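/- **Setting.** Let $M$ be a connected smooth $n$-manifold (Hausdorff, second countable), $F$ and $Z^0=G,Z^1,Z^2,\dots$ smooth real vector bundles of finite rank over $M$, and $e\colon\Gamma(F)\to\Gamma(G)$, $z^i\colon\Gamma(Z^i)\to\Gamma(Z^{i+1})$ linear differential operators. A *local section* $f\in\Gamma_F(H)$ is an operator $\psi\mapsto f[\psi]=f\circ j^k\psi$ with $f\colon J^kF\to H$ a smooth bundle map for some finite $k$; a *local horizontal $q$-form* $\omega\in\Omega^{q,0}(F)$ is a local section of $\Lambda^qT^*M$, with $(\mathrm d_h\omega)[\psi]=\mathrm d(\omega[\psi])$ and $\Omega^{-1,0}(F)=0$. The PDE manifold $\mathcal E^\infty\subset J^\infty F$ is the zero set of the prolongation $p_\infty e$; "on-shell" means on $\mathcal E^\infty$, and *null* means vanishing on-shell. **Local regularity.** A linear operator $e$ is a *regular equation form* if it has an order $k$ for which $e\colon J^kF\to G$ has constant rank and its zero set is the projection of $\mathcal E^\infty$ to $J^kF$ (involutivity), and if $\mathcal E^\infty$ is a smooth sub-bundle regularly cut out by $p_\infty e$: for every $m$ there is an $l$ such that $p_le$ has constant rank and the zero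 set of $p_le$ and $\mathcal E^\infty$ have the same projection to $J^mF$. The system $e[\psi]=0$, with Noether operators $z^i$, is *locally regular* if $e$ and all $z^i$ are regular equation forms, the sequence $J^\infty F\to J^\infty Z^0\to J^\infty Z^1\to\cdots$ of prolongations of $e,z^0,z^1,\dots$ is exact over each point of $M$ at every $J^\infty Z^i$ ($i\ge 0$), and $Z^i=0$ for all $i>r$, for some $r$. **Cohomology spaces.** For $0\le p\le n$: - $H^p_{\mathrm{src}}$ is the space of null $\rho\in\Omega^{n-p,0}(F)$ of the form $\rho=\mathrm d_hj$ with $j\in\Omega^{n-p-1,0}(F)$, modulo the local forms $\mathrm d_hj$ with $j$ null. - $H^0_{\mathrm{def}}$ is the space of $f\in\Gamma_F(G)$ with $z^0[f[\psi]]$ null, modulo the sums of $e[g[\psi]]$, $g\in\Gamma_F(F)$, and null sections. - $H^p_{\mathrm{cur}}$ is the space of $\omega\in\Omega^{n-p,0}(F)$ with $\mathrm d_h\omega=0$ on-shell, modulo the sums of a horizontally exact local form, a closed form on $M$ and a null form. **Theorem (Deformation currents).** Let $e[\psi]=0$ be locally regular and $0\le p\le n$. 1. Every null local $p$-source $\rho$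 can be written as $\rho[\psi]=\rho[\psi;e[\psi]]$, where $\rho[\psi;\zeta]$ is a local differential operator $\Gamma_F(G)\to\Omega^{n-p,0}(F)$ (a smooth function of the point and of finite jets of $\psi$ and $\zeta$) that is linear in $\zeta$. 2. There is a unique bilinear map $$j\colon H^p_{\mathrm{src}}\times H^0_{\mathrm{def}}\to H^p_{\mathrm{cur}}$$ such that, for every null $p$-source $\rho$, every on-shell consistent deformation $f$ and every operator $\rho[\psi;\zeta]$ as in 1, the form $j_{\rho,f}[\psi]=\rho[\psi;f[\psi]]$ is a local horizontal $(n-p)$-form with $\mathrm d_hj_{\rho,f}=0$ on-shell and $j([\rho],[f])=[j_{\rho,f}]$. In particular, the class $[j_{\rho,f}]$ depends neither on the representatives $\rho$ and $f$ nor on the choice of $\rho[\psi;\zeta]$. -/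

import Mathlib

open scoped Manifold ContDiff Topology
open Set Filter Bundle

universe u v w

noncomputable section

/-- A smooth real vector bundle of finite rank over the `n`-dimensional smooth manifold `M`. -/
structure SmoothVB (n : ℕ) (M : Type u) [TopologicalSpace M]
    [ChartedSpace (EuclideanSpace ℝ (Fin n)) M] where
  /-- the model fibre -/
  Model : Type v
  [modelGroup : NormedAddCommGroup Model]
  [modelSpace : NormedSpace ℝ Model]
  [modelFinite : FiniteDimensional ℝ Model]
  /-- the fibres -/
  Fiber : M → Type w
  [fiberTop : ∀ x, TopologicalSpace (Fiber x)]
  [fiberGroup : ∀ x, AddCommGroup (Fiber x)]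
  [fiberModule : ∀ x, Module ℝ (Fiber x)]
  [totalTop : TopologicalSpace (TotalSpace Model Fiber)]
  [fiberBundle : FiberBundle Model Fiber]
  [vectorBundle : VectorBundle ℝ Model Fiber]
  [smooth : ContMDiffVectorBundle ∞ Model Fiber (𝓡 n)]

attribute [instance] SmoothVB.modelGroup SmoothVB.modelSpace SmoothVB.modelFinite
  SmoothVB.fiberTop SmoothVB.fiberGroup SmoothVB.fiberModule SmoothVB.totalTop
  SmoothVB.fiberBundle SmoothVB.vectorBundle SmoothVB.smooth

section LocalGeometry

variable {n : ℕ} {M : Type u} [TopologicalSpace M] [ChartedSpace (EuclideanSpace ℝ (Fin n)) M]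

/-- The space `Γ(V)` of smooth global sections. -/
abbrev Sec (V : SmoothVB.{u, v, w} n M) : Type (max u w) :=
  ContMDiffSection (𝓡 n) V.Model ∞ V.Fiber

/-- Coordinates on the `k`-jets of `W`-valued functions on `ℝⁿ`: the derivatives of order `≤ k`. -/
abbrev JetSpace (n k : ℕ) (W : Type v) [NormedAddCommGroup W] [NormedSpace ℝ W] : Type v :=
  (i : Fin (k + 1)) →
    ContinuousMultilinearMap ℝ (fun _ : Fin (i : ℕ) => EuclideanSpace ℝ (Fin n)) W

/-- The `k`-jet at `y` of a function on `ℝⁿ`. -/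
def jet {W : Type v} [NormedAddCommGroup W] [NormedSpace ℝ W] (k : ℕ)
    (f : EuclideanSpace ℝ (Fin n) → W) (y : EuclideanSpace ℝ (Fin n)) : JetSpace n k W :=
  fun i => iteratedFDeriv ℝ (i : ℕ) f y

/-- The expression of a section in the preferred chart and trivialization at `x₀`. -/
def secRep (V : SmoothVB.{u, v, w} n M) (s : Sec V) (x₀ : M) :
    EuclideanSpace ℝ (Fin n) → V.Model :=
  fun y => (trivializationAt V.Model V.Fiber x₀
    ⟨(extChartAt (𝓡 n) x₀).symm y, s ((extChartAt (𝓡 n) x₀).symm y)⟩).2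

/-- Fields of alternating `q`-forms on the tangent spaces of `M` (no regularity imposed). -/
def FormField (n : ℕ) (M : Type u) [TopologicalSpace M]
    [ChartedSpace (EuclideanSpace ℝ (Fin n)) M] (q : ℕ) : Type u :=
  (x : M) → ContinuousAlternatingMap ℝ (TangentSpace (𝓡 n) x) ℝ (Fin q)

instance (q : ℕ) : AddCommGroup (FormField n M q) :=
  inferInstanceAs (AddCommGroup
    ((x : M) → ContinuousAlternatingMap ℝ (TangentSpace (𝓡 n) x) ℝ (Fin q)))

instance (q : ℕ) : Module ℝ (FormField n M q) :=
  inferInstanceAs (Module ℝ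
    ((x : M) → ContinuousAlternatingMap ℝ (TangentSpace (𝓡 n) x) ℝ (Fin q)))

@[simp] lemma FormField.add_apply {q : ℕ} (α β : FormField n M q) (x : M) :
    (α + β) x = α x + β x := rfl

@[simp] lemma FormField.zero_apply {q : ℕ} (x : M) : (0 : FormField n M q) x = 0 := rfl

@[simp] lemma FormField.smul_apply {q : ℕ} (c : ℝ) (α : FormField n M q) (x : M) :
    (c • α) x = c • α x := rfl

/-- The expression of a form in the preferred chart `φ` at `x₀`, that is, its pullback
along `φ⁻¹`. -/
def formRep {q : ℕ} (α : FormField n M q) (x₀ : M) :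
    EuclideanSpace ℝ (Fin n) →
      ContinuousAlternatingMap ℝ (EuclideanSpace ℝ (Fin n)) ℝ (Fin q) :=
  fun y => (α ((extChartAt (𝓡 n) x₀).symm y)).compContinuousLinearMap
    (mfderiv (𝓡 n) (𝓡 n) (extChartAt (𝓡 n) x₀).symm y)

/-- The exterior derivative at `x`, computed in the preferred chart `φ` at `x`:
`(dα)ₓ = φ^* d((φ⁻¹)^* α)`. -/
def extD {q : ℕ} (α : FormField n M q) : FormField n M (q + 1) :=
  fun x => (extDeriv (formRep α x) (extChartAt (𝓡 n) x x)).compContinuousLinearMap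
    (mfderiv (𝓡 n) (𝓡 n) (extChartAt (𝓡 n) x) x)

/-- Near `x₀`, in coordinates, `out ψ` is a smooth function of the point and of the `k`-jet
of `ψ`. -/
def DependsOnJet (F : SmoothVB.{u, v, w} n M) (k : ℕ) (x₀ : M) {W : Type*}
    [NormedAddCommGroup W] [NormedSpace ℝ W]
    (out : Sec F → EuclideanSpace ℝ (Fin n) → W) : Prop :=
  ∃ U : Set (EuclideanSpace ℝ (Fin n)), IsOpen U ∧ extChartAt (𝓡 n) x₀ x₀ ∈ U ∧
    ∃ A : EuclideanSpace ℝ (Fin n) × JetSpace n k F.Model → W,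
      ContDiffOn ℝ ∞ A (U ×ˢ univ) ∧
      ∀ ψ : Sec F, ∀ y ∈ U, out ψ y = A (y, jet k (secRep F ψ x₀) y)

/-- `f` is a (possibly non-linear) differential operator `Γ(F) → Γ(G)` of order `≤ k`, that is,
`f[ψ] = f ∘ j^k ψ` for a smooth bundle map `f : J^k F → G`. -/
def IsDiffOp {F G : SmoothVB.{u, v, w} n M} (k : ℕ) (f : Sec F → Sec G) : Prop :=
  ∀ x₀ : M, DependsOnJet F k x₀ (fun ψ => secRep G (f ψ) x₀)

/-- `α` is given by a smooth bundle map `J^k F → Λ^q T^*M`. -/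
def IsDiffOpForm {F : SmoothVB.{u, v, w} n M} {q : ℕ} (k : ℕ)
    (α : Sec F → FormField n M q) : Prop :=
  ∀ x₀ : M, DependsOnJet F k x₀ (fun ψ => formRep (α ψ) x₀)

lemma DependsOnJet.mono {F : SmoothVB.{u, v, w} n M} {k l : ℕ} (hkl : k ≤ l) {x₀ : M} {W : Type*}
    [NormedAddCommGroup W] [NormedSpace ℝ W]
    {out : Sec F → EuclideanSpace ℝ (Fin n) → W} (h : DependsOnJet F k x₀ out) :
    DependsOnJet F l x₀ out := by
  obtain ⟨U, hU, hx, A, hA, hAo⟩ := h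
  refine ⟨U, hU, hx, fun p => A (p.1, fun i => p.2 (Fin.castLE (by omega) i)), ?_, ?_⟩
  · refine hA.comp (t := U ×ˢ univ) (s := U ×ˢ univ)
      (f := fun p : EuclideanSpace ℝ (Fin n) × JetSpace n l F.Model =>
        ((p.1, fun i => p.2 (Fin.castLE (by omega) i)) :
          EuclideanSpace ℝ (Fin n) × JetSpace n k F.Model)) ?_ ?_
    · refine ContDiff.contDiffOn (contDiff_fst.prodMk (contDiff_pi.2 fun i => ?_))
      exact (ContinuousLinearMap.proj (R := ℝ)
        (φ := fun i : Fin (l + 1) => ContinuousMultilinearMap ℝ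
          (fun _ : Fin (i : ℕ) => EuclideanSpace ℝ (Fin n)) F.Model)
        (Fin.castLE (by omega : k + 1 ≤ l + 1) i)).contDiff.comp contDiff_snd
    · rintro ⟨y, j⟩ ⟨hy, -⟩
      exact ⟨hy, mem_univ _⟩
  · intro ψ y hy
    exact hAo ψ y hy

lemma DependsOnJet.congr {F : SmoothVB.{u, v, w} n M} {k : ℕ} {x₀ : M} {W : Type*}
    [NormedAddCommGroup W] [NormedSpace ℝ W]
    {out out' : Sec F → EuclideanSpace ℝ (Fin n) → W} (h : DependsOnJet F k x₀ out)
    (he : ∀ᶠ y in 𝓝 (extChartAt (𝓡 n) x₀ x₀), ∀ ψ, out' ψ y = out ψ y) :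
    DependsOnJet F k x₀ out' := by
  obtain ⟨U, hU, hx, A, hA, hAo⟩ := h
  obtain ⟨V, hV, hVo, hxV⟩ := eventually_nhds_iff.1 he
  refine ⟨U ∩ V, hU.inter hVo, ⟨hx, hxV⟩, A,
    hA.mono (prod_mono inter_subset_left subset_rfl), fun ψ y hy => ?_⟩
  rw [hV y hy.2, hAo ψ y hy.1]

lemma DependsOnJet.add {F : SmoothVB.{u, v, w} n M} {k : ℕ} {x₀ : M} {W : Type*}
    [NormedAddCommGroup W] [NormedSpace ℝ W]
    {out out' : Sec F → EuclideanSpace ℝ (Fin n) → W} (h : DependsOnJet F k x₀ out)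
    (h' : DependsOnJet F k x₀ out') :
    DependsOnJet F k x₀ (fun ψ y => out ψ y + out' ψ y) := by
  obtain ⟨U, hU, hx, A, hA, hAo⟩ := h
  obtain ⟨V, hV, hxV, B, hB, hBo⟩ := h'
  refine ⟨U ∩ V, hU.inter hV, ⟨hx, hxV⟩, fun p => A p + B p,
    (hA.mono (prod_mono inter_subset_left subset_rfl)).add
      (hB.mono (prod_mono inter_subset_right subset_rfl)), fun ψ y hy => ?_⟩
  simp only [hAo ψ y hy.1, hBo ψ y hy.2]

lemma DependsOnJet.smul {F : SmoothVB.{u, v, w} n M} {k : ℕ} {x₀ : M} {W : Type*}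
    [NormedAddCommGroup W] [NormedSpace ℝ W]
    {out : Sec F → EuclideanSpace ℝ (Fin n) → W} (c : ℝ) (h : DependsOnJet F k x₀ out) :
    DependsOnJet F k x₀ (fun ψ y => c • out ψ y) := by
  obtain ⟨U, hU, hx, A, hA, hAo⟩ := h
  refine ⟨U, hU, hx, fun p => c • A p, contDiffOn_const.smul hA, fun ψ y hy => ?_⟩
  simp only [hAo ψ y hy]

lemma DependsOnJet.zero {F : SmoothVB.{u, v, w} n M} {k : ℕ} {x₀ : M} {W : Type*}
    [NormedAddCommGroup W] [NormedSpace ℝ W] :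
    DependsOnJet F k x₀ (fun _ _ => (0 : W)) :=
  ⟨univ, isOpen_univ, mem_univ _, fun _ => 0, contDiffOn_const, fun _ _ _ => rfl⟩

lemma eventually_mem_baseSet (V : SmoothVB.{u, v, w} n M) (x₀ : M) :
    ∀ᶠ y in 𝓝 (extChartAt (𝓡 n) x₀ x₀),
      (extChartAt (𝓡 n) x₀).symm y ∈ (trivializationAt V.Model V.Fiber x₀).baseSet := by
  have hc := (continuousAt_extChartAt_symm (I := 𝓡 n) x₀)
  refine hc.eventually_mem ?_
  rw [extChartAt_to_inv]
  exact (trivializationAt V.Model V.Fiber x₀).open_baseSet.mem_nhds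
    (mem_baseSet_trivializationAt _ _ x₀)

lemma secRep_add_eventually (V : SmoothVB.{u, v, w} n M) (x₀ : M) :
    ∀ᶠ y in 𝓝 (extChartAt (𝓡 n) x₀ x₀), ∀ s t : Sec V,
      secRep V (s + t) x₀ y = secRep V s x₀ y + secRep V t x₀ y := by
  filter_upwards [eventually_mem_baseSet V x₀] with y hy s t
  exact ((trivializationAt V.Model V.Fiber x₀).linear ℝ hy).map_add _ _

lemma secRep_smul_eventually (V : SmoothVB.{u, v, w} n M) (x₀ : M) (c : ℝ) :
    ∀ᶠ y in 𝓝 (extChartAt (𝓡 n) x₀ x₀), ∀ s : Sec V,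
      secRep V (c • s) x₀ y = c • secRep V s x₀ y := by
  filter_upwards [eventually_mem_baseSet V x₀] with y hy s
  exact ((trivializationAt V.Model V.Fiber x₀).linear ℝ hy).map_smul _ _

lemma secRep_contDiffAt (V : SmoothVB.{u, v, w} n M) (s : Sec V) [IsManifold (𝓡 n) ∞ M] (x₀ : M) :
    ContDiffAt ℝ ∞ (secRep V s x₀) (extChartAt (𝓡 n) x₀ x₀) := by
  have h := (Bundle.contMDiffAt_section (IB := 𝓡 n) (n := ∞) (F := V.Model) (E := V.Fiber)
    (s := fun x => s x) x₀).1 (s.contMDiff x₀)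
  have h2 := (contMDiffAt_iff.1 h).2
  simp only [extChartAt_model_space_eq_id, PartialEquiv.refl_coe, Function.comp_def, id_eq,
    modelWithCornersSelf_coe, range_id, contDiffWithinAt_univ] at h2
  exact h2

/-- The `k`-jet of a section at a point `x`, in the preferred coordinates at `x`. -/
def jetAt (V : SmoothVB.{u, v, w} n M) [IsManifold (𝓡 n) ∞ M] (k : ℕ) (x : M) :
    Sec V →ₗ[ℝ] JetSpace n k V.Model where
  toFun s := jet k (secRep V s x) (extChartAt (𝓡 n) x x)
  map_add' s t := by
    funext i
    have h : secRep V (s + t) x =ᶠ[𝓝 (extChartAt (𝓡 n) x x)] (secRep V s x + secRep V t x) := by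
      filter_upwards [secRep_add_eventually V x] with y hy
      exact hy s t
    have hs := (secRep_contDiffAt V s x).of_le (m := ((i : ℕ) : ℕ∞ω)) (by exact_mod_cast le_top)
    have ht := (secRep_contDiffAt V t x).of_le (m := ((i : ℕ) : ℕ∞ω)) (by exact_mod_cast le_top)
    simp only [jet, Pi.add_apply]
    rw [(h.iteratedFDeriv ℝ (i : ℕ)).eq_of_nhds, iteratedFDeriv_add_apply hs ht]
  map_smul' c s := by
    funext i
    have h : secRep V (c • s) x =ᶠ[𝓝 (extChartAt (𝓡 n) x x)] (c • secRep V s x) := by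
      filter_upwards [secRep_smul_eventually V x c] with y hy
      exact hy s
    have hs := (secRep_contDiffAt V s x).of_le (m := ((i : ℕ) : ℕ∞ω)) (by exact_mod_cast le_top)
    simp only [jet, Pi.smul_apply, RingHom.id_apply]
    rw [(h.iteratedFDeriv ℝ (i : ℕ)).eq_of_nhds, iteratedFDeriv_const_smul_apply hs]

/-- The `∞`-jet of the section `s` vanishes at `x`. Since every `∞`-jet at `x` is the jet of a
smooth section (Borel), `J^∞_x V` is the quotient of `Γ(V)` by the sections that are flat at `x`. -/
def IsFlatAt (V : SmoothVB.{u, v, w} n M) [IsManifold (𝓡 n) ∞ M] (s : Sec V) (x : M) : Prop :=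
  ∀ k : ℕ, jetAt V k x s = 0

variable [IsManifold (𝓡 n) ∞ M]

/-- The space `Γ_F(G)` of `F`-local sections of `G`, each viewed as the differential operator
`ψ ↦ f[ψ]`. -/
def LocalSec (F G : SmoothVB.{u, v, w} n M) : Submodule ℝ (Sec F → Sec G) where
  carrier := {f | ∃ k, IsDiffOp k f}
  add_mem' := by
    rintro f g ⟨k, hf⟩ ⟨l, hg⟩
    refine ⟨max k l, fun x₀ => ?_⟩
    refine (((hf x₀).mono (le_max_left k l)).add ((hg x₀).mono (le_max_right k l))).congr ?_
    filter_upwards [secRep_add_eventually G x₀] with y hy ψ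
    exact hy _ _
  zero_mem' := by
    refine ⟨0, fun x₀ => ?_⟩
    refine DependsOnJet.zero.congr ?_
    filter_upwards [secRep_smul_eventually G x₀ 0] with y hy ψ
    simpa using hy 0
  smul_mem' := by
    rintro c f ⟨k, hf⟩
    refine ⟨k, fun x₀ => ?_⟩
    refine ((hf x₀).smul c).congr ?_
    filter_upwards [secRep_smul_eventually G x₀ c] with y hy ψ
    exact hy _

/-- The space `Ω^{q,0}(F)` of local horizontal `q`-forms, each viewed as the differential operator
`ψ ↦ α[ψ]`. -/
def LocalForm (F : SmoothVB.{u, v, w} n M) (q : ℕ) : Submodule ℝ (Sec F → FormField n M q) where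
  carrier := {α | ∃ k, IsDiffOpForm k α}
  add_mem' := by
    rintro f g ⟨k, hf⟩ ⟨l, hg⟩
    exact ⟨max k l, fun x₀ => ((hf x₀).mono (le_max_left k l)).add
      ((hg x₀).mono (le_max_right k l))⟩
  zero_mem' := ⟨0, fun x₀ => DependsOnJet.zero⟩
  smul_mem' := by
    rintro c f ⟨k, hf⟩
    exact ⟨k, fun x₀ => (hf x₀).smul c⟩

lemma contDiffAt_jet (V : SmoothVB.{u, v, w} n M) (s : Sec V) (k : ℕ) (x₀ : M) :
    ContDiffAt ℝ ∞ (fun y => jet k (secRep V s x₀) y) (extChartAt (𝓡 n) x₀ x₀) := by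
  refine contDiffAt_pi.2 fun i => ?_
  exact (secRep_contDiffAt V s x₀).iteratedFDeriv_right (m := ∞) (by exact_mod_cast le_top)

lemma formRep_differentiableAt {F : SmoothVB.{u, v, w} n M} {q : ℕ} (α : LocalForm F q)
    (ψ : Sec F) (x₀ : M) :
    DifferentiableAt ℝ (formRep (α.1 ψ) x₀) (extChartAt (𝓡 n) x₀ x₀) := by
  obtain ⟨k, hk⟩ := α.2
  obtain ⟨U, hU, hx, A, hA, hAo⟩ := hk x₀
  have hA' : ContDiffAt ℝ ∞ A
      (extChartAt (𝓡 n) x₀ x₀, jet k (secRep F ψ x₀) (extChartAt (𝓡 n) x₀ x₀)) :=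
    hA.contDiffAt ((hU.prod isOpen_univ).mem_nhds ⟨hx, mem_univ _⟩)
  have h : ContDiffAt ℝ ∞ (fun y => A (y, jet k (secRep F ψ x₀) y)) (extChartAt (𝓡 n) x₀ x₀) :=
    hA'.comp (extChartAt (𝓡 n) x₀ x₀) (contDiffAt_id.prodMk (contDiffAt_jet F ψ k x₀))
  refine (h.differentiableAt (by simp)).congr_of_eventuallyEq ?_
  filter_upwards [hU.mem_nhds hx] with y hy
  exact hAo ψ y hy

/-- The horizontal differential: `(d_h α)[ψ] = d(α[ψ])`. -/
def dH (F : SmoothVB.{u, v, w} n M) (q : ℕ) :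
    LocalForm F q →ₗ[ℝ] (Sec F → FormField n M (q + 1)) where
  toFun α := fun ψ => extD (α.1 ψ)
  map_add' α η := by
    funext ψ x
    have h : formRep ((α + η).1 ψ) x = formRep (α.1 ψ) x + formRep (η.1 ψ) x := rfl
    simp only [extD, h, Pi.add_apply]
    rw [extDeriv_add (formRep_differentiableAt α ψ x) (formRep_differentiableAt η ψ x)]
    rfl
  map_smul' c α := by
    funext ψ x
    have h : formRep ((c • α).1 ψ) x = c • formRep (α.1 ψ) x := rfl
    simp only [extD, h, Pi.smul_apply, RingHom.id_apply]
    rw [extDeriv_smul]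
    rfl

/-- The local horizontal `q`-forms `d_h j`, with `j` in the given spaces `N` of local forms
(there are no forms of degree `-1`). -/
def hExact (F : SmoothVB.{u, v, w} n M)
    (N : ∀ q, Submodule ℝ (Sec F → FormField n M q)) :
    ∀ q, Submodule ℝ (Sec F → FormField n M q)
  | 0 => ⊥
  | q + 1 => LocalForm F (q + 1) ⊓ ((N q).submoduleOf (LocalForm F q)).map (dH F q)

end LocalGeometry

section Equations

variable {n : ℕ} {M : Type u} [TopologicalSpace M] [ChartedSpace (EuclideanSpace ℝ (Fin n)) M]
  [IsManifold (𝓡 n) ∞ M] {F G : SmoothVB.{u, v, w} n M}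

/-- The `∞`-jet of `ψ` at `x` lies on the PDE manifold `E^∞ ⊆ J^∞ F`, the zero set of the
`∞`-prolongation of the linear operator `e`. -/
def OnShell (e : Sec F →ₗ[ℝ] Sec G) (ψ : Sec F) (x : M) : Prop :=
  IsFlatAt G (e ψ) x

/-- The `l`-prolongation `p_l e : J^{k+l} F → J^l G` has constant rank. (The image of its fibre
over `x` consists of the `l`-jets at `x` of the sections `e ψ`.) -/
def ProlongationHasConstantRank (e : Sec F →ₗ[ℝ] Sec G) (l : ℕ) : Prop :=
  ∃ d : ℕ, ∀ x : M, Module.finrank ℝ (LinearMap.range (jetAt G l x ∘ₗ e)) = d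

/-- The zero set of `p_l e` and the PDE manifold `E^∞` have the same projection to `J^m F`. -/
def ProlongationCutsOut (e : Sec F →ₗ[ℝ] Sec G) (l m : ℕ) : Prop :=
  ∀ (x : M) (ψ : Sec F), jetAt G l x (e ψ) = 0 →
    ∃ ψ' : Sec F, OnShell e ψ' x ∧ jetAt F m x ψ' = jetAt F m x ψ

/-- The linear operator `e` is a regular equation form: it has an order `k` such that
the bundle map `e : J^k F → G` has constant rank, its zero set is the projection of `E^∞`
(involutivity), and `E^∞` is a smooth sub-bundle, regularly cut out by the prolongations of `e`:
its projection to any finite jet bundle is that of the zero set of a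
finite prolongation of constant rank. -/
structure IsRegularForm (e : Sec F →ₗ[ℝ] Sec G) : Prop where
  involutive : ∃ k : ℕ, IsDiffOp k (fun ψ => e ψ) ∧ ProlongationHasConstantRank e 0 ∧
    ProlongationCutsOut e 0 k
  subbundle : ∀ m : ℕ, ∃ l : ℕ, ProlongationHasConstantRank e l ∧ ProlongationCutsOut e l m

/-- The linear system `e ψ = 0` with equation bundle `Z 0`, Noether bundles `Z 1, Z 2, …` and
linear Noether operators `z i` is locally regular: all operators are regular equation forms, the
Noether complex is formally exact (the induced sequence of `∞`-jets is exact at every point and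
every stage) and it terminates, i.e. the system is stage-`r` irreducible for some `r`. -/
structure IsLocallyRegular {Z : ℕ → SmoothVB.{u, v, w} n M} (e : Sec F →ₗ[ℝ] Sec (Z 0))
    (z : ∀ i, Sec (Z i) →ₗ[ℝ] Sec (Z (i + 1))) : Prop where
  regular : IsRegularForm e
  regular_noether : ∀ i, IsRegularForm (z i)
  exact_zero : ∀ (x : M) (ζ : Sec (Z 0)),
    IsFlatAt (Z 1) (z 0 ζ) x ↔ ∃ ξ : Sec F, IsFlatAt (Z 0) (ζ - e ξ) x
  exact_succ : ∀ (i : ℕ) (x : M) (ζ : Sec (Z (i + 1))),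
    IsFlatAt (Z (i + 2)) (z (i + 1) ζ) x ↔
      ∃ ξ : Sec (Z i), IsFlatAt (Z (i + 1)) (ζ - z i ξ) x
  irreducible : ∃ r : ℕ, ∀ i, r < i → ∀ x : M, Subsingleton ((Z i).Fiber x)

/-! ### Null sources -/

/-- Null local horizontal `q`-forms: those that vanish on `E^∞`. -/
def nullForms (e : Sec F →ₗ[ℝ] Sec G) (q : ℕ) : Submodule ℝ (Sec F → FormField n M q) where
  carrier := {α | α ∈ LocalForm F q ∧ ∀ ψ x, OnShell e ψ x → α ψ x = 0}
  add_mem' := by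
    rintro a b ⟨hal, ha⟩ ⟨hbl, hb⟩
    refine ⟨add_mem hal hbl, fun ψ x h => ?_⟩
    rw [Pi.add_apply, FormField.add_apply, ha ψ x h, hb ψ x h, add_zero]
  zero_mem' := ⟨zero_mem _, fun _ _ _ => rfl⟩
  smul_mem' := by
    rintro c a ⟨hal, ha⟩
    refine ⟨Submodule.smul_mem _ c hal, fun ψ x h => ?_⟩
    rw [Pi.smul_apply, FormField.smul_apply, ha ψ x h, smul_zero]

/-- Null sources of form degree `q`: horizontally exact and vanishing on `E^∞`. -/
def nullSources (e : Sec F →ₗ[ℝ] Sec G) (q : ℕ) : Submodule ℝ (Sec F → FormField n M q) :=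
  hExact F (LocalForm F) q ⊓ nullForms e q

/-- Trivial null sources: `d_h j` with `j` vanishing on `E^∞`. -/
def trivialSources (e : Sec F →ₗ[ℝ] Sec G) (q : ℕ) : Submodule ℝ (Sec F → FormField n M q) :=
  hExact F (nullForms e) q

/-- The space `H^p_src` of classes of null local `p`-sources. -/
abbrev Hsrc (e : Sec F →ₗ[ℝ] Sec G) (p : ℕ) : Type _ :=
  nullSources e (n - p) ⧸ (trivialSources e (n - p)).submoduleOf (nullSources e (n - p))

/-! ### Conserved currents -/

/-- Local horizontal `q`-forms that are horizontally closed on `E^∞`. -/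
def conservedCurrents (e : Sec F →ₗ[ℝ] Sec G) (q : ℕ) :
    Submodule ℝ (Sec F → FormField n M q) where
  carrier := {α | ∃ h : α ∈ LocalForm F q, ∀ ψ x, OnShell e ψ x → dH F q ⟨α, h⟩ ψ x = 0}
  add_mem' := by
    rintro a b ⟨hal, ha⟩ ⟨hbl, hb⟩
    refine ⟨add_mem hal hbl, fun ψ x h => ?_⟩
    change dH F q (⟨a, hal⟩ + ⟨b, hbl⟩) ψ x = 0
    rw [map_add, Pi.add_apply, FormField.add_apply, ha ψ x h, hb ψ x h, add_zero]
  zero_mem' := by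
    refine ⟨zero_mem _, fun ψ x _ => ?_⟩
    change dH F q 0 ψ x = 0
    rw [map_zero]
    rfl
  smul_mem' := by
    rintro c a ⟨hal, ha⟩
    refine ⟨Submodule.smul_mem _ c hal, fun ψ x h => ?_⟩
    change dH F q (c • ⟨a, hal⟩) ψ x = 0
    rw [map_smul, Pi.smul_apply, FormField.smul_apply, ha ψ x h, smul_zero]

/-- Field-independent closed local forms, that is, closed `q`-forms on `M`. -/
def closedFormsOnBase (F : SmoothVB.{u, v, w} n M) (q : ℕ) :
    Submodule ℝ (Sec F → FormField n M q) where
  carrier := {α | ∃ h : α ∈ LocalForm F q, (∀ ψ ψ', α ψ = α ψ') ∧ dH F q ⟨α, h⟩ = 0}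
  add_mem' := by
    rintro a b ⟨hal, ha, ha'⟩ ⟨hbl, hb, hb'⟩
    refine ⟨add_mem hal hbl, fun ψ ψ' => ?_, ?_⟩
    · rw [Pi.add_apply, Pi.add_apply, ha ψ ψ', hb ψ ψ']
    · change dH F q (⟨a, hal⟩ + ⟨b, hbl⟩) = 0
      rw [map_add, ha', hb', add_zero]
  zero_mem' := ⟨zero_mem _, fun _ _ => rfl, map_zero (dH F q)⟩
  smul_mem' := by
    rintro c a ⟨hal, ha, ha'⟩
    refine ⟨Submodule.smul_mem _ c hal, fun ψ ψ' => ?_, ?_⟩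
    · rw [Pi.smul_apply, Pi.smul_apply, ha ψ ψ']
    · change dH F q (c • ⟨a, hal⟩) = 0
      rw [map_smul, ha', smul_zero]

/-- Trivial currents: those that on `E^∞` are the sum of a horizontally exact form and
of a closed form on `M`. -/
def trivialCurrents (e : Sec F →ₗ[ℝ] Sec G) (q : ℕ) : Submodule ℝ (Sec F → FormField n M q) :=
  hExact F (LocalForm F) q ⊔ closedFormsOnBase F q ⊔ nullForms e q

/-- The space `H^p_cur = H^{n-p}_char / H^{n-p}_dR(M)` of classes of conserved local
`p`-currents. -/
abbrev Hcur (e : Sec F →ₗ[ℝ] Sec G) (p : ℕ) : Type _ :=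
  conservedCurrents e (n - p) ⧸
    (trivialCurrents e (n - p)).submoduleOf (conservedCurrents e (n - p))

/-! ### Consistent deformations -/

/-- Null local sections of `H`: those that vanish on `E^∞`. -/
def nullSec (e : Sec F →ₗ[ℝ] Sec G) (H : SmoothVB.{u, v, w} n M) :
    Submodule ℝ (Sec F → Sec H) where
  carrier := {f | f ∈ LocalSec F H ∧ ∀ ψ x, OnShell e ψ x → f ψ x = 0}
  add_mem' := by
    rintro a b ⟨hal, ha⟩ ⟨hbl, hb⟩
    refine ⟨add_mem hal hbl, fun ψ x h => ?_⟩
    rw [Pi.add_apply, ContMDiffSection.coe_add, Pi.add_apply, ha ψ x h, hb ψ x h, add_zero]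
  zero_mem' := ⟨zero_mem _, fun _ _ _ => rfl⟩
  smul_mem' := by
    rintro c a ⟨hal, ha⟩
    refine ⟨Submodule.smul_mem _ c hal, fun ψ x h => ?_⟩
    rw [Pi.smul_apply, ContMDiffSection.coe_smul, Pi.smul_apply, ha ψ x h, smul_zero]

/-- Stage-0 on-shell consistent deformations: local sections `f` of `G` such that `z⁰[f[ψ]]`
vanishes on `E^∞`. -/
def deformations {Z : SmoothVB.{u, v, w} n M} (e : Sec F →ₗ[ℝ] Sec G) (z₀ : Sec G →ₗ[ℝ] Sec Z) :
    Submodule ℝ (Sec F → Sec G) where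
  carrier := {f | f ∈ LocalSec F G ∧ ∀ ψ x, OnShell e ψ x → z₀ (f ψ) x = 0}
  add_mem' := by
    rintro a b ⟨hal, ha⟩ ⟨hbl, hb⟩
    refine ⟨add_mem hal hbl, fun ψ x h => ?_⟩
    rw [Pi.add_apply, map_add, ContMDiffSection.coe_add, Pi.add_apply, ha ψ x h, hb ψ x h,
      add_zero]
  zero_mem' := by
    refine ⟨zero_mem _, fun ψ x _ => ?_⟩
    rw [Pi.zero_apply, map_zero]
    rfl
  smul_mem' := by
    rintro c a ⟨hal, ha⟩
    refine ⟨Submodule.smul_mem _ c hal, fun ψ x h => ?_⟩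
    rw [Pi.smul_apply, map_smul, ContMDiffSection.coe_smul, Pi.smul_apply, ha ψ x h, smul_zero]

/-- Trivial deformations: those that on `E^∞` are of the form `e[g[ψ]]`, with `g` a local section
of `F`. -/
def trivialDeformations (e : Sec F →ₗ[ℝ] Sec G) : Submodule ℝ (Sec F → Sec G) :=
  (LocalSec F F).map (e.compLeft (Sec F)) ⊔ nullSec e G

/-- The space `H^0_def` of stage-0 on-shell consistent deformation classes. -/
abbrev Hdef {Z : SmoothVB.{u, v, w} n M} (e : Sec F →ₗ[ℝ] Sec G) (z₀ : Sec G →ₗ[ℝ] Sec Z) :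
    Type _ :=
  deformations e z₀ ⧸ (trivialDeformations e).submoduleOf (deformations e z₀)

/-! ### Deformation currents -/

/-- `R[ψ; ζ]` is an `F`-local linear differential operator `Γ_F(G) → Ω^{q,0}(F)`: linear in `ζ`, and
in coordinates a smooth function of the point and of the jets of `ψ` and `ζ` of some
finite order. -/
def IsLocalLinearOp {q : ℕ} (R : Sec F → Sec G →ₗ[ℝ] FormField n M q) : Prop :=
  ∃ k : ℕ, ∀ x₀ : M, ∃ U : Set (EuclideanSpace ℝ (Fin n)),
    IsOpen U ∧ extChartAt (𝓡 n) x₀ x₀ ∈ U ∧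
    ∃ A : EuclideanSpace ℝ (Fin n) × JetSpace n k F.Model × JetSpace n k G.Model →
        ContinuousAlternatingMap ℝ (EuclideanSpace ℝ (Fin n)) ℝ (Fin q),
      ContDiffOn ℝ ∞ A (U ×ˢ univ) ∧
      ∀ (ψ : Sec F) (ζ : Sec G), ∀ y ∈ U,
        formRep (R ψ ζ) x₀ y = A (y, jet k (secRep F ψ x₀) y, jet k (secRep G ζ x₀) y)

/-- The local linear operator `R[ψ; ζ]` represents the form `ρ`, that is,
`ρ[ψ] = R[ψ; e[ψ]]`. -/
def RepresentsForm {q : ℕ} (e : Sec F →ₗ[ℝ] Sec G) (R : Sec F → Sec G →ₗ[ℝ] FormField n M q)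
    (ρ : Sec F → FormField n M q) : Prop :=
  IsLocalLinearOp R ∧ ∀ ψ, ρ ψ = R ψ (e ψ)

/-- The deformation current `j_{ρ,f}[ψ] = ρ[ψ; f[ψ]]`. -/
def deformationCurrent {q : ℕ} (R : Sec F → Sec G →ₗ[ℝ] FormField n M q) (f : Sec F → Sec G) :
    Sec F → FormField n M q :=
  fun ψ => R ψ (f ψ)

end Equations

end

noncomputable section

/-! ### Calculus in normed spaces -/

section Calculus

/-! Linearity in the equation. Let ρ be a null form of order m. Regularity gives a prolongation p_l
e of constant rank whose zero set has the same projection to m-jets as the PDE manifold. So near a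
point ρ vanishes on the kernels of a smooth family of linear maps L_y of constant rank. With T_y a
smooth generalized inverse of L_y, a jet splits as p = (p - T L p) + T L p, whose first summand lies
in the kernel. Hadamard's lemma between p - T L p and p then writes ρ as a smooth operator applied
linearly to L p, the l-jet of e[ψ] (`IsRegularForm.exists_local_factorization`). A partition of
unity glues these local formulas to an operator R[ψ;ζ] (`exists_representsForm`).

The key fact is that if R[ψ;e[ψ]] = 0 for all ψ, then R[ψ;f[ψ]] is null for every consistent
deformation f (`IsLocallyRegular.deformationCurrent_mem_nullForms`). Let ψ be on-shell at x. In the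
derivative at t = 0 of R[ψ+tξ; e[ψ]+t e[ξ]] at x, the term with e[ψ] vanishes for every t, because
e[ψ] is flat at x. Hence R[ψ;e[ξ]] = 0 at x for all ξ (`RepresentsForm.linearization_eq`). The null
section z⁰[f[ψ]] is even flat at x (`isFlatAt_of_mem_nullSec`), so formal exactness of the Noether
complex gives a ξ such that f[ψ] - e[ξ] is flat at x, and R does not see flat sections.

The rest follows from this fact and from the linearization. Two operators for the same ρ differ by
one that represents 0, so their currents differ by a null form. The operator d∘R represents dρ = 0,
so the current is conserved. If ρ = d_h j with j null and J represents j, then d∘J also represents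
ρ, so the current is d_h of J[ψ;f[ψ]] up to a null form. If f = e[g] + h with h null, then h
contributes a null form, and on-shell R[ψ;e[g]] is the linearization of ρ along g. When ρ = d_h j
this is d_h of the linearization of j along g (`extD_linearization`). -/

instance finiteDimensional_continuousMultilinearMap {E : Type*} [NormedAddCommGroup E]
    [NormedSpace ℝ E] [FiniteDimensional ℝ E] {W : Type*} [NormedAddCommGroup W] [NormedSpace ℝ W]
    [FiniteDimensional ℝ W] (k : ℕ) :
    FiniteDimensional ℝ (ContinuousMultilinearMap ℝ (fun _ : Fin k => E) W) :=
  Module.Finite.of_injective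
    (ContinuousMultilinearMap.toMultilinearMapLinear (R' := ℝ) (A := ℝ)
      (M₁ := fun _ : Fin k => E) (M₂ := W)) ContinuousMultilinearMap.toMultilinearMap_injective

instance finiteDimensional_continuousAlternatingMap {E : Type*} [NormedAddCommGroup E]
    [NormedSpace ℝ E] [FiniteDimensional ℝ E] {W : Type*} [NormedAddCommGroup W] [NormedSpace ℝ W]
    [FiniteDimensional ℝ W] (k : ℕ) :
    FiniteDimensional ℝ (ContinuousAlternatingMap ℝ E W (Fin k)) :=
  Module.Finite.of_injective
    (ContinuousAlternatingMap.toContinuousMultilinearMapCLM (𝕜 := ℝ) (E := E) (F := W)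
      (ι := Fin k) ℝ).toLinearMap ContinuousAlternatingMap.toContinuousMultilinearMap_injective

/-- The pullback of an alternating form along a linear map depends smoothly on both. -/
lemma contDiff_compContinuousLinearMap {E E' : Type*} [NormedAddCommGroup E] [NormedSpace ℝ E]
    [FiniteDimensional ℝ E] [NormedAddCommGroup E'] [NormedSpace ℝ E'] [FiniteDimensional ℝ E']
    (q : ℕ) :
    ContDiff ℝ ∞ (fun p : ContinuousAlternatingMap ℝ E' ℝ (Fin q) × (E →L[ℝ] E') =>
      p.1.compContinuousLinearMap p.2) := by
  -- Alternating maps sit in the multilinear maps as a subspace of finite dimension. Smoothness is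
  -- checked there and transported back by a linear retraction.
  obtain ⟨g, hg⟩ := LinearMap.exists_leftInverse_of_injective
    (ContinuousAlternatingMap.toContinuousMultilinearMapCLM (𝕜 := ℝ) (E := E) (F := ℝ)
      (ι := Fin q) ℝ).toLinearMap
    (LinearMap.ker_eq_bot.2 ContinuousAlternatingMap.toContinuousMultilinearMap_injective)
  have h : ContDiff ℝ ∞ (fun p : ContinuousAlternatingMap ℝ E' ℝ (Fin q) × (E →L[ℝ] E') =>
      ContinuousMultilinearMap.compContinuousLinearMapContinuousMultilinear ℝ
        (fun _ : Fin q => E) (fun _ => E') ℝ (fun _ => p.2) p.1.toContinuousMultilinearMap) := by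
    refine ContDiff.clm_apply ?_ ?_
    · exact (ContinuousMultilinearMap.contDiff _).comp (contDiff_pi.2 fun _ => contDiff_snd)
    · exact (ContinuousAlternatingMap.toContinuousMultilinearMapCLM (𝕜 := ℝ) (E := E') (F := ℝ)
        (ι := Fin q) ℝ).contDiff.comp contDiff_fst
  have h2 := g.toContinuousLinearMap.contDiff.comp h
  convert! h2 using 2 with p
  exact (LinearMap.congr_fun hg (p.1.compContinuousLinearMap p.2)).symm

/-- Differentiation under the integral sign. The derivative is again an integral of a smooth family,
which makes an induction on the order of differentiability possible. -/
lemma hasFDerivAt_integral_of_contDiffOn {P W : Type*} [NormedAddCommGroup P]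
    [NormedSpace ℝ P] [NormedAddCommGroup W] [NormedSpace ℝ W] {O : Set P} (hO : IsOpen O)
    {h : P × ℝ → W} (hh : ContDiffOn ℝ ∞ h (O ×ˢ univ)) {p₀ : P} (hp : p₀ ∈ O) :
    HasFDerivAt (fun p => ∫ s in (0 : ℝ)..1, h (p, s))
      (∫ s in (0 : ℝ)..1, (fderiv ℝ h (p₀, s)).comp (ContinuousLinearMap.inl ℝ P ℝ)) p₀ := by
  have hOu : IsOpen (O ×ˢ (univ : Set ℝ)) := hO.prod isOpen_univ
  have hD : ContinuousOn (fun z : P × ℝ =>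
      (fderiv ℝ h z).comp (ContinuousLinearMap.inl ℝ P ℝ)) (O ×ˢ univ) :=
    ((hh.fderiv_of_isOpen hOu (m := 0) (by simp)).clm_comp contDiffOn_const).continuousOn
  have hDs : ∀ p ∈ O, Continuous (fun s : ℝ =>
      (fderiv ℝ h (p, s)).comp (ContinuousLinearMap.inl ℝ P ℝ)) := fun p hp' =>
    hD.comp_continuous (Continuous.prodMk_right p) fun s => ⟨hp', mem_univ _⟩
  have hs : ∀ p ∈ O, Continuous (fun s : ℝ => h (p, s)) := fun p hp' =>
    hh.continuousOn.comp_continuous (Continuous.prodMk_right p) fun s => ⟨hp', mem_univ _⟩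
  -- `C` bounds the partial derivative at `p₀` over the compact interval. By compactness the bound
  -- `C + 1` then holds for all `p` near `p₀`, uniformly in `s`, and serves as the dominating
  -- constant.
  obtain ⟨C, hC⟩ := (isCompact_Icc (a := (0 : ℝ)) (b := 1)).bddAbove_image
    (hDs p₀ hp).norm.continuousOn
  have hev : ∀ᶠ p in 𝓝 p₀, ∀ s ∈ Icc (0 : ℝ) 1,
      ‖(fderiv ℝ h (p, s)).comp (ContinuousLinearMap.inl ℝ P ℝ)‖ < C + 1 := by
    refine (isCompact_Icc (a := (0 : ℝ)) (b := 1)).eventually_forall_of_forall_eventually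
      fun s hs' => ?_
    have hc : ContinuousAt (fun z : P × ℝ =>
        ‖(fderiv ℝ h z).comp (ContinuousLinearMap.inl ℝ P ℝ)‖) (p₀, s) :=
      (hD.continuousAt (hOu.mem_nhds ⟨hp, mem_univ _⟩)).norm
    exact hc.eventually_lt_const (lt_of_le_of_lt (hC ⟨s, hs', rfl⟩) (lt_add_one C))
  refine intervalIntegral.hasFDerivAt_integral_of_dominated_of_fderiv_le
    (s := {p | p ∈ O ∧ ∀ s ∈ Icc (0 : ℝ) 1,
      ‖(fderiv ℝ h (p, s)).comp (ContinuousLinearMap.inl ℝ P ℝ)‖ < C + 1})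
    (bound := fun _ => C + 1) (F := fun p s => h (p, s))
    (F' := fun p s => (fderiv ℝ h (p, s)).comp (ContinuousLinearMap.inl ℝ P ℝ))
    (Filter.Eventually.and (hO.mem_nhds hp) hev) ?_ ?_ ?_ ?_ ?_ ?_
  · filter_upwards [hO.mem_nhds hp] with p hp'
    exact (hs p hp').aestronglyMeasurable
  · exact (hs p₀ hp).intervalIntegrable _ _
  · exact (hDs p₀ hp).aestronglyMeasurable
  · refine Eventually.of_forall fun s hs' p hp' => (hp'.2 s ?_).le
    rw [uIoc_of_le zero_le_one] at hs'
    exact Ioc_subset_Icc_self hs'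
  · exact intervalIntegrable_const
  · refine Eventually.of_forall fun s _ p hp' => ?_
    have h1 : HasFDerivAt h (fderiv ℝ h (p, s)) (p, s) :=
      ((hh.contDiffAt (hOu.mem_nhds ⟨hp'.1, mem_univ _⟩)).differentiableAt
        (by simp)).hasFDerivAt
    exact h1.comp p (hasFDerivAt_prodMk_left p s)

/-- Smooth dependence of an integral on parameters. -/
lemma contDiffOn_integral {P : Type u} [NormedAddCommGroup P] [NormedSpace ℝ P] {O : Set P}
    (hO : IsOpen O) {W : Type (max u w)} [NormedAddCommGroup W] [NormedSpace ℝ W] {h : P × ℝ → W}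
    (hh : ContDiffOn ℝ ∞ h (O ×ˢ univ)) :
    ContDiffOn ℝ ∞ (fun p => ∫ s in (0 : ℝ)..1, h (p, s)) O := by
  refine contDiffOn_infty.2 fun m => ?_
  -- The derivative takes values in `P →L[ℝ] W`, so `W` has to vary. Its universe `max u w` is
  -- chosen so that this space lies in it again.
  induction m generalizing W with
  | zero =>
    refine contDiffOn_zero.2 fun p hp => ?_
    exact (hasFDerivAt_integral_of_contDiffOn hO hh hp).continuousAt.continuousWithinAt
  | succ m ih =>
    rw [Nat.cast_succ, contDiffOn_succ_iff_fderiv_of_isOpen hO]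
    refine ⟨fun p hp => (hasFDerivAt_integral_of_contDiffOn hO hh
      hp).differentiableAt.differentiableWithinAt, by simp, ?_⟩
    have h2 : ContDiffOn ℝ ∞ (fun z : P × ℝ =>
        (fderiv ℝ h z).comp (ContinuousLinearMap.inl ℝ P ℝ)) (O ×ˢ univ) :=
      (hh.fderiv_of_isOpen (hO.prod isOpen_univ) (by simp)).clm_comp contDiffOn_const
    exact (ih h2).congr fun p hp => (hasFDerivAt_integral_of_contDiffOn hO hh hp).fderiv

/-- Hadamard's lemma with parameters. -/
lemma exists_hadamard {X : Type} [NormedAddCommGroup X] [NormedSpace ℝ X] {V : Type v}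
    [NormedAddCommGroup V] [NormedSpace ℝ V] {W : Type w} [NormedAddCommGroup W] [NormedSpace ℝ W]
    [CompleteSpace W] {U : Set X} (hU : IsOpen U) {g : X × V → W}
    (hg : ContDiffOn ℝ ∞ g (U ×ˢ univ)) :
    ∃ K : X × V × V → (V →L[ℝ] W), ContDiffOn ℝ ∞ K (U ×ˢ univ) ∧
      ∀ y ∈ U, ∀ a b : V, g (y, a + b) - g (y, a) = K (y, a, b) b := by
  have hUu : IsOpen (U ×ˢ (univ : Set V)) := hU.prod isOpen_univ
  have hUu' : IsOpen (U ×ˢ (univ : Set (V × V))) := hU.prod isOpen_univ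
  have hh : ContDiffOn ℝ ∞ (fun z : (X × V × V) × ℝ =>
      (fderiv ℝ g (z.1.1, z.1.2.1 + z.2 • z.1.2.2)).comp (ContinuousLinearMap.inr ℝ X V))
      ((U ×ˢ univ) ×ˢ univ) := by
    refine ContDiffOn.clm_comp ?_ contDiffOn_const
    refine (hg.fderiv_of_isOpen hUu (m := ∞) (by simp)).comp (ContDiff.contDiffOn ?_) ?_
    · fun_prop
    · rintro z ⟨⟨hz, -⟩, -⟩
      exact ⟨hz, mem_univ _⟩
  -- `K (y, a, b)` is the integral over `s ∈ [0, 1]` of the partial derivative of `g` at `(y, a + s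
  -- • b)`.
  refine ⟨_, contDiffOn_integral.{v, w} hUu' hh, fun y hy a b => ?_⟩
  have hcont : Continuous (fun s : ℝ => (fderiv ℝ g (y, a + s • b)).comp
      (ContinuousLinearMap.inr ℝ X V)) :=
    hh.continuousOn.comp_continuous (f := fun s : ℝ => ((y, a, b), s))
      (Continuous.prodMk_right _) fun s => ⟨⟨hy, mem_univ _⟩, mem_univ _⟩
  have hd : ∀ s : ℝ, HasDerivAt (fun s : ℝ => g (y, a + s • b))
      ((fderiv ℝ g (y, a + s • b)).comp (ContinuousLinearMap.inr ℝ X V) b) s := by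
    intro s
    have h1 : HasFDerivAt g (fderiv ℝ g (y, a + s • b)) (y, a + s • b) :=
      ((hg.contDiffAt (hUu.mem_nhds ⟨hy, mem_univ _⟩)).differentiableAt (by simp)).hasFDerivAt
    have h2 : HasDerivAt (fun s : ℝ => (y, a + s • b)) ((0 : X), b) s := by
      refine (hasDerivAt_const s y).prodMk ?_
      simpa using ((hasDerivAt_id s).smul_const b).const_add a
    exact h1.comp_hasDerivAt s h2
  have h3 := intervalIntegral.integral_eq_sub_of_hasDerivAt (a := 0) (b := 1)
    (fun s _ => hd s) ((hcont.clm_apply continuous_const).intervalIntegrable _ _)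
  simp only [one_smul, zero_smul, add_zero] at h3
  rw [← h3, ContinuousLinearMap.intervalIntegral_apply (hcont.intervalIntegrable _ _)]

/-- A family of linear maps of constant rank has a smooth local family of generalized inverses. -/
lemma exists_generalized_inverse {X V W : Type*} [NormedAddCommGroup X] [NormedSpace ℝ X]
    [NormedAddCommGroup V] [NormedSpace ℝ V] [FiniteDimensional ℝ V] [NormedAddCommGroup W]
    [NormedSpace ℝ W] [FiniteDimensional ℝ W] {U : Set X} (hU : IsOpen U) {L : X → V →L[ℝ] W}
    (hL : ContDiffOn ℝ ∞ L U) {d : ℕ}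
    (hd : ∀ y ∈ U, Module.finrank ℝ (LinearMap.range (L y).toLinearMap) = d) {x₀ : X}
    (hx : x₀ ∈ U) :
    ∃ U' ⊆ U, IsOpen U' ∧ x₀ ∈ U' ∧ ∃ T : X → W →L[ℝ] V, ContDiffOn ℝ ∞ T U' ∧
      ∀ y ∈ U', ∀ v, L y (T y (L y v)) = L y v := by
  obtain ⟨C, hC⟩ := Submodule.exists_isCompl (LinearMap.ker (L x₀).toLinearMap)
  set I : Submodule ℝ W := LinearMap.range (L x₀).toLinearMap with hI
  obtain ⟨q, hq⟩ := LinearMap.exists_leftInverse_of_injective I.subtype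
    (LinearMap.ker_eq_bot.2 I.injective_subtype)
  have hqI : ∀ w : W, ∀ hw : w ∈ I, q w = ⟨w, hw⟩ := fun w hw =>
    LinearMap.congr_fun hq ⟨w, hw⟩
  -- `C` is a complement of the kernel at `x₀` and `q` a projection to the image at `x₀`. The
  -- compression `Φ y` of `L y` to `C` and `I` is bijective at `x₀`, hence invertible nearby, and
  -- the generalized inverse is `Φ y` inverted, preceded by `q`.
  let Φ : X → C →L[ℝ] I := fun y => q.toContinuousLinearMap.comp ((L y).comp C.subtypeL)
  have hΦ : ContDiffOn ℝ ∞ Φ U := contDiffOn_const.clm_comp (hL.clm_comp contDiffOn_const)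
  have hinj : Function.Injective (Φ x₀) := by
    refine (injective_iff_map_eq_zero (Φ x₀)).2 fun c hc => ?_
    have h1 : q (L x₀ c) = 0 := hc
    have h2 : (c : V) ∈ LinearMap.ker (L x₀).toLinearMap :=
      congrArg Subtype.val ((hqI (L x₀ c) ⟨(c : V), rfl⟩).symm.trans h1)
    exact Subtype.ext ((Submodule.disjoint_def.1 hC.disjoint) _ h2 c.2)
  have hsurj : Function.Surjective (Φ x₀) := by
    rintro ⟨_, v, rfl⟩
    obtain ⟨a, ha, c, hc, rfl⟩ := Submodule.mem_sup.1
      (hC.sup_eq_top ▸ Submodule.mem_top : v ∈ LinearMap.ker (L x₀).toLinearMap ⊔ C)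
    refine ⟨⟨c, hc⟩, ?_⟩
    have ha' : L x₀ a = 0 := ha
    refine (hqI (L x₀ c) ⟨c, rfl⟩).trans (Subtype.ext ?_)
    change L x₀ c = L x₀ (a + c)
    rw [map_add, ha', zero_add]
  let e₀ : C ≃L[ℝ] I := (LinearEquiv.ofBijective (Φ x₀).toLinearMap
    ⟨hinj, hsurj⟩).toContinuousLinearEquiv
  have he₀ : (e₀ : C →L[ℝ] I) = Φ x₀ := by ext; rfl
  refine ⟨U ∩ Φ ⁻¹' (range ((↑) : (C ≃L[ℝ] I) → C →L[ℝ] I)), inter_subset_left,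
    hΦ.continuousOn.isOpen_inter_preimage hU ContinuousLinearEquiv.isOpen, ⟨hx, e₀, he₀⟩,
    fun y => C.subtypeL.comp ((Φ y).inverse.comp q.toContinuousLinearMap), ?_, ?_⟩
  · refine contDiffOn_const.clm_comp (ContDiffOn.clm_comp ?_ contDiffOn_const)
    rintro y ⟨hy, e, he⟩
    refine ContDiffAt.comp_contDiffWithinAt (g := ContinuousLinearMap.inverse) (f := Φ) y ?_ ((hΦ y hy).mono inter_subset_left)
    rw [← he]
    exact contDiffAt_map_inverse e
  · rintro y ⟨hy, e, he⟩ v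
    have hle : LinearMap.range ((L y).toLinearMap ∘ₗ C.subtype) ≤
        LinearMap.range (L y).toLinearMap := LinearMap.range_comp_le_range _ _
    have hinjy : Function.Injective ((L y).toLinearMap ∘ₗ C.subtype) := by
      intro a b hab
      refine e.injective ?_
      have h1 : Φ y a = Φ y b := congrArg q hab
      rwa [← he] at h1
    -- Here the constancy of the rank enters: `L y` is injective on `C`, whose dimension is the
    -- rank, so `C` already yields the whole image of `L y`.
    have heq := Submodule.eq_of_le_of_finrank_eq hle (by
      rw [LinearMap.finrank_range_of_inj hinjy, hd y hy, ← hd x₀ hx]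
      exact e₀.toLinearEquiv.finrank_eq)
    obtain ⟨c, hc⟩ := (heq ▸ ⟨v, rfl⟩ : L y v ∈ LinearMap.range ((L y).toLinearMap ∘ₗ C.subtype))
    have hc' : L y c = L y v := hc
    have h2 : (Φ y).inverse (Φ y c) = c := by
      rw [← he]
      simp
    have h3 : (Φ y).inverse (q (L y c)) = c := h2
    change L y ((Φ y).inverse (q (L y v)) : C) = L y v
    rw [← hc', h3]

end Calculus

/-! ### Jets of functions and functions of jets -/

section Jets

variable {n : ℕ} {X : Type v} [NormedAddCommGroup X] [NormedSpace ℝ X]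
  {Y : Type w} [NormedAddCommGroup Y] [NormedSpace ℝ Y]

/-- The Euclidean space on which charts take their values. -/
abbrev Eu (n : ℕ) : Type := EuclideanSpace ℝ (Fin n)

lemma jet_congr {k : ℕ} {f g : Eu n → X} {y : Eu n} (h : f =ᶠ[𝓝 y] g) : jet k f y = jet k g y :=
  funext fun i => (h.iteratedFDeriv ℝ (i : ℕ)).eq_of_nhds

lemma jet_add {k : ℕ} {f g : Eu n → X} {y : Eu n} (hf : ContDiffAt ℝ ∞ f y)
    (hg : ContDiffAt ℝ ∞ g y) : jet k (fun z => f z + g z) y = jet k f y + jet k g y :=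
  funext fun i => iteratedFDeriv_add_apply (hf.of_le (by exact_mod_cast le_top))
    (hg.of_le (by exact_mod_cast le_top))

lemma jet_const_smul {k : ℕ} (c : ℝ) {f : Eu n → X} {y : Eu n} (hf : ContDiffAt ℝ ∞ f y) :
    jet k (fun z => c • f z) y = c • jet k f y :=
  funext fun i => iteratedFDeriv_const_smul_apply (hf.of_le (by exact_mod_cast le_top))

lemma jet_zero {k : ℕ} (y : Eu n) : jet k (fun _ => (0 : X)) y = 0 :=
  funext fun i => by simp [jet]

lemma jet_comp_sub {k : ℕ} (f : Eu n → X) (a y : Eu n) :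
    jet k (fun z => f (z - a)) y = jet k f (y - a) :=
  funext fun i => iteratedFDeriv_comp_sub (i : ℕ) a y

/-- The action of a linear map on jets. -/
def jetMap (n k : ℕ) (L : X →L[ℝ] Y) : JetSpace n k X →L[ℝ] JetSpace n k Y :=
  ContinuousLinearMap.pi fun i =>
    (ContinuousLinearMap.compContinuousMultilinearMapL ℝ
      (fun _ : Fin (i : ℕ) => Eu n) X Y L).comp (ContinuousLinearMap.proj i)

lemma jet_clm_comp {k : ℕ} (L : X →L[ℝ] Y) {f : Eu n → X} {y : Eu n} (hf : ContDiffAt ℝ ∞ f y) :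
    jet k (fun z => L (f z)) y = jetMap n k L (jet k f y) :=
  funext fun i => L.iteratedFDeriv_comp_left (hf.of_le (by exact_mod_cast le_top)) le_rfl

/-- Truncation of jets. -/
def jetTrunc (X : Type v) [NormedAddCommGroup X] [NormedSpace ℝ X] (n : ℕ) {k l : ℕ} (h : k ≤ l) :
    JetSpace n l X →L[ℝ] JetSpace n k X :=
  ContinuousLinearMap.pi fun i => ContinuousLinearMap.proj (R := ℝ)
    (φ := fun i : Fin (l + 1) => ContinuousMultilinearMap ℝ (fun _ : Fin (i : ℕ) => Eu n) X)
    (Fin.castLE (by omega : k + 1 ≤ l + 1) i)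

lemma jetTrunc_jet {k l : ℕ} (h : k ≤ l) (f : Eu n → X) (y : Eu n) :
    jetTrunc X n h (jet l f y) = jet k f y := rfl

/-- The derivative of the `k`-jet, as a function of the `(k+1)`-jet. -/
def jetFDeriv (X : Type v) [NormedAddCommGroup X] [NormedSpace ℝ X] (n k : ℕ) :
    JetSpace n (k + 1) X →L[ℝ] (Eu n →L[ℝ] JetSpace n k X) :=
  (ContinuousLinearMap.piEquivL ℝ (Eu n) (fun i : Fin (k + 1) =>
      ContinuousMultilinearMap ℝ (fun _ : Fin (i : ℕ) => Eu n) X)).toContinuousLinearMap.comp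
    (ContinuousLinearMap.pi fun i : Fin (k + 1) =>
      ((continuousMultilinearCurryLeftEquiv ℝ (fun _ : Fin ((i : ℕ) + 1) => Eu n)
        X).toContinuousLinearEquiv.toContinuousLinearMap).comp (ContinuousLinearMap.proj (R := ℝ)
        (φ := fun i : Fin (k + 1 + 1) =>
          ContinuousMultilinearMap ℝ (fun _ : Fin (i : ℕ) => Eu n) X) i.succ))

set_option synthInstance.maxHeartbeats 200000 in
lemma contDiff_jetFDeriv (k : ℕ) : ContDiff ℝ ∞ (fun p => jetFDeriv X n k p) :=
  ContinuousLinearMap.contDiff (𝕜 := ℝ) (E := JetSpace n (k + 1) X)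
    (F := Eu n →L[ℝ] JetSpace n k X) (jetFDeriv X n k)

lemma hasFDerivAt_jet {k : ℕ} {f : Eu n → X} {y : Eu n} (hf : ContDiffAt ℝ ∞ f y) :
    HasFDerivAt (jet k f) (jetFDeriv X n k (jet (k + 1) f y)) y := by
  refine hasFDerivAt_pi'.2 fun i => ?_
  have h := ((hf.iteratedFDeriv_right (m := 1) (i := (i : ℕ)) (by
    exact_mod_cast le_top)).differentiableAt (by simp)).hasFDerivAt
  rw [fderiv_iteratedFDeriv] at h
  exact h

/-! ### Calculus of operators that factor through jets -/

variable {ι : Type*} {W : Type*} [NormedAddCommGroup W] [NormedSpace ℝ W]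
  {W' : Type*} [NormedAddCommGroup W'] [NormedSpace ℝ W']
  {U V : Set (Eu n)} {σ : Eu n → Eu n} {k l : ℕ} {u : ι → Eu n → X} {out : ι → Eu n → W}

/-- On `U`, the value of `out i` at `y` is a smooth function of `y` and of the `k`-jet of `u i`
at `σ y`. -/
def JetDep (U : Set (Eu n)) (σ : Eu n → Eu n) (k : ℕ) (u : ι → Eu n → X) (out : ι → Eu n → W) :
    Prop :=
  ∃ A : Eu n × JetSpace n k X → W, ContDiffOn ℝ ∞ A (U ×ˢ univ) ∧
    ∀ i, ∀ y ∈ U, out i y = A (y, jet k (u i) (σ y))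

namespace JetDep

lemma jet_self : JetDep U σ k u (fun i y => jet k (u i) (σ y)) :=
  ⟨Prod.snd, contDiffOn_snd, fun _ _ _ => rfl⟩

lemma of_contDiffOn {f : Eu n → W} (hf : ContDiffOn ℝ ∞ f U) : JetDep U σ k u (fun _ => f) :=
  ⟨fun p => f p.1, hf.comp contDiffOn_fst fun _ hp => hp.1, fun _ _ _ => rfl⟩

lemma mono_set (h : JetDep U σ k u out) (hVU : V ⊆ U) : JetDep V σ k u out := by
  obtain ⟨A, hA, hAo⟩ := h
  exact ⟨A, hA.mono (prod_mono hVU subset_rfl), fun i y hy => hAo i y (hVU hy)⟩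

lemma mono (h : JetDep U σ k u out) (hkl : k ≤ l) : JetDep U σ l u out := by
  obtain ⟨A, hA, hAo⟩ := h
  refine ⟨fun p => A (p.1, jetTrunc X n hkl p.2), hA.comp (ContDiff.contDiffOn (by fun_prop))
    fun p hp => ⟨hp.1, mem_univ _⟩, fun i y hy => hAo i y hy⟩

lemma congr (h : JetDep U σ k u out) {out' : ι → Eu n → W}
    (he : ∀ i, ∀ y ∈ U, out' i y = out i y) : JetDep U σ k u out' := by
  obtain ⟨A, hA, hAo⟩ := h
  exact ⟨A, hA, fun i y hy => (he i y hy).trans (hAo i y hy)⟩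

lemma congr_map (h : JetDep U σ k u out) {τ : Eu n → Eu n} (he : EqOn τ σ U) :
    JetDep U τ k u out := by
  obtain ⟨A, hA, hAo⟩ := h
  exact ⟨A, hA, fun i y hy => by rw [hAo i y hy, he hy]⟩

lemma comp_index {κ : Type*} (h : JetDep U σ k u out) (g : κ → ι) :
    JetDep U σ k (fun i => u (g i)) (fun i => out (g i)) := by
  obtain ⟨A, hA, hAo⟩ := h
  exact ⟨A, hA, fun i y hy => hAo _ y hy⟩

/-- Applying a function that depends smoothly on the point and on the value. -/
lemma map (h : JetDep U σ k u out) {B : Eu n × W → W'} (hB : ContDiffOn ℝ ∞ B (U ×ˢ univ)) :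
    JetDep U σ k u (fun i y => B (y, out i y)) := by
  obtain ⟨A, hA, hAo⟩ := h
  refine ⟨fun p => B (p.1, A p), hB.comp (contDiffOn_fst.prodMk hA) fun p hp => ⟨hp.1, mem_univ _⟩,
    fun i y hy => congrArg (fun w => B (y, w)) (hAo i y hy)⟩

lemma clm (h : JetDep U σ k u out) (L : W →L[ℝ] W') : JetDep U σ k u (fun i y => L (out i y)) :=
  h.map (B := fun p => L p.2) (L.contDiff.comp contDiff_snd).contDiffOn

lemma prodMk (h : JetDep U σ k u out) {out' : ι → Eu n → W'} (h' : JetDep U σ l u out') :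
    JetDep U σ (max k l) u (fun i y => (out i y, out' i y)) := by
  obtain ⟨A, hA, hAo⟩ := h.mono (le_max_left k l)
  obtain ⟨B, hB, hBo⟩ := h'.mono (le_max_right k l)
  exact ⟨fun p => (A p, B p), hA.prodMk hB, fun i y hy => Prod.ext (hAo i y hy) (hBo i y hy)⟩

lemma pi {κ : Type*} [Fintype κ] {W : κ → Type*} [∀ j, NormedAddCommGroup (W j)]
    [∀ j, NormedSpace ℝ (W j)] {out : ι → Eu n → ∀ j, W j}
    (h : ∀ j, JetDep U σ k u (fun i y => out i y j)) : JetDep U σ k u out := by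
  choose A hA hAo using h
  exact ⟨fun p j => A j p, contDiffOn_pi.2 hA, fun i y hy => funext fun j => hAo j i y hy⟩

lemma sum {κ : Type*} (s : Finset κ) {out : κ → ι → Eu n → W}
    (h : ∀ j ∈ s, JetDep U σ k u (out j)) : JetDep U σ k u (fun i y => ∑ j ∈ s, out j i y) := by
  classical
  induction s using Finset.induction_on with
  | empty => simpa using of_contDiffOn (σ := σ) (k := k) (u := u) (contDiffOn_const (c := (0 : W)))
  | insert a s ha ih =>
    have h1 := ((h a (Finset.mem_insert_self _ _)).prodMk
      (ih fun j hj => h j (Finset.mem_insert_of_mem hj))).clm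
        (ContinuousLinearMap.fst ℝ W W + ContinuousLinearMap.snd ℝ W W)
    rw [max_self] at h1
    exact h1.congr fun i y _ => by simp [Finset.sum_insert ha]

set_option synthInstance.maxHeartbeats 200000 in
lemma fderiv (h : JetDep U σ k u out) (hU : IsOpen U) (hV : IsOpen V) (hσ : ContDiffOn ℝ ∞ σ U)
    (hUV : MapsTo σ U V) (hu : ∀ i, ContDiffOn ℝ ∞ (u i) V) :
    JetDep U σ (k + 1) u (fun i y => fderiv ℝ (out i) y) := by
  obtain ⟨A, hA, hAo⟩ := h
  have hUu : IsOpen (U ×ˢ (univ : Set (JetSpace n k X))) := hU.prod isOpen_univ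
  -- The chain rule for `y ↦ A (y, jet k (u i) (σ y))`. The derivative of the `k`-jet is a linear
  -- function of the `(k+1)`-jet, whence the order `k + 1`.
  refine ⟨fun p => (_root_.fderiv ℝ A (p.1, jetTrunc X n (Nat.le_succ k) p.2)).comp
    ((ContinuousLinearMap.inl ℝ (Eu n) (JetSpace n k X)) +
      (ContinuousLinearMap.inr ℝ (Eu n) (JetSpace n k X)).comp
        ((jetFDeriv X n k p.2).comp (_root_.fderiv ℝ σ p.1))), ?_, fun i y hy => ?_⟩
  · refine ContDiffOn.clm_comp ?_ (contDiffOn_const.add (contDiffOn_const.clm_comp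
      (ContDiffOn.clm_comp ?_ ?_)))
    · exact (hA.fderiv_of_isOpen hUu (m := ∞) (by simp)).comp
        (ContDiff.contDiffOn (by fun_prop)) fun p hp => ⟨hp.1, mem_univ _⟩
    · exact ((contDiff_jetFDeriv (n := n) (X := X) k).comp contDiff_snd).contDiffOn
    · exact (hσ.fderiv_of_isOpen hU (m := ∞) (by simp)).comp contDiffOn_fst fun p hp => hp.1
  · have h1 : HasFDerivAt σ (_root_.fderiv ℝ σ y) y :=
      ((hσ.contDiffAt (hU.mem_nhds hy)).differentiableAt (by simp)).hasFDerivAt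
    have h2 := (hasFDerivAt_jet (k := k) ((hu i).contDiffAt (hV.mem_nhds (hUV hy)))).comp y h1
    have h3 : HasFDerivAt A (_root_.fderiv ℝ A (y, jet k (u i) (σ y))) (y, jet k (u i) (σ y)) :=
      ((hA.contDiffAt (hUu.mem_nhds ⟨hy, mem_univ _⟩)).differentiableAt (by simp)).hasFDerivAt
    have h4 := h3.comp y ((hasFDerivAt_id y).prodMk h2)
    have h5 : out i =ᶠ[𝓝 y] fun y => A (y, jet k (u i) (σ y)) := by
      filter_upwards [hU.mem_nhds hy] with z hz using hAo i z hz
    refine h5.fderiv_eq.trans (h4.fderiv.trans ?_)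
    dsimp only
    rw [jetTrunc_jet]
    congr 1
    ext v
    · simp
    · simp

lemma iteratedFDeriv (h : JetDep U σ k u out) (hU : IsOpen U) (hV : IsOpen V)
    (hσ : ContDiffOn ℝ ∞ σ U) (hUV : MapsTo σ U V) (hu : ∀ i, ContDiffOn ℝ ∞ (u i) V) (r : ℕ) :
    JetDep U σ (k + r) u (fun i y => iteratedFDeriv ℝ r (out i) y) := by
  induction r with
  | zero => exact h.clm (continuousMultilinearCurryFin0 ℝ (Eu n)
      W).symm.toContinuousLinearEquiv.toContinuousLinearMap
  | succ r ih =>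
    refine ((ih.fderiv hU hV hσ hUV hu).clm (continuousMultilinearCurryLeftEquiv ℝ
      (fun _ : Fin (r + 1) => Eu n)
      W).symm.toContinuousLinearEquiv.toContinuousLinearMap).congr fun i y _ => ?_
    rw [iteratedFDeriv_succ_eq_comp_left]
    rfl

/-- The jets of a function of jets are functions of jets. -/
lemma jet (h : JetDep U σ k u out) (hU : IsOpen U) (hV : IsOpen V)
    (hσ : ContDiffOn ℝ ∞ σ U) (hUV : MapsTo σ U V) (hu : ∀ i, ContDiffOn ℝ ∞ (u i) V) (r : ℕ) :
    JetDep U σ (k + r) u (fun i y => jet r (out i) y) :=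
  pi fun j => (h.iteratedFDeriv hU hV hσ hUV hu j).mono (by omega)

/-- Orders add: the `l`-jet of `out` is a function of the `(k + l)`-jet of `u`. Besides composing
operators, this moves local expressions between charts, with transition maps as `σ` and `τ`. -/
lemma comp {U' : Set (Eu n)} {τ : Eu n → Eu n} {out' : ι → Eu n → W'} (h : JetDep U σ k u out)
    (h' : JetDep U' τ l out out') (hU : IsOpen U) (hV : IsOpen V) (hσ : ContDiffOn ℝ ∞ σ U)
    (hUV : MapsTo σ U V) (hu : ∀ i, ContDiffOn ℝ ∞ (u i) V) (hτ : ContDiffOn ℝ ∞ τ U')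
    (hU' : MapsTo τ U' U) : JetDep U' (fun y => σ (τ y)) (k + l) u out' := by
  obtain ⟨A, hA, hAo⟩ := h'
  obtain ⟨B, hB, hBo⟩ := h.jet hU hV hσ hUV hu l
  refine ⟨fun p => A (p.1, B (τ p.1, p.2)), ?_, fun i y hy => ?_⟩
  · refine hA.comp (contDiffOn_fst.prodMk (hB.comp ((hτ.comp contDiffOn_fst
      fun p hp => hp.1).prodMk contDiffOn_snd) fun p hp => ⟨hU' hp.1, mem_univ _⟩))
      fun p hp => ⟨hp.1, mem_univ _⟩
  · rw [hAo i y hy]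
    exact congrArg (fun w => A (y, w)) (hBo i (τ y) (hU' hy))

/-- The value, and hence every jet, of `out i` is determined by the jets of `u i`. -/
lemma eq_of_jet_eq (h : JetDep U σ k u out) {i j : ι} {y : Eu n} (hy : y ∈ U)
    (hij : _root_.jet k (u i) (σ y) = _root_.jet k (u j) (σ y)) : out i y = out j y := by
  obtain ⟨A, hA, hAo⟩ := h
  rw [hAo i y hy, hAo j y hy, hij]

lemma contDiffOn (h : JetDep U σ k u out) (hV : IsOpen V) (hσ : ContDiffOn ℝ ∞ σ U)
    (hUV : MapsTo σ U V) (hu : ∀ i, ContDiffOn ℝ ∞ (u i) V) (i : ι) :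
    ContDiffOn ℝ ∞ (out i) U := by
  obtain ⟨A, hA, hAo⟩ := h
  refine ContDiffOn.congr ?_ fun y hy => hAo i y hy
  have hj : ContDiffOn ℝ ∞ (fun y => _root_.jet k (u i) y) V := contDiffOn_pi.2 fun j y hy => (((hu i).contDiffAt (hV.mem_nhds hy)).iteratedFDeriv_right (m := ∞)
    (by exact_mod_cast le_top)).contDiffWithinAt
  exact hA.comp (contDiffOn_id.prodMk (hj.comp hσ hUV)) fun y hy => ⟨hy, mem_univ _⟩

end JetDep

/-- The jets at a point of the smooth functions form a linear space. -/
def smoothJets (n k : ℕ) (X : Type v) [NormedAddCommGroup X] [NormedSpace ℝ X] :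
    Submodule ℝ (JetSpace n k X) where
  carrier := {p | ∃ f : Eu n → X, ContDiff ℝ ∞ f ∧ jet k f 0 = p}
  add_mem' := by
    rintro _ _ ⟨f, hf, rfl⟩ ⟨g, hg, rfl⟩
    exact ⟨fun z => f z + g z, hf.add hg, jet_add hf.contDiffAt hg.contDiffAt⟩
  zero_mem' := ⟨fun _ => 0, contDiff_const, jet_zero _⟩
  smul_mem' := by
    rintro c _ ⟨f, hf, rfl⟩
    exact ⟨fun z => c • f z, contDiff_const.smul hf, jet_const_smul c hf.contDiffAt⟩

/-- Multiplication by a bump function supported in a closed ball inside `O` extends the germ to the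
whole space. -/
lemma exists_contDiff_eventuallyEq {f : Eu n → X} {O : Set (Eu n)} (hO : IsOpen O)
    (hf : ContDiffOn ℝ ∞ f O) {y : Eu n} (hy : y ∈ O) :
    ∃ g : Eu n → X, ContDiff ℝ ∞ g ∧ g =ᶠ[𝓝 y] f := by
  obtain ⟨ε, hε, hεO⟩ := Metric.nhds_basis_closedBall.mem_iff.1 (hO.mem_nhds hy)
  let χ : ContDiffBump y := ⟨ε / 2, ε, half_pos hε, half_lt_self hε⟩
  refine ⟨fun z => χ z • f z, contDiff_iff_contDiffAt.2 fun z => ?_, ?_⟩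
  · by_cases hz : z ∈ O
    · exact χ.contDiffAt.smul (hf.contDiffAt (hO.mem_nhds hz))
    · have h1 : z ∉ tsupport χ := fun h => hz (hεO (by rwa [χ.tsupport_eq] at h))
      refine (contDiffAt_const (c := (0 : X))).congr_of_eventuallyEq ?_
      filter_upwards [notMem_tsupport_iff_eventuallyEq.1 h1] with t ht
      simp [ht]
  · filter_upwards [χ.eventuallyEq_one] with z hz
    simp [hz]

/-- Translation identifies the jets of smooth functions at `y` with those at the origin. One
subspace therefore serves all points, and a projection to it can be chosen independently of `y`. -/
lemma jet_mem_smoothJets {k : ℕ} {f : Eu n → X} {O : Set (Eu n)} (hO : IsOpen O)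
    (hf : ContDiffOn ℝ ∞ f O) {y : Eu n} (hy : y ∈ O) : jet k f y ∈ smoothJets n k X := by
  obtain ⟨g, hg, hgf⟩ := exists_contDiff_eventuallyEq hO hf hy
  refine ⟨fun z => g (z - (-y)), hg.comp (contDiff_id.sub contDiff_const), ?_⟩
  rw [jet_comp_sub, zero_sub, neg_neg, jet_congr hgf]

end Jets

/-! ### Changes of charts and trivializations -/

section Charts

variable {n : ℕ} {M : Type u} [TopologicalSpace M] [ChartedSpace (EuclideanSpace ℝ (Fin n)) M]

/-- The transition map from the preferred chart at `x₁` to the preferred chart at `x₀`. -/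
def chartChange (x₀ x₁ : M) : Eu n → Eu n :=
  fun y => extChartAt (𝓡 n) x₀ ((extChartAt (𝓡 n) x₁).symm y)

/-- The domain of the transition map. -/
def chartOverlap (x₀ x₁ : M) : Set (Eu n) :=
  (extChartAt (𝓡 n) x₁).target ∩ (extChartAt (𝓡 n) x₁).symm ⁻¹' (extChartAt (𝓡 n) x₀).source

lemma isOpen_target_inter_preimage (x₁ : M) {s : Set M} (hs : IsOpen s) :
    IsOpen ((extChartAt (𝓡 n) x₁).target ∩ (extChartAt (𝓡 n) x₁).symm ⁻¹' s) :=
  (continuousOn_extChartAt_symm x₁).isOpen_inter_preimage (isOpen_extChartAt_target x₁) hs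

lemma isOpen_chartOverlap (x₀ x₁ : M) : IsOpen (chartOverlap (n := n) x₀ x₁) :=
  isOpen_target_inter_preimage x₁ (isOpen_extChartAt_source x₀)

/-- The set of coordinates of the points at which the preferred chart and trivialization at `x₀` are
defined. -/
def secDom (V : SmoothVB.{u, v, w} n M) (x₀ : M) : Set (Eu n) :=
  (extChartAt (𝓡 n) x₀).target ∩
    (extChartAt (𝓡 n) x₀).symm ⁻¹' (trivializationAt V.Model V.Fiber x₀).baseSet

lemma isOpen_secDom (V : SmoothVB.{u, v, w} n M) (x₀ : M) : IsOpen (secDom V x₀) :=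
  isOpen_target_inter_preimage x₀ (trivializationAt V.Model V.Fiber x₀).open_baseSet

lemma mem_secDom (V : SmoothVB.{u, v, w} n M) (x₀ : M) : extChartAt (𝓡 n) x₀ x₀ ∈ secDom V x₀ := by
  refine ⟨mem_extChartAt_target x₀, ?_⟩
  rw [mem_preimage, extChartAt_to_inv]
  exact mem_baseSet_trivializationAt _ _ x₀

/-- The coordinates, in the chart at `x₁`, of the points at which the preferred charts and
trivializations at `x₀` and `x₁` are defined. -/
def secOverlap (V : SmoothVB.{u, v, w} n M) (x₀ x₁ : M) : Set (Eu n) :=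
  secDom V x₁ ∩ {y | y ∈ chartOverlap x₀ x₁ ∧ chartChange x₀ x₁ y ∈ secDom V x₀}

lemma mapsTo_chartChange (V : SmoothVB.{u, v, w} n M) (x₀ x₁ : M) :
    MapsTo (chartChange x₀ x₁) (secOverlap V x₀ x₁) (secDom V x₀) := fun _ hy => hy.2.2

lemma secRep_add (V : SmoothVB.{u, v, w} n M) (x₀ : M) (s t : Sec V) {y : Eu n}
    (hy : y ∈ secDom V x₀) : secRep V (s + t) x₀ y = secRep V s x₀ y + secRep V t x₀ y :=
  ((trivializationAt V.Model V.Fiber x₀).linear ℝ hy.2).map_add _ _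

lemma secRep_smul (V : SmoothVB.{u, v, w} n M) (x₀ : M) (c : ℝ) (s : Sec V) {y : Eu n}
    (hy : y ∈ secDom V x₀) : secRep V (c • s) x₀ y = c • secRep V s x₀ y :=
  ((trivializationAt V.Model V.Fiber x₀).linear ℝ hy.2).map_smul _ _

lemma secRep_zero (V : SmoothVB.{u, v, w} n M) (x₀ : M) {y : Eu n}
    (hy : y ∈ secDom V x₀) : secRep V 0 x₀ y = 0 := by
  simpa using secRep_smul V x₀ 0 0 hy

lemma formRep_eq_zero {q : ℕ} {α : FormField n M q} {x₀ : M} {y : Eu n}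
    (h : α ((extChartAt (𝓡 n) x₀).symm y) = 0) : formRep α x₀ y = 0 := by
  rw [formRep, h]
  rfl

variable [IsManifold (𝓡 n) ∞ M]

lemma contDiffOn_chartChange (x₀ x₁ : M) :
    ContDiffOn ℝ ∞ (chartChange (n := n) x₀ x₁) (chartOverlap x₀ x₁) := by
  have h := contDiffOn_ext_coord_change (I := 𝓡 n) (n := ∞) x₀ x₁
  rwa [PartialEquiv.trans_source, PartialEquiv.symm_source] at h

lemma isOpen_secOverlap (V : SmoothVB.{u, v, w} n M) (x₀ x₁ : M) : IsOpen (secOverlap V x₀ x₁) :=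
  (isOpen_secDom V x₁).inter ((contDiffOn_chartChange x₀ x₁).continuousOn.isOpen_inter_preimage
    (isOpen_chartOverlap x₀ x₁) (isOpen_secDom V x₀))

lemma contDiffOn_secRep (V : SmoothVB.{u, v, w} n M) (s : Sec V) (x₀ : M) :
    ContDiffOn ℝ ∞ (secRep V s x₀) (secDom V x₀) := by
  have h1 : ContMDiffOn (𝓡 n) 𝓘(ℝ, V.Model) ∞
      (fun x => (trivializationAt V.Model V.Fiber x₀ ⟨x, s x⟩).2)
      (trivializationAt V.Model V.Fiber x₀).baseSet := fun x hx =>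
    (((trivializationAt V.Model V.Fiber x₀).contMDiffAt_section_iff (IB := 𝓡 n) hx).1
      (s.contMDiff x)).contMDiffWithinAt
  have h2 := h1.comp (contMDiffOn_extChartAt_symm (n := ∞) (I := 𝓡 n) x₀ |>.mono
    (inter_subset_left : secDom V x₀ ⊆ _)) (fun y hy => hy.2)
  exact contMDiffOn_iff_contDiffOn.1 h2

/-- The change of charts and trivializations, for sections. -/
lemma jetDep_secRep (V : SmoothVB.{u, v, w} n M) (x₀ x₁ : M) :
    JetDep (secOverlap V x₀ x₁) (chartChange x₀ x₁) 0 (fun s : Sec V => secRep V s x₀)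
      (fun s => secRep V s x₁) := by
  set e₀ := trivializationAt V.Model V.Fiber x₀
  set e₁ := trivializationAt V.Model V.Fiber x₁
  have hmem : ∀ y ∈ secOverlap V x₀ x₁, (extChartAt (𝓡 n) x₁).symm y ∈ e₀.baseSet ∩ e₁.baseSet := by
    rintro y ⟨h1, h2, h3⟩
    refine ⟨?_, h1.2⟩
    have h4 := h3.2
    rwa [mem_preimage, chartChange, (extChartAt (𝓡 n) x₀).left_inv h2.2] at h4
  have hg : ContDiffOn ℝ ∞ (fun y => (e₀.coordChangeL ℝ e₁
      ((extChartAt (𝓡 n) x₁).symm y) : V.Model →L[ℝ] V.Model)) (secOverlap V x₀ x₁) := by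
    refine contMDiffOn_iff_contDiffOn.1 ((contMDiffOn_coordChangeL (IB := 𝓡 n) (n := ∞)
      e₀ e₁).comp ((contMDiffOn_extChartAt_symm (n := ∞) (I := 𝓡 n) x₁).mono ?_) hmem)
    exact fun y hy => hy.1.1
  refine ((JetDep.jet_self (n := n) (k := 0) (u := fun s : Sec V => secRep V s x₀)).map
    (B := fun p : Eu n × JetSpace n 0 V.Model => (e₀.coordChangeL ℝ e₁
      ((extChartAt (𝓡 n) x₁).symm p.1) : V.Model →L[ℝ] V.Model)
      ((continuousMultilinearCurryFin0 ℝ (Eu n) V.Model) (p.2 0))) ?_).congr fun s y hy => ?_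
  · refine (hg.comp contDiffOn_fst fun p hp => hp.1).clm_apply (ContDiff.contDiffOn ?_)
    exact (continuousMultilinearCurryFin0 ℝ (Eu n) V.Model).contDiff.comp
      ((ContinuousLinearMap.proj (R := ℝ) (φ := fun i : Fin 1 => ContinuousMultilinearMap ℝ
        (fun _ : Fin (i : ℕ) => Eu n) V.Model) 0).contDiff.comp contDiff_snd)
  · have h1 : (continuousMultilinearCurryFin0 ℝ (Eu n) V.Model)
        (jet 0 (secRep V s x₀) (chartChange x₀ x₁ y) 0) =
        secRep V s x₀ (chartChange x₀ x₁ y) := rfl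
    dsimp only
    -- The fibre depends on the base point, so equal points are substituted for one another instead
    -- of being rewritten inside the dependent pair.
    have h2 : ∀ a b : M, a = b → (e₀ ⟨a, s a⟩).2 = (e₀ ⟨b, s b⟩).2 := by
      rintro a _ rfl
      rfl
    have h3 : secRep V s x₀ (chartChange x₀ x₁ y) =
        (e₀ ⟨(extChartAt (𝓡 n) x₁).symm y, s ((extChartAt (𝓡 n) x₁).symm y)⟩).2 :=
      h2 _ _ ((extChartAt (𝓡 n) x₀).left_inv hy.2.1.2)
    rw [h1, h3]
    refine Eq.trans ?_ (e₀.coordChangeL_apply e₁ (hmem y hy) _).symm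
    rw [e₀.symm_apply_apply_mk (hmem y hy).1]
    rfl

/-- Every smooth function is, near a given point, the expression of a global section. -/
lemma exists_section [T2Space M] (V : SmoothVB.{u, v, w} n M) (x₀ : M) {y : Eu n}
    (hy : y ∈ secDom V x₀) {f : Eu n → V.Model} (hf : ContDiff ℝ ∞ f) :
    ∃ s : Sec V, secRep V s x₀ =ᶠ[𝓝 y] f := by
  set e₀ := trivializationAt V.Model V.Fiber x₀
  set O : Set M := (extChartAt (𝓡 n) x₀).source ∩ e₀.baseSet
  have hO : IsOpen O := (isOpen_extChartAt_source x₀).inter e₀.open_baseSet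
  set x := (extChartAt (𝓡 n) x₀).symm y with hx
  have hxO : x ∈ O := ⟨(extChartAt (𝓡 n) x₀).map_target hy.1, hy.2⟩
  -- The cut-off `χ` is supported where both chart and trivialization are defined. The local section
  -- multiplied by `χ` is global, and it is unchanged near `x`, where `χ = 1`.
  obtain ⟨χ, -, hχ⟩ := (SmoothBumpFunction.nhds_basis_tsupport (I := 𝓡 n) x).mem_iff.1
    (hO.mem_nhds hxO)
  have hs : ContMDiffOn (𝓡 n) ((𝓡 n).prod 𝓘(ℝ, V.Model)) ∞
      (fun z => (⟨z, e₀.symm z (f (extChartAt (𝓡 n) x₀ z))⟩ : TotalSpace V.Model V.Fiber)) O := by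
    intro z hz
    refine ContMDiffAt.contMDiffWithinAt ?_
    rw [e₀.contMDiffAt_section_iff hz.2]
    have h1 : ContMDiffAt (𝓡 n) 𝓘(ℝ, V.Model) ∞ (fun z => f (extChartAt (𝓡 n) x₀ z)) z :=
      hf.contMDiff.contMDiffAt.comp z (contMDiffAt_extChartAt' (by
        simpa using hz.1))
    refine h1.congr_of_eventuallyEq ?_
    filter_upwards [hO.mem_nhds hz] with t ht
    rw [e₀.apply_mk_symm ht.2]
  have hsm := ContMDiffOn.smul_section_of_tsupport (χ.contMDiff.contMDiffOn (s := O)) hO hχ hs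
  refine ⟨⟨_, hsm⟩, ?_⟩
  have h1 : ∀ᶠ t in 𝓝 y, χ ((extChartAt (𝓡 n) x₀).symm t) = 1 := by
    have hc : ContinuousAt (extChartAt (𝓡 n) x₀).symm y :=
      (continuousOn_extChartAt_symm x₀).continuousAt ((isOpen_extChartAt_target x₀).mem_nhds hy.1)
    exact hc.eventually χ.eventuallyEq_one
  filter_upwards [h1, (isOpen_secDom V x₀).mem_nhds hy] with t ht htd
  change (e₀ ⟨_, χ ((extChartAt (𝓡 n) x₀).symm t) • e₀.symm _ _⟩).2 = _
  rw [ht, one_smul, e₀.apply_mk_symm htd.2, (extChartAt (𝓡 n) x₀).right_inv htd.1]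

lemma mdifferentiableAt_extChartAt_symm {x₀ : M} {y : Eu n}
    (hy : y ∈ (extChartAt (𝓡 n) x₀).target) :
    MDifferentiableAt (𝓡 n) (𝓡 n) (extChartAt (𝓡 n) x₀).symm y :=
  haveI : IsManifold (𝓡 n) 1 M := .of_le (n := ∞) (by simp)
  (mdifferentiableOn_extChartAt_symm y hy).mdifferentiableAt
    ((isOpen_extChartAt_target x₀).mem_nhds hy)

lemma mdifferentiableAt_extChartAt_of_mem {x₀ x : M} (hx : x ∈ (extChartAt (𝓡 n) x₀).source) :
    MDifferentiableAt (𝓡 n) (𝓡 n) (extChartAt (𝓡 n) x₀) x :=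
  haveI : IsManifold (𝓡 n) 1 M := .of_le (n := ∞) (by simp)
  mdifferentiableAt_extChartAt (by simpa using hx)

lemma fderiv_chartChange {x₀ x₁ : M} {y : Eu n} (hy : y ∈ chartOverlap x₀ x₁) :
    fderiv ℝ (chartChange x₀ x₁) y =
      (mfderiv (𝓡 n) (𝓡 n) (extChartAt (𝓡 n) x₀) ((extChartAt (𝓡 n) x₁).symm y)).comp
        (mfderiv (𝓡 n) (𝓡 n) (extChartAt (𝓡 n) x₁).symm y) := by
  rw [← mfderiv_eq_fderiv]
  exact mfderiv_comp y (mdifferentiableAt_extChartAt_of_mem hy.2)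
    (mdifferentiableAt_extChartAt_symm hy.1)

lemma mfderiv_symm_comp_mfderiv {x₀ x : M} (hx : x ∈ (extChartAt (𝓡 n) x₀).source) :
    (mfderiv (𝓡 n) (𝓡 n) (extChartAt (𝓡 n) x₀).symm (extChartAt (𝓡 n) x₀ x)).comp
      (mfderiv (𝓡 n) (𝓡 n) (extChartAt (𝓡 n) x₀) x) = ContinuousLinearMap.id ℝ _ := by
  rw [← mfderiv_comp x (mdifferentiableAt_extChartAt_symm
    ((extChartAt (𝓡 n) x₀).map_source hx)) (mdifferentiableAt_extChartAt_of_mem hx)]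
  have h : ((extChartAt (𝓡 n) x₀).symm ∘ extChartAt (𝓡 n) x₀) =ᶠ[𝓝 x] id := by
    filter_upwards [(isOpen_extChartAt_source x₀).mem_nhds hx] with z hz
    exact (extChartAt (𝓡 n) x₀).left_inv hz
  rw [h.mfderiv_eq, mfderiv_id]

/-- A form is the pullback of its expression in a chart. -/
lemma formRep_pullback {q : ℕ} (α : FormField n M q) {x₀ x : M}
    (hx : x ∈ (extChartAt (𝓡 n) x₀).source) :
    (formRep α x₀ (extChartAt (𝓡 n) x₀ x)).compContinuousLinearMap
      (mfderiv (𝓡 n) (𝓡 n) (extChartAt (𝓡 n) x₀) x) = α x := by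
  have h1 : ∀ a b : M, a = b → (α a : ContinuousAlternatingMap ℝ (Eu n) ℝ (Fin q)) = α b := by
    rintro a _ rfl
    rfl
  have h2 := mfderiv_symm_comp_mfderiv hx
  ext v
  refine Eq.trans ?_ (congrArg (fun β : ContinuousAlternatingMap ℝ (Eu n) ℝ (Fin q) => β v)
    (h1 _ _ ((extChartAt (𝓡 n) x₀).left_inv hx)))
  refine congrArg (α ((extChartAt (𝓡 n) x₀).symm (extChartAt (𝓡 n) x₀ x)) :
    ContinuousAlternatingMap ℝ (Eu n) ℝ (Fin q)) (funext fun i => ?_)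
  exact DFunLike.congr_fun h2 (v i)

/-- The change of charts, for forms. -/
lemma formRep_chartChange {q : ℕ} (α : FormField n M q) {x₀ x₁ : M} {y : Eu n}
    (hy : y ∈ chartOverlap x₀ x₁) :
    formRep α x₁ y = (formRep α x₀ (chartChange x₀ x₁ y)).compContinuousLinearMap
      (fderiv ℝ (chartChange x₀ x₁) y) := by
  rw [fderiv_chartChange hy, formRep, ← formRep_pullback α hy.2]
  rfl

/-- The exterior derivative can be computed in any of the preferred charts. -/
lemma formRep_extD {q : ℕ} (α : FormField n M q) {x₀ : M} {y : Eu n}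
    (hy : y ∈ (extChartAt (𝓡 n) x₀).target)
    (hα : DifferentiableAt ℝ (formRep α ((extChartAt (𝓡 n) x₀).symm y))
      (extChartAt (𝓡 n) ((extChartAt (𝓡 n) x₀).symm y) ((extChartAt (𝓡 n) x₀).symm y))) :
    formRep (extD α) x₀ y = extDeriv (formRep α x₀) y := by
  set x := (extChartAt (𝓡 n) x₀).symm y with hx
  have hyo : y ∈ chartOverlap x x₀ := ⟨hy, mem_extChartAt_source x⟩
  -- `extD` at `x` is computed in the chart at `x` itself. Near `y` the expression at `x₀` is the
  -- pullback of the one at `x` by the transition map, and the exterior derivative commutes with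
  -- pullback.
  have h1 : formRep α x₀ =ᶠ[𝓝 y] fun z => (formRep α x (chartChange x x₀ z)).compContinuousLinearMap
      (fderiv ℝ (chartChange x x₀) z) := by
    filter_upwards [(isOpen_chartOverlap x x₀).mem_nhds hyo] with z hz
    exact formRep_chartChange α hz
  have hα' : DifferentiableAt ℝ (formRep α x) (chartChange x x₀ y) := hα
  rw [h1.extDeriv_eq, extDeriv_pullback (r := ∞) hα'
    ((contDiffOn_chartChange x x₀).contDiffAt ((isOpen_chartOverlap x x₀).mem_nhds hyo))
    (by simp only [minSmoothness_of_isRCLikeNormedField]; exact WithTop.coe_le_coe.2 le_top), fderiv_chartChange hyo]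
  rfl

end Charts

/-! ### Local factorization of operators that vanish on the PDE manifold -/

/-- A function that vanishes on the kernels of a family of linear maps of constant rank is linear in
the values of these maps. -/
lemma exists_factorization_of_constant_rank {X : Type} [NormedAddCommGroup X] [NormedSpace ℝ X]
    {V : Type v} [NormedAddCommGroup V] [NormedSpace ℝ V] [FiniteDimensional ℝ V] {Y : Type*}
    [NormedAddCommGroup Y] [NormedSpace ℝ Y] [FiniteDimensional ℝ Y] {W : Type*}
    [NormedAddCommGroup W] [NormedSpace ℝ W] [CompleteSpace W] {U : Set X} (hU : IsOpen U) {x₀ : X}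
    (hx : x₀ ∈ U) {g : X × V → W} (hg : ContDiffOn ℝ ∞ g (U ×ˢ univ)) {L : X → V →L[ℝ] Y}
    (hL : ContDiffOn ℝ ∞ L U) {d : ℕ}
    (hd : ∀ y ∈ U, Module.finrank ℝ (LinearMap.range (L y).toLinearMap) = d) {J : Submodule ℝ V}
    (P : V →L[ℝ] V) (hPJ : ∀ p, P p ∈ J) (hP : ∀ p ∈ J, P p = p)
    (hLP : ∀ y ∈ U, ∀ p, L y (P p) = L y p) (hzero : ∀ y ∈ U, ∀ p ∈ J, L y p = 0 → g (y, p) = 0) :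
    ∃ U' ⊆ U, IsOpen U' ∧ x₀ ∈ U' ∧ ∃ H : X × V → (Y →L[ℝ] W), ContDiffOn ℝ ∞ H (U' ×ˢ univ) ∧
      ∀ y ∈ U', ∀ p ∈ J, g (y, p) = H (y, p) (L y p) := by
  obtain ⟨U', hU'U, hU', hxU', T, hT, hTL⟩ := exists_generalized_inverse hU hL hd hx
  obtain ⟨K, hK, hKo⟩ := exists_hadamard hU hg
  -- The segment runs from the kernel component `p - T L p`, where `g` vanishes, to `p`. Its
  -- increment `T L p` is linear in `L p`. Both pieces are projected by `P`, because `g` is only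
  -- known to vanish at kernel points in `J`, and `T` need not take values in `J`.
  refine ⟨U', hU'U, hU', hxU', fun p => (K (p.1, P (p.2 - T p.1 (L p.1 p.2)),
    P (T p.1 (L p.1 p.2)))).comp (P.comp (T p.1)), ?_, fun y hy p hp => ?_⟩
  · have hTp : ContDiffOn ℝ ∞ (fun p : X × V => T p.1) (U' ×ˢ univ) :=
      hT.comp contDiffOn_fst fun p hp => hp.1
    have hLp : ContDiffOn ℝ ∞ (fun p : X × V => L p.1) (U' ×ˢ univ) :=
      hL.comp contDiffOn_fst fun p hp => hU'U hp.1
    have hTL' : ContDiffOn ℝ ∞ (fun p : X × V => T p.1 (L p.1 p.2)) (U' ×ˢ univ) :=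
      hTp.clm_apply (hLp.clm_apply contDiffOn_snd)
    refine ContDiffOn.clm_comp ?_ (contDiffOn_const.clm_comp hTp)
    refine hK.comp (contDiffOn_fst.prodMk ((P.contDiff.comp_contDiffOn
      (contDiffOn_snd.sub hTL')).prodMk (P.contDiff.comp_contDiffOn hTL')))
      fun p hp => ⟨hU'U hp.1, mem_univ _⟩
  · have h2 : L y (P (p - T y (L y p))) = 0 := by
      rw [hLP y (hU'U hy), map_sub, hTL y hy, sub_self]
    have h3 := hKo y (hU'U hy) (P (p - T y (L y p))) (P (T y (L y p)))
    rw [← map_add, sub_add_cancel, hP p hp, hzero y (hU'U hy) _ (hPJ _) h2, sub_zero] at h3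
    exact h3

section Factorization

variable {n : ℕ} {M : Type u} [TopologicalSpace M] [ChartedSpace (EuclideanSpace ℝ (Fin n)) M]
  [IsManifold (𝓡 n) ∞ M]

/-- The jet at the point with coordinates `y` in the preferred chart at `x₀`. -/
def secJet (V : SmoothVB.{u, v, w} n M) (k : ℕ) (x₀ : M) {y : Eu n} (hy : y ∈ secDom V x₀) :
    Sec V →ₗ[ℝ] JetSpace n k V.Model where
  toFun s := jet k (secRep V s x₀) y
  map_add' s t := by
    have hO := (isOpen_secDom V x₀).mem_nhds hy
    rw [← jet_add ((contDiffOn_secRep V s x₀).contDiffAt hO)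
      ((contDiffOn_secRep V t x₀).contDiffAt hO)]
    refine jet_congr ?_
    filter_upwards [hO] with z hz using secRep_add V x₀ s t hz
  map_smul' c s := by
    have hO := (isOpen_secDom V x₀).mem_nhds hy
    rw [RingHom.id_apply, ← jet_const_smul c ((contDiffOn_secRep V s x₀).contDiffAt hO)]
    refine jet_congr ?_
    filter_upwards [hO] with z hz using secRep_smul V x₀ c s hz

/-- The change of charts and trivializations is an operator of order zero. It therefore turns equal
jets into equal jets, and it can be applied in both directions. -/
lemma jetAt_eq_iff (V : SmoothVB.{u, v, w} n M) (k : ℕ) {x₀ : M} {y : Eu n} (hy : y ∈ secDom V x₀)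
    (s t : Sec V) :
    jetAt V k ((extChartAt (𝓡 n) x₀).symm y) s = jetAt V k ((extChartAt (𝓡 n) x₀).symm y) t ↔
      jet k (secRep V s x₀) y = jet k (secRep V t x₀) y := by
  have key : ∀ (a b : M) (z : Eu n), z ∈ secOverlap V a b →
      jet k (secRep V s a) (chartChange a b z) = jet k (secRep V t a) (chartChange a b z) →
      jet k (secRep V s b) z = jet k (secRep V t b) z := by
    intro a b z hz h
    refine ((jetDep_secRep V a b).jet (isOpen_secOverlap V a b) (isOpen_secDom V a)
      ((contDiffOn_chartChange a b).mono fun _ hw => hw.2.1) (mapsTo_chartChange V a b)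
      (fun s => contDiffOn_secRep V s a) k).eq_of_jet_eq hz ?_
    rwa [zero_add]
  set x := (extChartAt (𝓡 n) x₀).symm y with hx
  have h1 : chartChange x₀ x (extChartAt (𝓡 n) x x) = y := by
    rw [chartChange, extChartAt_to_inv, hx, (extChartAt (𝓡 n) x₀).right_inv hy.1]
  constructor
  · intro h
    refine key x x₀ y ⟨hy, ⟨hy.1, mem_extChartAt_source x⟩, mem_secDom V x⟩ h
  · intro h
    refine key x₀ x (extChartAt (𝓡 n) x x) ⟨mem_secDom V x, ⟨mem_extChartAt_target x, ?_⟩, ?_⟩ ?_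
    · rw [mem_preimage, extChartAt_to_inv]
      exact (extChartAt (𝓡 n) x₀).map_target hy.1
    · rwa [h1]
    · rwa [h1]

lemma jetAt_eq_zero_iff (V : SmoothVB.{u, v, w} n M) (k : ℕ) {x₀ : M} {y : Eu n}
    (hy : y ∈ secDom V x₀) (s : Sec V) :
    jetAt V k ((extChartAt (𝓡 n) x₀).symm y) s = 0 ↔ jet k (secRep V s x₀) y = 0 := by
  have h := jetAt_eq_iff V k hy s 0
  rwa [map_zero, show jet k (secRep V 0 x₀) y = 0 from (secJet V k x₀ hy).map_zero] at h

/-- An operator that vanishes on the PDE manifold of a regular linear equation `e ψ = 0` is, near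
each point, linear in the jets of `e ψ`. -/
lemma IsRegularForm.exists_local_factorization [T2Space M] {F G : SmoothVB.{u, v, w} n M}
    {e : Sec F →ₗ[ℝ] Sec G} (he : IsRegularForm e) (m : ℕ) :
    ∃ N l : ℕ, ∀ (x₀ : M) {W : Type*} [NormedAddCommGroup W] [NormedSpace ℝ W] [CompleteSpace W]
      (out : Sec F → Eu n → W), DependsOnJet F m x₀ out →
      (∀ᶠ y in 𝓝 (extChartAt (𝓡 n) x₀ x₀), ∀ ψ,
        OnShell e ψ ((extChartAt (𝓡 n) x₀).symm y) → out ψ y = 0) →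
      ∃ U : Set (Eu n), IsOpen U ∧ extChartAt (𝓡 n) x₀ x₀ ∈ U ∧
        ∃ H : Eu n × JetSpace n N F.Model → (JetSpace n l G.Model →L[ℝ] W),
          ContDiffOn ℝ ∞ H (U ×ˢ univ) ∧ ∀ ψ, ∀ y ∈ U, out ψ y =
            H (y, jet N (secRep F ψ x₀) y) (jet l (secRep G (e ψ) x₀) y) := by
  obtain ⟨k, hk, -, -⟩ := he.involutive
  obtain ⟨l, ⟨d, hd⟩, hcut⟩ := he.subbundle m
  -- The orders are fixed before the point `x₀`, so that local factorizations can later be glued to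
  -- an operator of finite order. The jet order `k + l + m` suffices both for the `l`-jet of `e ψ`
  -- and for the `m`-jet in `out`.
  refine ⟨k + l + m, l, fun x₀ W _ _ _ out hout hnull => ?_⟩
  set N := k + l + m
  obtain ⟨U₀, hU₀, hxU₀, hdep⟩ := hout
  obtain ⟨U₁, hU₁, hxU₁, hedep⟩ := hk x₀
  obtain ⟨U₂, hnull, hU₂, hxU₂⟩ := eventually_nhds_iff.1 hnull
  set U := (U₀ ∩ U₁ ∩ U₂) ∩ (secDom F x₀ ∩ secDom G x₀) with hUdef
  have hU : IsOpen U := ((hU₀.inter hU₁).inter hU₂).inter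
    ((isOpen_secDom F x₀).inter (isOpen_secDom G x₀))
  have hxU : extChartAt (𝓡 n) x₀ x₀ ∈ U := ⟨⟨⟨hxU₀, hxU₁⟩, hxU₂⟩, mem_secDom F x₀, mem_secDom G x₀⟩
  have hUF : U ⊆ secDom F x₀ := fun y hy => hy.2.1
  have hUG : U ⊆ secDom G x₀ := fun y hy => hy.2.2
  replace hdep : JetDep U id m (fun ψ => secRep F ψ x₀) out :=
    JetDep.mono_set (U := U₀) hdep fun y hy => hy.1.1.1
  replace hedep : JetDep U id k (fun ψ => secRep F ψ x₀) (fun ψ => secRep G (e ψ) x₀) :=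
    JetDep.mono_set (U := U₁) hedep fun y hy => hy.1.1.2
  obtain ⟨A₀, hA₀, hA₀o⟩ := hdep
  obtain ⟨A, hA, hAo⟩ := (hedep.jet hU (isOpen_secDom F x₀) contDiffOn_id
    (fun y hy => hUF hy) (fun ψ => contDiffOn_secRep F ψ x₀) l).mono (Nat.le_add_right (k + l) m)
  dsimp only [id] at hAo hA₀o
  -- the jets of sections, and a projection to them
  set J := smoothJets n N F.Model with hJdef
  obtain ⟨q, hq⟩ := LinearMap.exists_leftInverse_of_injective J.subtype
    (LinearMap.ker_eq_bot.2 J.injective_subtype)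
  -- `JetSpace` contains non-symmetric multilinear maps, which are not jets of functions. The
  -- coordinate function `A` is determined by `e` only on `J`, and precomposition with `P` discards
  -- its arbitrary values elsewhere.
  let P : JetSpace n N F.Model →L[ℝ] JetSpace n N F.Model :=
    (J.subtype ∘ₗ q).toContinuousLinearMap
  have hPJ : ∀ p, P p ∈ J := fun p => (q p).2
  have hP : ∀ p ∈ J, P p = p := fun p hp =>
    congrArg Subtype.val (LinearMap.congr_fun hq (⟨p, hp⟩ : J))
  have hJ : ∀ y ∈ U, ∀ p ∈ J, ∃ ψ, jet N (secRep F ψ x₀) y = p := by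
    rintro y hy _ ⟨f, hf, rfl⟩
    obtain ⟨ψ, hψ⟩ := exists_section F x₀ (hUF hy)
      (hf.comp (contDiff_id.sub (contDiff_const (c := y))))
    refine ⟨ψ, (jet_congr hψ).trans ?_⟩
    exact (jet_comp_sub f y y).trans (by rw [sub_self])
  have hJ' : ∀ y ∈ U, ∀ ψ, jet N (secRep F ψ x₀) y ∈ J := fun y hy ψ =>
    jet_mem_smoothJets (isOpen_secDom F x₀) (contDiffOn_secRep F ψ x₀) (hUF hy)
  -- the linear maps between jet spaces defined by `e`
  have hlin : ∀ y ∈ U, IsLinearMap ℝ (fun p => A (y, P p)) := by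
    intro y hy
    constructor
    · intro p p'
      obtain ⟨ψ, hψ⟩ := hJ y hy _ (hPJ p)
      obtain ⟨ψ', hψ'⟩ := hJ y hy _ (hPJ p')
      have h1 : jet N (secRep F (ψ + ψ') x₀) y = P (p + p') := by
        rw [map_add, ← hψ, ← hψ']
        exact (secJet F N x₀ (hUF hy)).map_add ψ ψ'
      rw [← h1, ← hψ, ← hψ', ← hAo _ y hy, ← hAo _ y hy, ← hAo _ y hy, map_add]
      exact (secJet G l x₀ (hUG hy)).map_add _ _
    · intro c p
      obtain ⟨ψ, hψ⟩ := hJ y hy _ (hPJ p)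
      have h1 : jet N (secRep F (c • ψ) x₀) y = P (c • p) := by
        rw [map_smul, ← hψ]
        exact (secJet F N x₀ (hUF hy)).map_smul c ψ
      rw [← h1, ← hψ, ← hAo _ y hy, ← hAo _ y hy, map_smul]
      exact (secJet G l x₀ (hUG hy)).map_smul _ _
  -- `A (y, P ·)` is linear, so it equals its derivative at `0`. Written as a derivative, it depends
  -- smoothly on `y` as a continuous linear map.
  let L : Eu n → JetSpace n N F.Model →L[ℝ] JetSpace n l G.Model := fun y =>
    (fderiv ℝ A (y, 0)).comp ((ContinuousLinearMap.inr ℝ (Eu n) (JetSpace n N F.Model)).comp P)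
  have hUu : IsOpen (U ×ˢ (univ : Set (JetSpace n N F.Model))) := hU.prod isOpen_univ
  have hLs : ContDiffOn ℝ ∞ L U := by
    refine ContDiffOn.clm_comp ?_ contDiffOn_const
    exact (hA.fderiv_of_isOpen hUu (m := ∞) (by simp)).comp
      (contDiffOn_id.prodMk contDiffOn_const) fun y hy => ⟨hy, mem_univ _⟩
  have hL : ∀ y ∈ U, ∀ p, L y p = A (y, P p) := by
    intro y hy p
    have h1 : HasFDerivAt A (fderiv ℝ A (y, P 0)) (y, P 0) :=
      ((hA.contDiffAt (hUu.mem_nhds ⟨hy, mem_univ _⟩)).differentiableAt (by simp)).hasFDerivAt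
    have h2 := h1.comp (0 : JetSpace n N F.Model)
      ((hasFDerivAt_prodMk_right y (P 0)).comp 0 P.hasFDerivAt)
    have h3 : HasFDerivAt (fun p => A (y, P p))
        (IsLinearMap.mk' _ (hlin y hy)).toContinuousLinearMap 0 :=
      (IsLinearMap.mk' _ (hlin y hy)).toContinuousLinearMap.hasFDerivAt
    have h4 := h2.unique h3
    rw [map_zero] at h4
    exact DFunLike.congr_fun h4 p
  have hrank : ∀ y ∈ U, Module.finrank ℝ (LinearMap.range (L y).toLinearMap) = d := by
    intro y hy
    have h1 : LinearMap.range (L y).toLinearMap =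
        LinearMap.range (secJet G l x₀ (hUG hy) ∘ₗ e) := by
      ext t
      constructor
      · rintro ⟨p, rfl⟩
        obtain ⟨ψ, hψ⟩ := hJ y hy _ (hPJ p)
        refine ⟨ψ, ((hAo ψ y hy).trans ?_).trans (hL y hy p).symm⟩
        rw [hψ]
      · rintro ⟨ψ, rfl⟩
        refine ⟨jet N (secRep F ψ x₀) y, (hL y hy _).trans ?_⟩
        rw [hP _ (hJ' y hy ψ)]
        exact (hAo ψ y hy).symm
    -- The rank hypothesis concerns jets in the preferred coordinates at each point, while `L` uses
    -- the fixed coordinates at `x₀`. The two jet maps have the same kernel on sections, hence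
    -- images of the same dimension.
    have h2 : LinearMap.ker (secJet G l x₀ (hUG hy) ∘ₗ e) =
        LinearMap.ker (jetAt G l ((extChartAt (𝓡 n) x₀).symm y) ∘ₗ e) := by
      ext ψ
      exact (jetAt_eq_zero_iff G l (hUG hy) (e ψ)).symm
    rw [h1, ← hd ((extChartAt (𝓡 n) x₀).symm y)]
    exact ((LinearMap.quotKerEquivRange _).symm.trans ((Submodule.quotEquivOfEq _ _ h2).trans
      (LinearMap.quotKerEquivRange _))).finrank_eq
  have hmN : m ≤ N := Nat.le_add_left m (k + l)
  have hzero : ∀ y ∈ U, ∀ p ∈ J, L y p = 0 → A₀ (y, jetTrunc F.Model n hmN p) = 0 := by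
    intro y hy p hp hLp
    obtain ⟨ψ, hψ⟩ := hJ y hy p hp
    have h1 : jet l (secRep G (e ψ) x₀) y = 0 := by
      rw [hL y hy, hP p hp, ← hψ] at hLp
      exact (hAo ψ y hy).trans hLp
    -- A section solving the `l`-prolonged equation at the point is replaced by one that is on-shell
    -- there and has the same `m`-jet; `out` cannot distinguish the two.
    obtain ⟨ψ', hψ', hψψ'⟩ := hcut _ ψ ((jetAt_eq_zero_iff G l (hUG hy) (e ψ)).2 h1)
    rw [jetAt_eq_iff F m (hUF hy)] at hψψ'
    rw [← hψ, jetTrunc_jet, ← hψψ', ← hA₀o ψ' y hy]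
    exact hnull y hy.1.2 ψ' hψ'
  have hg : ContDiffOn ℝ ∞ (fun p : Eu n × JetSpace n N F.Model =>
      A₀ (p.1, jetTrunc F.Model n hmN p.2)) (U ×ˢ univ) :=
    hA₀.comp (ContDiff.contDiffOn (by fun_prop)) fun p hp => ⟨hp.1, mem_univ _⟩
  have hLP : ∀ y ∈ U, ∀ a, L y (P a) = L y a := fun y hy a => by
    rw [hL y hy, hL y hy, hP _ (hPJ a)]
  obtain ⟨U', hU'U, hU', hxU', H, hH, hHo⟩ :=
    exists_factorization_of_constant_rank hU hxU hg hLs hrank P hPJ hP hLP hzero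
  refine ⟨U', hU', hxU', H, hH, fun ψ y hy => ?_⟩
  have hyU := hU'U hy
  have hpJ := hJ' y hyU ψ
  have h1 : jet l (secRep G (e ψ) x₀) y = L y (jet N (secRep F ψ x₀) y) := by
    rw [hL y hyU, hP _ hpJ]
    exact hAo ψ y hyU
  rw [h1, ← hHo y hy _ hpJ, hA₀o ψ y hyU]
  rfl

end Factorization

/-! ### Operators depending on a pair of sections -/

section PairJets

variable {n : ℕ} {X : Type v} [NormedAddCommGroup X] [NormedSpace ℝ X]
  {Y : Type w} [NormedAddCommGroup Y] [NormedSpace ℝ Y]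

/-- The jet of a pair of functions. -/
def pairJet (n k : ℕ) (X Y : Type*) [NormedAddCommGroup X] [NormedSpace ℝ X]
    [NormedAddCommGroup Y] [NormedSpace ℝ Y] :
    JetSpace n k X × JetSpace n k Y →L[ℝ] JetSpace n k (X × Y) :=
  (jetMap n k (ContinuousLinearMap.inl ℝ X Y)).coprod (jetMap n k (ContinuousLinearMap.inr ℝ X Y))

lemma jet_prodMk {k : ℕ} {f : Eu n → X} {g : Eu n → Y} {y : Eu n} (hf : ContDiffAt ℝ ∞ f y)
    (hg : ContDiffAt ℝ ∞ g y) :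
    jet k (fun z => (f z, g z)) y = pairJet n k X Y (jet k f y, jet k g y) := by
  have h1 := jet_clm_comp (k := k) (ContinuousLinearMap.inl ℝ X Y) hf
  have h2 := jet_clm_comp (k := k) (ContinuousLinearMap.inr ℝ X Y) hg
  rw [pairJet, ContinuousLinearMap.coprod_apply, ← h1, ← h2, ← jet_add]
  · simp
  · exact (ContinuousLinearMap.inl ℝ X Y).contDiff.contDiffAt.comp y hf
  · exact (ContinuousLinearMap.inr ℝ X Y).contDiff.contDiffAt.comp y hg

/-- With `L` a projection, an operator on one section becomes an operator on a pair. -/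
lemma JetDep.of_clm {X' : Type*} [NormedAddCommGroup X'] [NormedSpace ℝ X'] {ι : Type*} {W : Type*}
    [NormedAddCommGroup W] [NormedSpace ℝ W] {U V : Set (Eu n)} {σ : Eu n → Eu n} {k : ℕ}
    {u : ι → Eu n → X} {out : ι → Eu n → W} (h : JetDep U σ k u out) (L : X' →L[ℝ] X)
    {u' : ι → Eu n → X'} (hV : IsOpen V) (hu' : ∀ i, ContDiffOn ℝ ∞ (u' i) V) (hσ : MapsTo σ U V)
    (he : ∀ i, ∀ y ∈ V, u i y = L (u' i y)) : JetDep U σ k u' out := by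
  obtain ⟨A, hA, hAo⟩ := h
  refine ⟨fun p => A (p.1, jetMap n k L p.2), hA.comp (ContDiff.contDiffOn (by fun_prop))
    fun p hp => ⟨hp.1, mem_univ _⟩, fun i y hy => ?_⟩
  have h1 : u i =ᶠ[𝓝 (σ y)] fun z => L (u' i z) := by
    filter_upwards [hV.mem_nhds (hσ hy)] with z hz using he i z hz
  rw [hAo i y hy, jet_congr h1, jet_clm_comp L ((hu' i).contDiffAt (hV.mem_nhds (hσ hy)))]

end PairJets

section PairOperators

variable {n : ℕ} {M : Type u} [TopologicalSpace M] [ChartedSpace (EuclideanSpace ℝ (Fin n)) M]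

/-- The expression of a pair of sections in the preferred chart and trivializations at `x₀`. -/
def pairRep (F G : SmoothVB.{u, v, w} n M) (x₀ : M) (p : Sec F × Sec G) :
    Eu n → F.Model × G.Model :=
  fun y => (secRep F p.1 x₀ y, secRep G p.2 x₀ y)

/-- The set of coordinates of the points at which the preferred chart and trivializations at `x₀` are
defined. -/
def pairDom (F G : SmoothVB.{u, v, w} n M) (x₀ : M) : Set (Eu n) := secDom F x₀ ∩ secDom G x₀

lemma isOpen_pairDom (F G : SmoothVB.{u, v, w} n M) (x₀ : M) : IsOpen (pairDom F G x₀) :=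
  (isOpen_secDom F x₀).inter (isOpen_secDom G x₀)

lemma mem_pairDom (F G : SmoothVB.{u, v, w} n M) (x₀ : M) :
    extChartAt (𝓡 n) x₀ x₀ ∈ pairDom F G x₀ := ⟨mem_secDom F x₀, mem_secDom G x₀⟩

/-- Near `x₀`, in coordinates, `out (ψ, ζ)` is a smooth function of the point and of the `k`-jets
of `ψ` and `ζ`. -/
def PairDep (F G : SmoothVB.{u, v, w} n M) (k : ℕ) (x₀ : M) {W : Type*} [NormedAddCommGroup W]
    [NormedSpace ℝ W] (out : Sec F × Sec G → Eu n → W) : Prop :=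
  ∃ U : Set (Eu n), IsOpen U ∧ extChartAt (𝓡 n) x₀ x₀ ∈ U ∧ U ⊆ pairDom F G x₀ ∧
    JetDep U id k (pairRep F G x₀) out

variable {F G : SmoothVB.{u, v, w} n M}

lemma PairDep.exists_subset {k : ℕ} {x₀ : M} {W : Type*} [NormedAddCommGroup W]
    [NormedSpace ℝ W] {out : Sec F × Sec G → Eu n → W} (h : PairDep F G k x₀ out)
    {O : Set (Eu n)} (hO : O ∈ 𝓝 (extChartAt (𝓡 n) x₀ x₀)) :
    ∃ U : Set (Eu n), IsOpen U ∧ extChartAt (𝓡 n) x₀ x₀ ∈ U ∧ U ⊆ pairDom F G x₀ ∧ U ⊆ O ∧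
      JetDep U id k (pairRep F G x₀) out := by
  obtain ⟨U, hU, hx, hUd, h⟩ := h
  obtain ⟨O', hO'O, hO', hxO'⟩ := mem_nhds_iff.1 hO
  exact ⟨U ∩ O', hU.inter hO', ⟨hx, hxO'⟩, inter_subset_left.trans hUd,
    inter_subset_right.trans hO'O, h.mono_set inter_subset_left⟩

variable [IsManifold (𝓡 n) ∞ M]

lemma contDiffOn_pairRep (F G : SmoothVB.{u, v, w} n M) (x₀ : M) (p : Sec F × Sec G) :
    ContDiffOn ℝ ∞ (pairRep F G x₀ p) (pairDom F G x₀) :=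
  ((contDiffOn_secRep F p.1 x₀).mono inter_subset_left).prodMk
    ((contDiffOn_secRep G p.2 x₀).mono inter_subset_right)

lemma jet_pairRep {k : ℕ} {x₀ : M} {y : Eu n} (hy : y ∈ pairDom F G x₀) (p : Sec F × Sec G) :
    jet k (pairRep F G x₀ p) y =
      pairJet n k F.Model G.Model (jet k (secRep F p.1 x₀) y, jet k (secRep G p.2 x₀) y) :=
  jet_prodMk ((contDiffOn_secRep F p.1 x₀).contDiffAt ((isOpen_secDom F x₀).mem_nhds hy.1))
    ((contDiffOn_secRep G p.2 x₀).contDiffAt ((isOpen_secDom G x₀).mem_nhds hy.2))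

lemma JetDep.fst_pair {ι : Type*} {κ : ι → Sec F × Sec G} {W : Type*} [NormedAddCommGroup W]
    [NormedSpace ℝ W] {U : Set (Eu n)} {σ : Eu n → Eu n} {k : ℕ} {x₀ : M} {out : ι → Eu n → W}
    (h : JetDep U σ k (fun i => secRep F (κ i).1 x₀) out) (hσ : MapsTo σ U (pairDom F G x₀)) :
    JetDep U σ k (fun i => pairRep F G x₀ (κ i)) out :=
  h.of_clm (ContinuousLinearMap.fst ℝ F.Model G.Model) (isOpen_pairDom F G x₀)
    (fun i => contDiffOn_pairRep F G x₀ (κ i)) hσ fun _ _ _ => rfl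

lemma JetDep.snd_pair {ι : Type*} {κ : ι → Sec F × Sec G} {W : Type*} [NormedAddCommGroup W]
    [NormedSpace ℝ W] {U : Set (Eu n)} {σ : Eu n → Eu n} {k : ℕ} {x₀ : M} {out : ι → Eu n → W}
    (h : JetDep U σ k (fun i => secRep G (κ i).2 x₀) out) (hσ : MapsTo σ U (pairDom F G x₀)) :
    JetDep U σ k (fun i => pairRep F G x₀ (κ i)) out :=
  h.of_clm (ContinuousLinearMap.snd ℝ F.Model G.Model) (isOpen_pairDom F G x₀)
    (fun i => contDiffOn_pairRep F G x₀ (κ i)) hσ fun _ _ _ => rfl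

/-- The change of charts and trivializations, for pairs of sections. -/
lemma jetDep_pairRep (F G : SmoothVB.{u, v, w} n M) (x₀ x₁ : M) :
    JetDep (secOverlap F x₀ x₁ ∩ secOverlap G x₀ x₁) (chartChange x₀ x₁) 0 (pairRep F G x₀)
      (pairRep F G x₁) := by
  have hσ : MapsTo (chartChange x₀ x₁) (secOverlap F x₀ x₁ ∩ secOverlap G x₀ x₁)
      (pairDom F G x₀) := fun y hy => ⟨mapsTo_chartChange F x₀ x₁ hy.1,
    mapsTo_chartChange G x₀ x₁ hy.2⟩
  have h1 := (((jetDep_secRep F x₀ x₁).mono_set inter_subset_left).comp_index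
    (Prod.fst : Sec F × Sec G → Sec F)).fst_pair (κ := id) hσ
  have h2 := (((jetDep_secRep G x₀ x₁).mono_set inter_subset_right).comp_index
    (Prod.snd : Sec F × Sec G → Sec G)).snd_pair (κ := id) hσ
  exact h1.prodMk h2

/-- The local expression of an operator with values in forms, in another chart. -/
lemma PairDep.of_jetDep_formRep {q : ℕ} {R : Sec F → Sec G → FormField n M q} {U : Set (Eu n)}
    (hU : IsOpen U) {x₀ : M} (hUd : U ⊆ pairDom F G x₀) {k : ℕ}
    (h : JetDep U id k (pairRep F G x₀) (fun p => formRep (R p.1 p.2) x₀)) {x₁ : M}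
    (hx₁ : x₁ ∈ (extChartAt (𝓡 n) x₀).source) (hx₁U : extChartAt (𝓡 n) x₀ x₁ ∈ U) :
    PairDep F G k x₁ (fun p => formRep (R p.1 p.2) x₁) := by
  set U' : Set (Eu n) := pairDom F G x₁ ∩ (chartOverlap x₀ x₁ ∩ chartChange x₀ x₁ ⁻¹' U) with hU'
  have hU'o : IsOpen U' := (isOpen_pairDom F G x₁).inter
    ((contDiffOn_chartChange x₀ x₁).continuousOn.isOpen_inter_preimage
      (isOpen_chartOverlap x₀ x₁) hU)
  have hinv : ∀ y ∈ U', chartChange x₁ x₀ (chartChange x₀ x₁ y) = y := fun y hy => by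
    rw [chartChange, chartChange, (extChartAt (𝓡 n) x₀).left_inv hy.2.1.2,
      (extChartAt (𝓡 n) x₁).right_inv hy.2.1.1]
  have hmaps : MapsTo (chartChange x₀ x₁) U' (secOverlap F x₁ x₀ ∩ secOverlap G x₁ x₀) := by
    intro y hy
    have h1 := hUd hy.2.2
    have h2 : chartChange x₀ x₁ y ∈ chartOverlap x₁ x₀ := by
      refine ⟨h1.1.1, ?_⟩
      rw [mem_preimage, chartChange, (extChartAt (𝓡 n) x₀).left_inv hy.2.1.2]
      exact (extChartAt (𝓡 n) x₁).map_target hy.2.1.1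
    refine ⟨⟨h1.1, h2, ?_⟩, ⟨h1.2, h2, ?_⟩⟩
    · rw [hinv y hy]
      exact hy.1.1
    · rw [hinv y hy]
      exact hy.1.2
  have hσ : ContDiffOn ℝ ∞ (chartChange x₀ x₁) U' :=
    (contDiffOn_chartChange x₀ x₁).mono fun y hy => hy.2.1
  refine ⟨U', hU'o, ⟨mem_pairDom F G x₁, ⟨mem_extChartAt_target x₁, ?_⟩, ?_⟩,
    inter_subset_left, ?_⟩
  · rwa [mem_preimage, extChartAt_to_inv]
  · rwa [mem_preimage, chartChange, extChartAt_to_inv]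
  have h1 : JetDep U' (chartChange x₀ x₁) k (pairRep F G x₀)
      (fun p y => formRep (R p.1 p.2) x₀ (chartChange x₀ x₁ y)) := by
    obtain ⟨A, hA, hAo⟩ := h
    refine ⟨fun p => A (chartChange x₀ x₁ p.1, p.2), hA.comp ((hσ.comp contDiffOn_fst
      fun p hp => hp.1).prodMk contDiffOn_snd) fun p hp => ⟨hp.1.2.2, mem_univ _⟩,
      fun p y hy => hAo p _ hy.2.2⟩
  -- The jets in the coordinates at `x₀` are expressed by those in the coordinates at `x₁`. The
  -- point of evaluation travels to the chart at `x₀` and back, so the composite map is the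
  -- identity.
  have h2 := (jetDep_pairRep F G x₁ x₀).comp h1
    ((isOpen_secOverlap F x₁ x₀).inter (isOpen_secOverlap G x₁ x₀)) (isOpen_pairDom F G x₁)
    ((contDiffOn_chartChange x₁ x₀).mono fun y hy => hy.1.2.1)
    (fun y hy => ⟨hy.1.2.2, hy.2.2.2⟩) (contDiffOn_pairRep F G x₁) hσ hmaps
  rw [zero_add] at h2
  replace h2 := h2.congr_map (τ := id) fun y hy => (hinv y hy).symm
  refine (h2.map (B := fun p => p.2.compContinuousLinearMap
    (fderiv ℝ (chartChange x₀ x₁) p.1)) ?_).congr fun p y hy => formRep_chartChange _ hy.2.1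
  exact (contDiff_compContinuousLinearMap q).comp_contDiffOn
    (contDiffOn_snd.prodMk ((hσ.fderiv_of_isOpen hU'o (m := ∞) (by simp)).comp contDiffOn_fst
      fun p hp => hp.1))

/-- The jets of `ψ` and `ζ` together carry the same information as the jet of the pair. In this form
the one-argument calculus of `JetDep` applies. -/
lemma isLocalLinearOp_iff {q : ℕ} {R : Sec F → Sec G →ₗ[ℝ] FormField n M q} :
    IsLocalLinearOp R ↔ ∃ k, ∀ x₀, PairDep F G k x₀ (fun p => formRep (R p.1 p.2) x₀) := by
  constructor
  · rintro ⟨k, h⟩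
    refine ⟨k, fun x₀ => ?_⟩
    obtain ⟨U, hU, hx, A, hA, hAo⟩ := h x₀
    refine ⟨U ∩ pairDom F G x₀, hU.inter (isOpen_pairDom F G x₀), ⟨hx, mem_pairDom F G x₀⟩,
      inter_subset_right, ?_⟩
    have h1 : JetDep (U ∩ pairDom F G x₀) id k (pairRep F G x₀)
        (fun p y => jet k (secRep F p.1 x₀) y) :=
      (JetDep.jet_self (σ := id) (u := fun p : Sec F × Sec G => secRep F p.1 x₀)).fst_pair
        (κ := id) fun y hy => hy.2
    have h2 : JetDep (U ∩ pairDom F G x₀) id k (pairRep F G x₀)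
        (fun p y => jet k (secRep G p.2 x₀) y) :=
      (JetDep.jet_self (σ := id) (u := fun p : Sec F × Sec G => secRep G p.2 x₀)).snd_pair
        (κ := id) fun y hy => hy.2
    have h3 := (h1.prodMk h2).map (hA.mono (prod_mono inter_subset_left subset_rfl))
    rw [max_self] at h3
    exact h3.congr fun p y hy => hAo p.1 p.2 y hy.1
  · rintro ⟨k, h⟩
    refine ⟨k, fun x₀ => ?_⟩
    obtain ⟨U, hU, hx, hUd, A, hA, hAo⟩ := h x₀
    refine ⟨U, hU, hx, fun p => A (p.1, pairJet n k F.Model G.Model p.2), hA.comp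
      (ContDiff.contDiffOn (by fun_prop)) fun p hp => ⟨hp.1, mem_univ _⟩, fun ψ ζ y hy => ?_⟩
    refine (hAo (ψ, ζ) y hy).trans ?_
    rw [id, jet_pairRep (hUd hy)]

end PairOperators

/-! ### Null forms are linear in the equation -/

section Representation

variable {n : ℕ} {M : Type u} [TopologicalSpace M] [ChartedSpace (EuclideanSpace ℝ (Fin n)) M]
  [IsManifold (𝓡 n) ∞ M] {F G : SmoothVB.{u, v, w} n M}

/-- Evaluation of forms at a point. -/
def FormField.eval (q : ℕ) (x : M) :
    FormField n M q →ₗ[ℝ] ContinuousAlternatingMap ℝ (TangentSpace (𝓡 n) x) ℝ (Fin q) where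
  toFun α := α x
  map_add' _ _ := rfl
  map_smul' _ _ := rfl

/-- The pullback of a form at a point along the inverse of the preferred chart at `x₀`. -/
def symmPullback (q : ℕ) (x₀ : M) (y : Eu n) :
    ContinuousAlternatingMap ℝ (TangentSpace (𝓡 n) ((extChartAt (𝓡 n) x₀).symm y)) ℝ (Fin q) →ₗ[ℝ]
      ContinuousAlternatingMap ℝ (Eu n) ℝ (Fin q) where
  toFun β := β.compContinuousLinearMap (mfderiv (𝓡 n) (𝓡 n) (extChartAt (𝓡 n) x₀).symm y)
  map_add' _ _ := rfl
  map_smul' _ _ := rfl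

/-- The pullback of a form at a point along the preferred chart at `x₀`. -/
def chartPullback (q : ℕ) (x₀ x : M) :
    ContinuousAlternatingMap ℝ (Eu n) ℝ (Fin q) →ₗ[ℝ]
      ContinuousAlternatingMap ℝ (TangentSpace (𝓡 n) x) ℝ (Fin q) where
  toFun β := β.compContinuousLinearMap (mfderiv (𝓡 n) (𝓡 n) (extChartAt (𝓡 n) x₀) x)
  map_add' _ _ := rfl
  map_smul' _ _ := rfl

open Classical in
/-- The operator with values in forms that is given in the preferred chart at `x₀` by the function
`H` of the jets, extended by zero. -/
def chartOp (F G : SmoothVB.{u, v, w} n M) {q N l : ℕ} (x₀ : M) (U : Set (Eu n))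
    (hU : U ⊆ secDom G x₀)
    (H : Eu n × JetSpace n N F.Model →
      (JetSpace n l G.Model →L[ℝ] ContinuousAlternatingMap ℝ (Eu n) ℝ (Fin q)))
    (ψ : Sec F) : Sec G →ₗ[ℝ] FormField n M q :=
  LinearMap.pi fun x => if h : extChartAt (𝓡 n) x₀ x ∈ U then
    chartPullback q x₀ x ∘ₗ
      (H (extChartAt (𝓡 n) x₀ x, jet N (secRep F ψ x₀) (extChartAt (𝓡 n) x₀ x))).toLinearMap ∘ₗ
        secJet G l x₀ (hU h) else 0

lemma formRep_chartOp {q N l : ℕ} {x₀ : M} {U : Set (Eu n)} {hU : U ⊆ secDom G x₀}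
    {H : Eu n × JetSpace n N F.Model →
      (JetSpace n l G.Model →L[ℝ] ContinuousAlternatingMap ℝ (Eu n) ℝ (Fin q))}
    (ψ : Sec F) (ζ : Sec G) {y : Eu n} (hy : y ∈ U) :
    formRep (chartOp F G x₀ U hU H ψ ζ) x₀ y =
      H (y, jet N (secRep F ψ x₀) y) (jet l (secRep G ζ x₀) y) := by
  have hyt : y ∈ (extChartAt (𝓡 n) x₀).target := (hU hy).1
  have h1 : extChartAt (𝓡 n) x₀ ((extChartAt (𝓡 n) x₀).symm y) = y :=
    (extChartAt (𝓡 n) x₀).right_inv hyt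
  have hyo : y ∈ chartOverlap x₀ x₀ := ⟨hyt, (extChartAt (𝓡 n) x₀).map_target hyt⟩
  -- The transition map from a chart to itself is the identity near `y`, so the pullbacks along the
  -- chart and along its inverse cancel.
  have h2 : fderiv ℝ (chartChange x₀ x₀) y = ContinuousLinearMap.id ℝ (Eu n) := by
    have h3 : chartChange x₀ x₀ =ᶠ[𝓝 y] id := by
      filter_upwards [(isOpen_extChartAt_target x₀).mem_nhds hyt] with z hz
      exact (extChartAt (𝓡 n) x₀).right_inv hz
    rw [h3.fderiv_eq, fderiv_id]
  rw [fderiv_chartChange hyo] at h2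
  have h4 : chartOp F G x₀ U hU H ψ ζ ((extChartAt (𝓡 n) x₀).symm y) =
      (H (y, jet N (secRep F ψ x₀) y) (jet l (secRep G ζ x₀) y)).compContinuousLinearMap
        (mfderiv (𝓡 n) (𝓡 n) (extChartAt (𝓡 n) x₀) ((extChartAt (𝓡 n) x₀).symm y)) := by
    have h5 : extChartAt (𝓡 n) x₀ ((extChartAt (𝓡 n) x₀).symm y) ∈ U := by rwa [h1]
    classical
    change (dite _ _ _ : Sec G →ₗ[ℝ] _) ζ = _
    rw [dif_pos h5]
    change (H (extChartAt (𝓡 n) x₀ ((extChartAt (𝓡 n) x₀).symm y), jet N (secRep F ψ x₀)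
      (extChartAt (𝓡 n) x₀ ((extChartAt (𝓡 n) x₀).symm y))) (jet l (secRep G ζ x₀)
      (extChartAt (𝓡 n) x₀ ((extChartAt (𝓡 n) x₀).symm y)))).compContinuousLinearMap _ = _
    rw [h1]
  rw [formRep, h4]
  ext v
  refine congrArg (H (y, jet N (secRep F ψ x₀) y) (jet l (secRep G ζ x₀) y))
    (funext fun i => ?_)
  exact DFunLike.congr_fun h2 (v i)

/-- The order `k` does not depend on `x₀`. Jet dependence is asserted at every point of `O`, not
only at `x₀`, since a partition of unity uses each local operator throughout its support. -/
lemma exists_local_representation [T2Space M] {e : Sec F →ₗ[ℝ] Sec G} (he : IsRegularForm e)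
    {q : ℕ} {ρ : Sec F → FormField n M q} (hρ : ρ ∈ nullForms e q) :
    ∃ k : ℕ, ∀ x₀ : M, ∃ O : Set M, IsOpen O ∧ x₀ ∈ O ∧
      ∃ R : Sec F → Sec G →ₗ[ℝ] FormField n M q, (∀ ψ, ∀ x ∈ O, ρ ψ x = R ψ (e ψ) x) ∧
        ∀ x₁ ∈ O, PairDep F G k x₁ (fun p => formRep (R p.1 p.2) x₁) := by
  obtain ⟨⟨m, hm⟩, hnull⟩ := hρ
  obtain ⟨N, l, hNl⟩ := he.exists_local_factorization m
  refine ⟨max N l, fun x₀ => ?_⟩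
  have : CompleteSpace (ContinuousAlternatingMap ℝ (Eu n) ℝ (Fin q)) :=
    FiniteDimensional.complete ℝ _
  obtain ⟨U₀, hU₀, hxU₀, H, hH, hHo⟩ := hNl x₀ (fun ψ => formRep (ρ ψ) x₀) (hm x₀)
    (Eventually.of_forall fun y ψ h => formRep_eq_zero (hnull ψ _ h))
  set U : Set (Eu n) := U₀ ∩ pairDom F G x₀ with hUdef
  have hU : IsOpen U := hU₀.inter (isOpen_pairDom F G x₀)
  have hUG : U ⊆ secDom G x₀ := fun y hy => hy.2.2
  have hdep : JetDep U id (max N l) (pairRep F G x₀)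
      (fun p => formRep (chartOp F G x₀ U hUG H p.1 p.2) x₀) := by
    have h1 : JetDep U id N (pairRep F G x₀) (fun p y => jet N (secRep F p.1 x₀) y) :=
      (JetDep.jet_self (σ := id) (u := fun p : Sec F × Sec G => secRep F p.1 x₀)).fst_pair
        (κ := id) fun y hy => hy.2
    have h2 : JetDep U id l (pairRep F G x₀) (fun p y => jet l (secRep G p.2 x₀) y) :=
      (JetDep.jet_self (σ := id) (u := fun p : Sec F × Sec G => secRep G p.2 x₀)).snd_pair
        (κ := id) fun y hy => hy.2
    refine ((h1.prodMk h2).map (B := fun p => H (p.1, p.2.1) p.2.2) ?_).congr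
      fun p y hy => formRep_chartOp p.1 p.2 hy
    refine ContDiffOn.clm_apply (hH.comp (ContDiff.contDiffOn (by fun_prop))
      fun p hp => ⟨hp.1.1, mem_univ _⟩) (ContDiff.contDiffOn (by fun_prop))
  refine ⟨(extChartAt (𝓡 n) x₀).source ∩ extChartAt (𝓡 n) x₀ ⁻¹' U,
    (continuousOn_extChartAt x₀).isOpen_inter_preimage (isOpen_extChartAt_source x₀) hU,
    ⟨mem_extChartAt_source x₀, hxU₀, mem_pairDom F G x₀⟩, chartOp F G x₀ U hUG H, ?_, ?_⟩
  · rintro ψ x ⟨hx, hxU⟩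
    rw [← formRep_pullback (ρ ψ) hx, hHo ψ _ hxU.1, ← formRep_chartOp (hU := hUG) ψ (e ψ) hxU,
      formRep_pullback _ hx]
  · rintro x₁ ⟨hx₁, hx₁U⟩
    exact PairDep.of_jetDep_formRep (R := fun ψ ζ => chartOp F G x₀ U hUG H ψ ζ) hU
      inter_subset_right hdep hx₁ hx₁U

/-- A null form is represented by a local linear operator in the equation. -/
theorem exists_representsForm [T2Space M] [SecondCountableTopology M]
    {e : Sec F →ₗ[ℝ] Sec G} (he : IsRegularForm e)
    {q : ℕ} {ρ : Sec F → FormField n M q} (hρ : ρ ∈ nullForms e q) :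
    ∃ R : Sec F → Sec G →ₗ[ℝ] FormField n M q, RepresentsForm e R ρ := by
  obtain ⟨k, hk⟩ := exists_local_representation he hρ
  choose O hO hxO R hR hRdep using hk
  have : LocallyCompactSpace M := ChartedSpace.locallyCompactSpace (EuclideanSpace ℝ (Fin n)) M
  obtain ⟨χ, hχ⟩ := SmoothPartitionOfUnity.exists_isSubordinate (𝓡 n) isClosed_univ O hO
    (fun x _ => mem_iUnion.2 ⟨x, hxO x⟩)
  let S : Sec F → Sec G →ₗ[ℝ] FormField n M q := fun ψ => LinearMap.pi fun x =>
    ∑ i ∈ χ.finsupport x, χ i x • (FormField.eval q x ∘ₗ R i ψ)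
  have hS : ∀ ψ ζ x, S ψ ζ x = ∑ i ∈ χ.finsupport x, χ i x • R i ψ ζ x := fun ψ ζ x =>
    (LinearMap.sum_apply _ _ _).trans rfl
  refine ⟨S, isLocalLinearOp_iff.2 ⟨k, fun x₀ => ?_⟩, fun ψ => funext fun x => ?_⟩
  -- Only the finitely many indices whose closed support contains `x₀` contribute near `x₀`, and
  -- each of these has `x₀` in the domain `O i` of its local operator.
  · set s := χ.fintsupport x₀ with hs
    have hsO : ∀ i ∈ s, x₀ ∈ O i := fun i hi => hχ i ((χ.mem_fintsupport_iff x₀ i).1 hi)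
    have hUi : ∀ i : M, ∃ U : Set (Eu n), IsOpen U ∧ extChartAt (𝓡 n) x₀ x₀ ∈ U ∧
        (i ∈ s → JetDep U id k (pairRep F G x₀) (fun p => formRep (R i p.1 p.2) x₀)) := by
      intro i
      by_cases hi : i ∈ s
      · obtain ⟨U, hU, hx, -, h⟩ := hRdep i x₀ (hsO i hi)
        exact ⟨U, hU, hx, fun _ => h⟩
      · exact ⟨univ, isOpen_univ, mem_univ _, fun h => absurd h hi⟩
    choose U hU hxU hUdep using hUi
    have hev : ∀ᶠ y in 𝓝 (extChartAt (𝓡 n) x₀ x₀),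
        χ.finsupport ((extChartAt (𝓡 n) x₀).symm y) ⊆ s := by
      have hc := continuousAt_extChartAt_symm (I := 𝓡 n) x₀
      rw [ContinuousAt, extChartAt_to_inv] at hc
      exact hc.eventually (χ.eventually_finsupport_subset x₀)
    obtain ⟨U', hU's, hU', hxU'⟩ := eventually_nhds_iff.1 hev
    set V : Set (Eu n) := (⋂ i ∈ s, U i) ∩ U' ∩ pairDom F G x₀ with hV
    refine ⟨V, (((isOpen_biInter_finset fun i _ => hU i).inter hU').inter
      (isOpen_pairDom F G x₀)), ⟨⟨mem_iInter₂.2 fun i _ => hxU i, hxU'⟩, mem_pairDom F G x₀⟩,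
      inter_subset_right, ?_⟩
    have h1 : ∀ i ∈ s, JetDep V id k (pairRep F G x₀) (fun p y =>
        χ i ((extChartAt (𝓡 n) x₀).symm y) • formRep (R i p.1 p.2) x₀ y) := by
      intro i hi
      have h2 := (hUdep i hi).mono_set (V := V) fun y hy => mem_iInter₂.1 hy.1.1 i hi
      refine h2.map (B := fun p => χ i ((extChartAt (𝓡 n) x₀).symm p.1) • p.2) ?_
      refine ContDiffOn.fun_smul ?_ contDiffOn_snd
      have h3 : ContDiffOn ℝ ∞ (fun y => χ i ((extChartAt (𝓡 n) x₀).symm y)) V :=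
        contMDiffOn_iff_contDiffOn.1 ((χ i).contMDiff.comp_contMDiffOn
          ((contMDiffOn_extChartAt_symm (n := ∞) (I := 𝓡 n) x₀).mono fun y hy => hy.2.1.1))
      exact h3.comp contDiffOn_fst fun p hp => hp.1
    refine (JetDep.sum s h1).congr fun p y hy => ?_
    have h4 : S p.1 p.2 ((extChartAt (𝓡 n) x₀).symm y) =
        ∑ i ∈ s, χ i ((extChartAt (𝓡 n) x₀).symm y) •
          R i p.1 p.2 ((extChartAt (𝓡 n) x₀).symm y) := by
      rw [hS]
      refine Finset.sum_subset (hU's y hy.1.2) fun i _ hi => ?_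
      rw [SmoothPartitionOfUnity.mem_finsupport, Function.notMem_support] at hi
      rw [hi, zero_smul]
    refine (congrArg (symmPullback q x₀ y) h4).trans ?_
    rw [map_sum]
    exact Finset.sum_congr rfl fun i _ => map_smul _ _ _
  · rw [hS]
    -- Each local operator reproduces `ρ` where its weight is nonzero, and the weights sum to one.
    have h1 : ∀ i ∈ χ.finsupport x, χ i x • R i ψ (e ψ) x = χ i x • ρ ψ x := by
      intro i hi
      rw [SmoothPartitionOfUnity.mem_finsupport] at hi
      rw [hR i ψ x (hχ i (subset_tsupport _ hi))]
    rw [Finset.sum_congr rfl h1, ← Finset.sum_smul, χ.sum_finsupport x (mem_univ x), one_smul]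

end Representation

/-! ### Local operators: composition, exterior derivative, linearization -/

section LocalOperators

lemma JetDep.self {n : ℕ} {X : Type v} [NormedAddCommGroup X] [NormedSpace ℝ X] {ι : Type*}
    {U : Set (Eu n)} (u : ι → Eu n → X) : JetDep U id 0 u u :=
  (JetDep.jet_self (U := U) (σ := id) (k := 0) (u := u)).clm
    ((continuousMultilinearCurryFin0 ℝ (Eu n) X).toContinuousLinearEquiv.toContinuousLinearMap.comp
      (ContinuousLinearMap.proj (R := ℝ) (φ := fun i : Fin 1 => ContinuousMultilinearMap ℝ
        (fun _ : Fin (i : ℕ) => Eu n) X) 0))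

/-- The symmetry of the second derivative of `Θ`, evaluated on the vectors `(1, 0)` and `(0, v)`. -/
lemma hasDerivAt_fderiv_comm {E : Type*} [NormedAddCommGroup E] [NormedSpace ℝ E] {W : Type*}
    [NormedAddCommGroup W] [NormedSpace ℝ W] {Θ : ℝ × E → W} {t₀ : ℝ} {y₀ : E}
    (hΘ : ContDiffAt ℝ ∞ Θ (t₀, y₀)) :
    HasDerivAt (fun t => fderiv ℝ (fun y => Θ (t, y)) y₀)
      (fderiv ℝ (fun y => deriv (fun t => Θ (t, y)) t₀) y₀) t₀ := by
  have hdiff : ∀ᶠ z in 𝓝 (t₀, y₀), DifferentiableAt ℝ Θ z := by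
    filter_upwards [(hΘ.of_le (m := 1) (by exact_mod_cast le_top)).eventually (by simp)] with z hz
    exact hz.differentiableAt (by simp)
  have hD : HasFDerivAt (fderiv ℝ Θ) (fderiv ℝ (fderiv ℝ Θ) (t₀, y₀)) (t₀, y₀) :=
    ((hΘ.fderiv_right (m := ∞) (by simp)).differentiableAt (by simp)).hasFDerivAt
  have hsymm : IsSymmSndFDerivAt ℝ Θ (t₀, y₀) :=
    hΘ.isSymmSndFDerivAt (by
      simp only [minSmoothness_of_isRCLikeNormedField]
      exact WithTop.coe_le_coe.2 le_top)
  have h1 : (fun t => fderiv ℝ (fun y => Θ (t, y)) y₀) =ᶠ[𝓝 t₀]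
      fun t => (fderiv ℝ Θ (t, y₀)).comp (ContinuousLinearMap.inr ℝ ℝ E) := by
    have hc : ContinuousAt (fun t : ℝ => (t, y₀)) t₀ := by fun_prop
    filter_upwards [hc.eventually hdiff] with t ht
    exact (ht.hasFDerivAt.comp y₀ (hasFDerivAt_prodMk_right t y₀)).fderiv
  have h2 : (fun y => deriv (fun t => Θ (t, y)) t₀) =ᶠ[𝓝 y₀] fun y => fderiv ℝ Θ (t₀, y) (1, 0) := by
    have hc : ContinuousAt (fun y : E => (t₀, y)) y₀ := by fun_prop
    filter_upwards [hc.eventually hdiff] with y hy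
    exact (hy.hasFDerivAt.comp_hasDerivAt t₀
      ((hasDerivAt_id t₀).prodMk (hasDerivAt_const t₀ y))).deriv
  have h3 : HasFDerivAt (fun y => fderiv ℝ Θ (t₀, y) (1, 0))
      (((ContinuousLinearMap.apply ℝ W ((1 : ℝ), (0 : E))).comp
        (fderiv ℝ (fderiv ℝ Θ) (t₀, y₀))).comp (ContinuousLinearMap.inr ℝ ℝ E)) y₀ :=
    (((ContinuousLinearMap.apply ℝ W ((1 : ℝ), (0 : E))).hasFDerivAt.comp _ hD).comp y₀
      (hasFDerivAt_prodMk_right t₀ y₀))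
  have h4 : HasDerivAt (fun t => (fderiv ℝ Θ (t, y₀)).comp (ContinuousLinearMap.inr ℝ ℝ E))
      ((fderiv ℝ (fderiv ℝ Θ) (t₀, y₀) (1, 0)).comp (ContinuousLinearMap.inr ℝ ℝ E)) t₀ := by
    have h5 : HasDerivAt (fun t => fderiv ℝ Θ (t, y₀))
        (fderiv ℝ (fderiv ℝ Θ) (t₀, y₀) (1, 0)) t₀ :=
      hD.comp_hasDerivAt t₀ ((hasDerivAt_id t₀).prodMk (hasDerivAt_const t₀ y₀))
    exact ((ContinuousLinearMap.compL ℝ E (ℝ × E) W).flip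
      (ContinuousLinearMap.inr ℝ ℝ E)).hasFDerivAt.comp_hasDerivAt t₀ h5
  rw [h2.fderiv_eq, h3.fderiv]
  refine (h4.congr_of_eventuallyEq h1).congr_deriv ?_
  ext v
  exact hsymm (1, 0) (0, v)

lemma deriv_clm_fderiv_comm {E : Type*} [NormedAddCommGroup E] [NormedSpace ℝ E] {W : Type*}
    [NormedAddCommGroup W] [NormedSpace ℝ W] {W' : Type*} [NormedAddCommGroup W'] [NormedSpace ℝ W']
    {Θ : ℝ × E → W} {t₀ : ℝ} {y₀ : E} (hΘ : ContDiffAt ℝ ∞ Θ (t₀, y₀)) (D : (E →L[ℝ] W) →L[ℝ] W') :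
    deriv (fun t => D (fderiv ℝ (fun y => Θ (t, y)) y₀)) t₀ =
      D (fderiv ℝ (fun y => deriv (fun t => Θ (t, y)) t₀) y₀) :=
  (D.hasFDerivAt.comp_hasDerivAt t₀ (hasDerivAt_fderiv_comm hΘ)).deriv

variable {n : ℕ} {M : Type u} [TopologicalSpace M] [ChartedSpace (EuclideanSpace ℝ (Fin n)) M]
  {F G H : SmoothVB.{u, v, w} n M}

lemma DependsOnJet.exists_jetDep {k : ℕ} {x₀ : M} {W : Type*} [NormedAddCommGroup W]
    [NormedSpace ℝ W] {out : Sec F → Eu n → W} (h : DependsOnJet F k x₀ out) {O : Set (Eu n)}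
    (hO : O ∈ 𝓝 (extChartAt (𝓡 n) x₀ x₀)) :
    ∃ U : Set (Eu n), IsOpen U ∧ extChartAt (𝓡 n) x₀ x₀ ∈ U ∧ U ⊆ secDom F x₀ ∧ U ⊆ O ∧
      JetDep U id k (fun ψ => secRep F ψ x₀) out := by
  obtain ⟨U, hU, hx, h⟩ := h
  obtain ⟨O', hO'O, hO', hxO'⟩ := mem_nhds_iff.1 hO
  exact ⟨(U ∩ O') ∩ secDom F x₀, (hU.inter hO').inter (isOpen_secDom F x₀),
    ⟨⟨hx, hxO'⟩, mem_secDom F x₀⟩, inter_subset_right, fun y hy => hO'O hy.1.2,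
    JetDep.mono_set (U := U) h fun y hy => hy.1.1⟩

lemma extD_apply {q : ℕ} (α : FormField n M q) (x : M) :
    extD α x = chartPullback (q + 1) x x (extDeriv (formRep α x) (extChartAt (𝓡 n) x x)) := rfl

lemma extD_smul {q : ℕ} (c : ℝ) (α : FormField n M q) : extD (c • α) = c • extD α := by
  funext x
  have h : formRep (c • α) x = c • formRep α x := rfl
  rw [extD_apply, h, extDeriv_smul, map_smul]
  rfl

lemma extD_zero (q : ℕ) : extD (0 : FormField n M q) = 0 := by
  simpa using extD_smul (0 : ℝ) (0 : FormField n M q)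

lemma extD_add {q : ℕ} {α β : FormField n M q}
    (hα : ∀ x, DifferentiableAt ℝ (formRep α x) (extChartAt (𝓡 n) x x))
    (hβ : ∀ x, DifferentiableAt ℝ (formRep β x) (extChartAt (𝓡 n) x x)) :
    extD (α + β) = extD α + extD β := by
  funext x
  have h : formRep (α + β) x = formRep α x + formRep β x := rfl
  rw [extD_apply, h, extDeriv_add (hα x) (hβ x), map_add]
  rfl

variable [IsManifold (𝓡 n) ∞ M]

/-- Composition of differential operators. -/
lemma comp_mem_localSec {f : Sec F → Sec G} (hf : f ∈ LocalSec F G) {g : Sec G → Sec H}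
    (hg : g ∈ LocalSec G H) : (fun ψ => g (f ψ)) ∈ LocalSec F H := by
  obtain ⟨k, hk⟩ := hf
  obtain ⟨l, hl⟩ := hg
  refine ⟨k + l, fun x₀ => ?_⟩
  obtain ⟨U, hU, hxU, hUd, -, h1⟩ := (hk x₀).exists_jetDep univ_mem
  obtain ⟨V, hV, hxV, hVd, hVU, h2⟩ := (hl x₀).exists_jetDep (hU.mem_nhds hxU)
  exact ⟨V, hV, hxV, h1.comp (h2.comp_index f) hU (isOpen_secDom F x₀) contDiffOn_id
    (fun y hy => hUd hy) (fun ψ => contDiffOn_secRep F ψ x₀) contDiffOn_id fun y hy => hVU hy⟩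

/-- `ψ ↦ R[ψ; f[ψ]]` is a local form. -/
lemma IsLocalLinearOp.deformationCurrent_mem {q : ℕ} {R : Sec F → Sec G →ₗ[ℝ] FormField n M q}
    (hR : IsLocalLinearOp R) {f : Sec F → Sec G} (hf : f ∈ LocalSec F G) :
    deformationCurrent R f ∈ LocalForm F q := by
  obtain ⟨l, hl⟩ := isLocalLinearOp_iff.1 hR
  obtain ⟨k, hk⟩ := hf
  refine ⟨max 0 k + l, fun x₀ => ?_⟩
  obtain ⟨U, hU, hxU, hUd, -, h1⟩ := (hk x₀).exists_jetDep univ_mem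
  obtain ⟨V, hV, hxV, hVd, hVU, h2⟩ := (hl x₀).exists_subset (hU.mem_nhds hxU)
  have h3 : JetDep U id (max 0 k) (fun ψ => secRep F ψ x₀)
      (fun ψ => pairRep F G x₀ (ψ, f ψ)) := (JetDep.self _).prodMk h1
  exact ⟨V, hV, hxV, h3.comp (h2.comp_index fun ψ => (ψ, f ψ)) hU (isOpen_secDom F x₀) contDiffOn_id
    (fun y hy => hUd hy) (fun ψ => contDiffOn_secRep F ψ x₀) contDiffOn_id fun y hy => hVU hy⟩

lemma IsLocalLinearOp.contDiffAt_formRep {q : ℕ} {R : Sec F → Sec G →ₗ[ℝ] FormField n M q}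
    (hR : IsLocalLinearOp R) (ψ : Sec F) (ζ : Sec G) (x₀ : M) :
    ContDiffAt ℝ ∞ (formRep (R ψ ζ) x₀) (extChartAt (𝓡 n) x₀ x₀) := by
  obtain ⟨k, hk⟩ := isLocalLinearOp_iff.1 hR
  obtain ⟨U, hU, hxU, hUd, h⟩ := hk x₀
  exact (h.contDiffOn (isOpen_pairDom F G x₀) contDiffOn_id (fun y hy => hUd hy)
    (contDiffOn_pairRep F G x₀) (ψ, ζ)).contDiffAt (hU.mem_nhds hxU)

lemma contDiffAt_formRep {q : ℕ} {α : Sec F → FormField n M q} (hα : α ∈ LocalForm F q)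
    (ψ : Sec F) (x₀ : M) : ContDiffAt ℝ ∞ (formRep (α ψ) x₀) (extChartAt (𝓡 n) x₀ x₀) := by
  obtain ⟨k, hk⟩ := hα
  obtain ⟨U, hU, hxU, hUd, -, h⟩ := (hk x₀).exists_jetDep univ_mem
  exact (h.contDiffOn (isOpen_secDom F x₀) contDiffOn_id (fun y hy => hUd hy)
    (fun ψ => contDiffOn_secRep F ψ x₀) ψ).contDiffAt (hU.mem_nhds hxU)

lemma IsLocalLinearOp.sub {q : ℕ} {R S : Sec F → Sec G →ₗ[ℝ] FormField n M q}
    (hR : IsLocalLinearOp R) (hS : IsLocalLinearOp S) : IsLocalLinearOp (fun ψ => R ψ - S ψ) := by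
  obtain ⟨k, hk⟩ := isLocalLinearOp_iff.1 hR
  obtain ⟨l, hl⟩ := isLocalLinearOp_iff.1 hS
  refine isLocalLinearOp_iff.2 ⟨max k l, fun x₀ => ?_⟩
  obtain ⟨U, hU, hxU, hUd, h1⟩ := hk x₀
  obtain ⟨V, hV, hxV, hVd, hVU, h2⟩ := (hl x₀).exists_subset (hU.mem_nhds hxU)
  refine ⟨V, hV, hxV, hVd, ((h1.mono_set hVU).prodMk h2).clm
    (ContinuousLinearMap.fst ℝ _ _ - ContinuousLinearMap.snd ℝ _ _)⟩

lemma IsLocalLinearOp.add {q : ℕ} {R S : Sec F → Sec G →ₗ[ℝ] FormField n M q}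
    (hR : IsLocalLinearOp R) (hS : IsLocalLinearOp S) : IsLocalLinearOp (fun ψ => R ψ + S ψ) := by
  obtain ⟨k, hk⟩ := isLocalLinearOp_iff.1 hR
  obtain ⟨l, hl⟩ := isLocalLinearOp_iff.1 hS
  refine isLocalLinearOp_iff.2 ⟨max k l, fun x₀ => ?_⟩
  obtain ⟨U, hU, hxU, hUd, h1⟩ := hk x₀
  obtain ⟨V, hV, hxV, hVd, hVU, h2⟩ := (hl x₀).exists_subset (hU.mem_nhds hxU)
  refine ⟨V, hV, hxV, hVd, ((h1.mono_set hVU).prodMk h2).clm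
    (ContinuousLinearMap.fst ℝ _ _ + ContinuousLinearMap.snd ℝ _ _)⟩

lemma IsLocalLinearOp.const_smul {q : ℕ} {R : Sec F → Sec G →ₗ[ℝ] FormField n M q}
    (hR : IsLocalLinearOp R) (c : ℝ) : IsLocalLinearOp (fun ψ => c • R ψ) := by
  obtain ⟨k, hk⟩ := isLocalLinearOp_iff.1 hR
  refine isLocalLinearOp_iff.2 ⟨k, fun x₀ => ?_⟩
  obtain ⟨U, hU, hxU, hUd, h1⟩ := hk x₀
  exact ⟨U, hU, hxU, hUd, h1.clm (c • ContinuousLinearMap.id ℝ _)⟩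

/-- The value of a local linear operator on a flat section vanishes. -/
lemma IsLocalLinearOp.eq_zero_of_isFlatAt {q : ℕ} {R : Sec F → Sec G →ₗ[ℝ] FormField n M q}
    (hR : IsLocalLinearOp R) (ψ : Sec F) {ζ : Sec G} {x : M} (hζ : IsFlatAt G ζ x) :
    R ψ ζ x = 0 := by
  obtain ⟨k, hk⟩ := isLocalLinearOp_iff.1 hR
  obtain ⟨U, hU, hxU, hUd, h⟩ := hk x
  have h1 : jet k (secRep G ζ x) (extChartAt (𝓡 n) x x) = 0 := hζ k
  have h2 : jet k (secRep G 0 x) (extChartAt (𝓡 n) x x) = 0 :=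
    (secJet G k x (mem_secDom G x)).map_zero
  have h3 := h.eq_of_jet_eq (i := (ψ, ζ)) (j := (ψ, 0)) hxU (by
    rw [id, jet_pairRep (mem_pairDom F G x), jet_pairRep (mem_pairDom F G x)]
    simp only [h1, h2])
  rw [← formRep_pullback (R ψ ζ) (mem_extChartAt_source x), h3,
    formRep_pullback _ (mem_extChartAt_source x), map_zero, FormField.zero_apply]

/-- The exterior derivative of the values of a local linear operator. -/
def extDOp {q : ℕ} {R : Sec F → Sec G →ₗ[ℝ] FormField n M q} (hR : IsLocalLinearOp R)
    (ψ : Sec F) : Sec G →ₗ[ℝ] FormField n M (q + 1) where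
  toFun ζ := extD (R ψ ζ)
  map_add' ζ ξ := by
    rw [map_add]
    exact extD_add (fun x => (hR.contDiffAt_formRep ψ ζ x).differentiableAt (by simp))
      (fun x => (hR.contDiffAt_formRep ψ ξ x).differentiableAt (by simp))
  map_smul' c ζ := by
    rw [map_smul, extD_smul, RingHom.id_apply]

/-- The exterior derivative is a fixed linear function of the first derivative, so the order rises
by one. -/
lemma isLocalLinearOp_extDOp {q : ℕ} {R : Sec F → Sec G →ₗ[ℝ] FormField n M q}
    (hR : IsLocalLinearOp R) : IsLocalLinearOp (extDOp hR) := by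
  obtain ⟨k, hk⟩ := isLocalLinearOp_iff.1 hR
  refine isLocalLinearOp_iff.2 ⟨k + 1, fun x₀ => ?_⟩
  obtain ⟨U, hU, hxU, hUd, h⟩ := hk x₀
  refine ⟨U, hU, hxU, hUd, ((h.fderiv hU (isOpen_pairDom F G x₀) contDiffOn_id
    (fun y hy => hUd hy) (contDiffOn_pairRep F G x₀)).clm
      (ContinuousAlternatingMap.alternatizeUncurryFinCLM ℝ (Eu n) ℝ)).congr fun p y hy => ?_⟩
  exact formRep_extD _ (hUd hy).1.1
    ((hR.contDiffAt_formRep p.1 p.2 _).differentiableAt (by simp))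

lemma extD_extD_eq_zero {q : ℕ} {α : Sec F → FormField n M q} (hα : α ∈ LocalForm F q)
    (ψ : Sec F) : extD (extD (α ψ)) = 0 := by
  funext x
  have h : formRep (extD (α ψ)) x =ᶠ[𝓝 (extChartAt (𝓡 n) x x)] extDeriv (formRep (α ψ) x) := by
    filter_upwards [(isOpen_extChartAt_target x).mem_nhds (mem_extChartAt_target x)] with y hy
    exact formRep_extD _ hy ((contDiffAt_formRep hα ψ _).differentiableAt (by simp))
  rw [extD_apply, h.extDeriv_eq, extDeriv_extDeriv_apply (contDiffAt_formRep hα ψ x) (by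
    simp only [minSmoothness_of_isRCLikeNormedField]
    exact WithTop.coe_le_coe.2 le_top), map_zero]
  rfl

lemma jet_secRep_line {k : ℕ} {x₀ : M} {y : Eu n} (hy : y ∈ secDom F x₀) (ψ ξ : Sec F) (t : ℝ) :
    jet k (secRep F (ψ + t • ξ) x₀) y = jet k (secRep F ψ x₀) y + t • jet k (secRep F ξ x₀) y := by
  have h1 := (secJet F k x₀ hy).map_add ψ (t • ξ)
  rw [map_smul] at h1
  exact h1

lemma hasDerivAt_formRep_line {q k : ℕ} {α : Sec F → FormField n M q} {x₀ : M} {U : Set (Eu n)}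
    (hU : IsOpen U) (hUd : U ⊆ secDom F x₀)
    {A : Eu n × JetSpace n k F.Model → ContinuousAlternatingMap ℝ (Eu n) ℝ (Fin q)}
    (hA : ContDiffOn ℝ ∞ A (U ×ˢ univ))
    (hAo : ∀ ψ, ∀ y ∈ U, formRep (α ψ) x₀ y = A (y, jet k (secRep F ψ x₀) y)) (ψ ξ : Sec F)
    {y : Eu n} (hy : y ∈ U) :
    HasDerivAt (fun t : ℝ => formRep (α (ψ + t • ξ)) x₀ y)
      (fderiv ℝ A (y, jet k (secRep F ψ x₀) y) (0, jet k (secRep F ξ x₀) y)) 0 := by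
  have h1 : (fun t : ℝ => formRep (α (ψ + t • ξ)) x₀ y) = fun t =>
      A (y, jet k (secRep F ψ x₀) y + t • jet k (secRep F ξ x₀) y) :=
    funext fun t => by rw [hAo _ y hy, jet_secRep_line (hUd hy)]
  have h2 : HasDerivAt (fun t : ℝ => (y, jet k (secRep F ψ x₀) y + t • jet k (secRep F ξ x₀) y))
      ((0 : Eu n), jet k (secRep F ξ x₀) y) 0 := by
    refine (hasDerivAt_const 0 y).prodMk ?_
    simpa using ((hasDerivAt_id (0 : ℝ)).smul_const (jet k (secRep F ξ x₀) y)).const_add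
      (jet k (secRep F ψ x₀) y)
  have h3 : HasFDerivAt A (fderiv ℝ A (y, jet k (secRep F ψ x₀) y +
      (0 : ℝ) • jet k (secRep F ξ x₀) y)) (y, jet k (secRep F ψ x₀) y +
      (0 : ℝ) • jet k (secRep F ξ x₀) y) :=
    ((hA.contDiffAt ((hU.prod isOpen_univ).mem_nhds ⟨hy, mem_univ _⟩)).differentiableAt
      (by simp)).hasFDerivAt
  have h4 := h3.comp_hasDerivAt (0 : ℝ) h2
  rw [zero_smul, add_zero] at h4
  rw [h1]
  exact h4

/-- The jet of `ψ + t • ξ` is affine in `t`, so the derivative is that of the coordinate function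
applied to the jet of `ξ`. This makes it linear in `ξ`, as the definition of `linearization`
requires. -/
lemma exists_hasDerivAt_formRep {q : ℕ} {α : Sec F → FormField n M q} (hα : α ∈ LocalForm F q)
    (x₀ : M) (ψ : Sec F) : ∃ D : Sec F →ₗ[ℝ] ContinuousAlternatingMap ℝ (Eu n) ℝ (Fin q), ∀ ξ,
      HasDerivAt (fun t : ℝ => formRep (α (ψ + t • ξ)) x₀ (extChartAt (𝓡 n) x₀ x₀)) (D ξ) 0 := by
  obtain ⟨k, hk⟩ := hα
  obtain ⟨U, hU, hxU, hUd, -, A, hA, hAo⟩ := (hk x₀).exists_jetDep univ_mem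
  exact ⟨(fderiv ℝ A (extChartAt (𝓡 n) x₀ x₀,
    jet k (secRep F ψ x₀) (extChartAt (𝓡 n) x₀ x₀))).toLinearMap ∘ₗ LinearMap.inr ℝ _ _ ∘ₗ
    secJet F k x₀ (mem_secDom F x₀), fun ξ => hasDerivAt_formRep_line hU hUd hA hAo ψ ξ hxU⟩

/-- The linearization of a local form at `ψ` in the direction `ξ`. -/
def linearization {q : ℕ} {α : Sec F → FormField n M q} (hα : α ∈ LocalForm F q) (ψ : Sec F) :
    Sec F →ₗ[ℝ] FormField n M q :=
  LinearMap.pi fun x => chartPullback q x x ∘ₗ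
    { toFun := fun ξ => deriv (fun t : ℝ => formRep (α (ψ + t • ξ)) x (extChartAt (𝓡 n) x x)) 0
      map_add' := fun ξ ξ' => by
        obtain ⟨D, hD⟩ := exists_hasDerivAt_formRep hα x ψ
        rw [(hD _).deriv, (hD _).deriv, (hD _).deriv, map_add]
      map_smul' := fun c ξ => by
        obtain ⟨D, hD⟩ := exists_hasDerivAt_formRep hα x ψ
        rw [(hD _).deriv, (hD _).deriv, map_smul, RingHom.id_apply] }

lemma linearization_apply {q : ℕ} {α : Sec F → FormField n M q} (hα : α ∈ LocalForm F q)
    (ψ ξ : Sec F) (x : M) : linearization hα ψ ξ x = chartPullback q x x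
      (deriv (fun t : ℝ => formRep (α (ψ + t • ξ)) x (extChartAt (𝓡 n) x x)) 0) := rfl

/-- The linearization is defined at each point in that point's own chart. Passing to the chart at
`x₀` is a linear map of the fibre that does not depend on `t`, so it commutes with the derivative in
`t`. -/
lemma formRep_linearization {q : ℕ} {α : Sec F → FormField n M q} (hα : α ∈ LocalForm F q)
    (ψ ξ : Sec F) (x₀ : M) (y : Eu n) :
    formRep (linearization hα ψ ξ) x₀ y =
      deriv (fun t : ℝ => formRep (α (ψ + t • ξ)) x₀ y) 0 := by
  set x := (extChartAt (𝓡 n) x₀).symm y with hx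
  obtain ⟨D, hD⟩ := exists_hasDerivAt_formRep hα x ψ
  let L := (symmPullback q x₀ y ∘ₗ chartPullback q x x).toContinuousLinearMap
  have h1 := (L.hasFDerivAt.comp_hasDerivAt (0 : ℝ) (hD ξ)).deriv
  have h2 : (fun t : ℝ => formRep (α (ψ + t • ξ)) x₀ y) =
      L ∘ fun t : ℝ => formRep (α (ψ + t • ξ)) x (extChartAt (𝓡 n) x x) := by
    funext t
    exact (congrArg (symmPullback q x₀ y) (formRep_pullback (α (ψ + t • ξ))
      (mem_extChartAt_source x))).symm
  rw [h2, h1, ← (hD ξ).deriv]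
  rfl

lemma isLocalLinearOp_linearization {q : ℕ} {α : Sec F → FormField n M q}
    (hα : α ∈ LocalForm F q) : IsLocalLinearOp (linearization hα) := by
  obtain ⟨k, hk⟩ := id hα
  refine isLocalLinearOp_iff.2 ⟨k, fun x₀ => ?_⟩
  obtain ⟨U, hU, hxU, hUd, -, A, hA, hAo⟩ := (hk x₀).exists_jetDep univ_mem
  have hUd' : U ⊆ pairDom F F x₀ := fun y hy => ⟨hUd hy, hUd hy⟩
  refine ⟨U, hU, hxU, hUd', ?_⟩
  have h1 : JetDep U id k (pairRep F F x₀) (fun p y => jet k (secRep F p.1 x₀) y) :=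
    (JetDep.jet_self (σ := id) (u := fun p : Sec F × Sec F => secRep F p.1 x₀)).fst_pair
      (κ := id) fun y hy => hUd' hy
  have h2 : JetDep U id k (pairRep F F x₀) (fun p y => jet k (secRep F p.2 x₀) y) :=
    (JetDep.jet_self (σ := id) (u := fun p : Sec F × Sec F => secRep F p.2 x₀)).snd_pair
      (κ := id) fun y hy => hUd' hy
  have h3 := (h1.prodMk h2).map (B := fun p => fderiv ℝ A (p.1, p.2.1) (0, p.2.2)) (by
    refine ContDiffOn.clm_apply ((hA.fderiv_of_isOpen (hU.prod isOpen_univ) (m := ∞)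
      (by simp)).comp (ContDiff.contDiffOn (by fun_prop)) fun p hp => ⟨hp.1, mem_univ _⟩)
      (ContDiff.contDiffOn (by fun_prop)))
  rw [max_self] at h3
  refine h3.congr fun p y hy => ?_
  rw [formRep_linearization]
  exact (hasDerivAt_formRep_line hU hUd hA hAo p.1 p.2 hy).deriv

/-- Joint smoothness in the parameter and the point is what allows their derivatives to be
interchanged. -/
lemma exists_contDiffAt_formRep_line {q : ℕ} {α : Sec F → FormField n M q}
    (hα : α ∈ LocalForm F q) (ψ ξ : Sec F) (x : M) :
    ∃ Θ : ℝ × Eu n → ContinuousAlternatingMap ℝ (Eu n) ℝ (Fin q),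
      ContDiffAt ℝ ∞ Θ (0, extChartAt (𝓡 n) x x) ∧
      ∀ᶠ y in 𝓝 (extChartAt (𝓡 n) x x), ∀ t : ℝ, formRep (α (ψ + t • ξ)) x y = Θ (t, y) := by
  obtain ⟨k, hk⟩ := hα
  obtain ⟨U, hU, hxU, hUd, -, A, hA, hAo⟩ := (hk x).exists_jetDep univ_mem
  refine ⟨fun p => A (p.2, jet k (secRep F ψ x) p.2 + p.1 • jet k (secRep F ξ x) p.2), ?_, ?_⟩
  · have hjet : ∀ s : Sec F, ContDiffAt ℝ ∞ (fun p : ℝ × Eu n => jet k (secRep F s x) p.2)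
        (0, extChartAt (𝓡 n) x x) :=
      fun s => (contDiffAt_jet F s k x).comp (0, extChartAt (𝓡 n) x x) contDiffAt_snd
    have h1 : ContDiffAt ℝ ∞ A (extChartAt (𝓡 n) x x,
        jet k (secRep F ψ x) (extChartAt (𝓡 n) x x) +
          (0 : ℝ) • jet k (secRep F ξ x) (extChartAt (𝓡 n) x x)) :=
      hA.contDiffAt ((hU.prod isOpen_univ).mem_nhds ⟨hxU, mem_univ _⟩)
    exact h1.comp (0, extChartAt (𝓡 n) x x)
      (contDiffAt_snd.prodMk ((hjet ψ).add (contDiffAt_fst.smul (hjet ξ))))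
  · filter_upwards [hU.mem_nhds hxU] with y hy t
    exact (hAo (ψ + t • ξ) y hy).trans
      (congrArg (fun v => A (y, v)) (jet_secRep_line (hUd hy) ψ ξ t))

/-- Linearization commutes with the exterior derivative. -/
lemma extD_linearization {q : ℕ} {α : Sec F → FormField n M q} (hα : α ∈ LocalForm F q)
    {β : Sec F → FormField n M (q + 1)} (hβ : β ∈ LocalForm F (q + 1))
    (h : ∀ ψ, β ψ = extD (α ψ)) (ψ ξ : Sec F) :
    extD (linearization hα ψ ξ) = linearization hβ ψ ξ := by
  funext x
  obtain ⟨Θ, hΘ, hΘo⟩ := exists_contDiffAt_formRep_line hα ψ ξ x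
  -- The exterior derivative is a continuous linear function `D` of the ordinary derivative, so
  -- differentiation in `t` passes through it.
  obtain ⟨D, hDo⟩ : ∃ D : (Eu n →L[ℝ] ContinuousAlternatingMap ℝ (Eu n) ℝ (Fin q)) →L[ℝ]
      ContinuousAlternatingMap ℝ (Eu n) ℝ (Fin (q + 1)), ∀ (f : Eu n → ContinuousAlternatingMap ℝ
        (Eu n) ℝ (Fin q)) (y : Eu n), extDeriv f y = D (fderiv ℝ f y) :=
    ⟨ContinuousAlternatingMap.alternatizeUncurryFinCLM ℝ (Eu n) ℝ, fun _ _ => rfl⟩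
  have h1 : ∀ t : ℝ, formRep (β (ψ + t • ξ)) x (extChartAt (𝓡 n) x x) =
      D (fderiv ℝ (fun y => Θ (t, y)) (extChartAt (𝓡 n) x x)) := by
    intro t
    have h2 : formRep (α (ψ + t • ξ)) x =ᶠ[𝓝 (extChartAt (𝓡 n) x x)] fun y => Θ (t, y) := by
      filter_upwards [hΘo] with y hy using hy t
    rw [h, formRep_extD _ (mem_extChartAt_target x)
      ((contDiffAt_formRep hα _ _).differentiableAt (by simp)), h2.extDeriv_eq, hDo]
  have h3 : formRep (linearization hα ψ ξ) x =ᶠ[𝓝 (extChartAt (𝓡 n) x x)]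
      fun y => deriv (fun t => Θ (t, y)) 0 := by
    filter_upwards [hΘo] with y hy
    rw [formRep_linearization, funext hy]
  have h4 : deriv (fun t : ℝ => D (fderiv ℝ (fun y => Θ (t, y)) (extChartAt (𝓡 n) x x))) 0 =
      extDeriv (fun y => deriv (fun t => Θ (t, y)) 0) (extChartAt (𝓡 n) x x) :=
    (deriv_clm_fderiv_comm hΘ D).trans (hDo _ _).symm
  rw [extD_apply, linearization_apply, h3.extDeriv_eq, funext h1, h4]

end LocalOperators

/-! ### Deformation currents -/

section DeformationCurrents

variable {n : ℕ} {M : Type u} [TopologicalSpace M] [ChartedSpace (EuclideanSpace ℝ (Fin n)) M]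
  [IsManifold (𝓡 n) ∞ M] {F G H : SmoothVB.{u, v, w} n M} {e : Sec F →ₗ[ℝ] Sec G}

/-- The `∞`-jet of a null section vanishes on the PDE manifold of a regular equation. -/
lemma isFlatAt_of_mem_nullSec [T2Space M] (he : IsRegularForm e) {f : Sec F → Sec H}
    (hf : f ∈ nullSec e H) {ψ : Sec F} {x : M} (h : OnShell e ψ x) : IsFlatAt H (f ψ) x := by
  intro r
  change jet r (secRep H (f ψ) x) (extChartAt (𝓡 n) x x) = 0
  obtain ⟨⟨m, hm⟩, hnull⟩ := hf
  obtain ⟨N, l, hNl⟩ := he.exists_local_factorization m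
  have : CompleteSpace H.Model := FiniteDimensional.complete ℝ _
  obtain ⟨U₀, hU₀, hxU₀, A, hA, hAo⟩ := hNl x (fun ψ => secRep H (f ψ) x) (hm x) (by
    filter_upwards [(isOpen_secDom H x).mem_nhds (mem_secDom H x)] with y hy ψ hon
    rw [secRep, hnull ψ _ hon]
    exact secRep_zero H x hy)
  set U : Set (Eu n) := U₀ ∩ pairDom F G x with hUdef
  have hU : IsOpen U := hU₀.inter (isOpen_pairDom F G x)
  have hxU : extChartAt (𝓡 n) x x ∈ U := ⟨hxU₀, mem_pairDom F G x⟩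
  -- Since `ψ` is on-shell only at `x`, vanishing of `f ψ` at `x` says nothing directly about its
  -- derivatives. They are compared through this factorization: `e ψ` and `0` have the same jets at
  -- `x`, hence so do `out (ψ, e ψ)`, which is `f ψ`, and `out (ψ, 0)`, which is `0`.
  let out : Sec F × Sec G → Eu n → H.Model := fun p y =>
    A (y, jet N (secRep F p.1 x) y) (jet l (secRep G p.2 x) y)
  have hdep : JetDep U id (max N l) (pairRep F G x) out := by
    have h1 : JetDep U id N (pairRep F G x) (fun p y => jet N (secRep F p.1 x) y) :=
      (JetDep.jet_self (σ := id) (u := fun p : Sec F × Sec G => secRep F p.1 x)).fst_pair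
        (κ := id) fun y hy => hy.2
    have h2 : JetDep U id l (pairRep F G x) (fun p y => jet l (secRep G p.2 x) y) :=
      (JetDep.jet_self (σ := id) (u := fun p : Sec F × Sec G => secRep G p.2 x)).snd_pair
        (κ := id) fun y hy => hy.2
    refine (h1.prodMk h2).map (B := fun p => A (p.1, p.2.1) p.2.2) ?_
    exact ContDiffOn.clm_apply (hA.comp (ContDiff.contDiffOn (by fun_prop))
      fun p hp => ⟨hp.1.1, mem_univ _⟩) (ContDiff.contDiffOn (by fun_prop))
  have h1 : secRep H (f ψ) x =ᶠ[𝓝 (extChartAt (𝓡 n) x x)] out (ψ, e ψ) := by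
    filter_upwards [hU₀.mem_nhds hxU₀] with y hy using hAo ψ y hy
  have h2 : out (ψ, 0) =ᶠ[𝓝 (extChartAt (𝓡 n) x x)] fun _ => 0 := by
    filter_upwards [hU.mem_nhds hxU] with y hy
    change A _ (secJet G l x hy.2.2 0) = 0
    rw [map_zero, map_zero]
  have h3 : jet r (out (ψ, e ψ)) (extChartAt (𝓡 n) x x) =
      jet r (out (ψ, 0)) (extChartAt (𝓡 n) x x) := by
    refine (hdep.jet hU (isOpen_pairDom F G x) contDiffOn_id (fun y hy => hy.2)
      (contDiffOn_pairRep F G x) r).eq_of_jet_eq (i := (ψ, e ψ)) (j := (ψ, 0)) hxU ?_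
    rw [id, jet_pairRep (mem_pairDom F G x), jet_pairRep (mem_pairDom F G x)]
    have h4 : jet (max N l + r) (secRep G (e ψ) x) (extChartAt (𝓡 n) x x) = 0 := h _
    have h5 : jet (max N l + r) (secRep G 0 x) (extChartAt (𝓡 n) x x) = 0 :=
      (secJet G _ x (mem_secDom G x)).map_zero
    simp only [h4, h5]
  rw [jet_congr h1, h3, jet_congr h2, jet_zero]

/-- On the PDE manifold, the linearization of `R[ψ; e[ψ]]` in the direction `ξ` is
`R[ψ; e[ξ]]`. -/
lemma RepresentsForm.linearization_eq {q : ℕ} {R : Sec F → Sec G →ₗ[ℝ] FormField n M q}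
    {ρ : Sec F → FormField n M q} (hR : RepresentsForm e R ρ) (hρ : ρ ∈ LocalForm F q)
    {ψ : Sec F} {x : M} (h : OnShell e ψ x) (ξ : Sec F) :
    linearization hρ ψ ξ x = R ψ (e ξ) x := by
  let c : ℝ → ContinuousAlternatingMap ℝ (Eu n) ℝ (Fin q) :=
    fun t => formRep (R (ψ + t • ξ) (e ξ)) x (extChartAt (𝓡 n) x x)
  have hc : DifferentiableAt ℝ c 0 := by
    obtain ⟨k, hk⟩ := hR.1
    obtain ⟨U, hU, hxU, A, hA, hAo⟩ := hk x
    have h1 : c = fun t => A (extChartAt (𝓡 n) x x,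
        jet k (secRep F ψ x) (extChartAt (𝓡 n) x x) +
          t • jet k (secRep F ξ x) (extChartAt (𝓡 n) x x),
        jet k (secRep G (e ξ) x) (extChartAt (𝓡 n) x x)) := funext fun t => by
      rw [← jet_secRep_line (mem_secDom F x)]
      exact hAo _ _ _ hxU
    rw [h1]
    exact ((hA.contDiffAt ((hU.prod isOpen_univ).mem_nhds ⟨hxU, mem_univ _⟩)).differentiableAt
      (by simp)).comp (0 : ℝ) (by fun_prop)
  have h1 : (fun t : ℝ => formRep (ρ (ψ + t • ξ)) x (extChartAt (𝓡 n) x x)) = fun t => t • c t := by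
    funext t
    -- Flatness of `e ψ` at `x` kills this term for every first argument, hence for every `t`. What
    -- remains is `t • c t`, whose derivative at `0` is `c 0`.
    have h2 : R (ψ + t • ξ) (e ψ) ((extChartAt (𝓡 n) x).symm (extChartAt (𝓡 n) x x)) = 0 := by
      rw [extChartAt_to_inv]
      exact hR.1.eq_zero_of_isFlatAt _ h
    have h3 : formRep (ρ (ψ + t • ξ)) x (extChartAt (𝓡 n) x x) =
        formRep (R (ψ + t • ξ) (e ψ)) x (extChartAt (𝓡 n) x x) + t • c t := by
      rw [hR.2, map_add, map_smul, map_add, map_smul]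
      rfl
    rw [h3, formRep_eq_zero h2, zero_add]
  have h2 : deriv (fun t => t • c t) 0 = c 0 :=
    ((hasDerivAt_id (0 : ℝ)).smul hc.hasDerivAt).deriv.trans (by simp)
  rw [linearization_apply, h1, h2]
  refine (formRep_pullback (R (ψ + (0 : ℝ) • ξ) (e ξ)) (mem_extChartAt_source x)).trans ?_
  rw [zero_smul, add_zero]

/-- The zero form has zero linearization. The vanishing on `e ψ` thereby spreads, on-shell, to all
`e ξ`. -/
lemma RepresentsForm.apply_eq_zero {q : ℕ} {R : Sec F → Sec G →ₗ[ℝ] FormField n M q}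
    (hR : RepresentsForm e R 0) {ψ : Sec F} {x : M} (h : OnShell e ψ x) (ξ : Sec F) :
    R ψ (e ξ) x = 0 := by
  have h1 : ∀ φ : Sec F, formRep ((0 : Sec F → FormField n M q) φ) x (extChartAt (𝓡 n) x x) = 0 :=
    fun φ => formRep_eq_zero rfl
  rw [← hR.linearization_eq (zero_mem _) h ξ, linearization_apply]
  simp only [h1, deriv_const, map_zero]

/-! ### Operations on representing operators -/

section Algebra

variable {q : ℕ} {R S : Sec F → Sec G →ₗ[ℝ] FormField n M q} {ρ σ : Sec F → FormField n M q}

lemma RepresentsForm.add (hR : RepresentsForm e R ρ) (hS : RepresentsForm e S σ) :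
    RepresentsForm e (fun ψ => R ψ + S ψ) (ρ + σ) :=
  ⟨hR.1.add hS.1, fun ψ => by rw [Pi.add_apply, hR.2, hS.2, LinearMap.add_apply]⟩

lemma RepresentsForm.sub (hR : RepresentsForm e R ρ) (hS : RepresentsForm e S σ) :
    RepresentsForm e (fun ψ => R ψ - S ψ) (ρ - σ) :=
  ⟨hR.1.sub hS.1, fun ψ => by rw [Pi.sub_apply, hR.2, hS.2, LinearMap.sub_apply]⟩

lemma RepresentsForm.const_smul (hR : RepresentsForm e R ρ) (c : ℝ) :
    RepresentsForm e (fun ψ => c • R ψ) (c • ρ) :=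
  ⟨hR.1.const_smul c, fun ψ => by rw [Pi.smul_apply, hR.2, LinearMap.smul_apply]⟩

lemma extD_eq_zero_of_mem_hExact {N : ∀ q, Submodule ℝ (Sec F → FormField n M q)}
    (h : ρ ∈ hExact F N q) (ψ : Sec F) : extD (ρ ψ) = 0 := by
  cases q with
  | zero =>
    rw [(Submodule.mem_bot ℝ).1 h]
    exact extD_zero 0
  | succ q =>
    obtain ⟨-, j, -, rfl⟩ := h
    exact extD_extD_eq_zero j.2 ψ

/-- Applied to a closed form this yields an operator representing zero, which gives conservation.
Applied to a null potential it yields a second operator for its differential. -/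
lemma RepresentsForm.extDOp (hR : RepresentsForm e R ρ) :
    RepresentsForm e (extDOp hR.1) (fun ψ => extD (ρ ψ)) :=
  ⟨isLocalLinearOp_extDOp hR.1, fun ψ => congrArg extD (hR.2 ψ)⟩

end Algebra

/-! ### The pairing of sources and deformations for a locally regular system -/

section Regular

variable [T2Space M] {Z : ℕ → SmoothVB.{u, v, w} n M} {e : Sec F →ₗ[ℝ] Sec (Z 0)}
  {z : ∀ i, Sec (Z i) →ₗ[ℝ] Sec (Z (i + 1))} {q : ℕ}
  {R S : Sec F → Sec (Z 0) →ₗ[ℝ] FormField n M q} {ρ : Sec F → FormField n M q}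
  {f : Sec F → Sec (Z 0)}

/-- An operator that vanishes on `e[ψ]` gives null deformation currents. -/
lemma IsLocallyRegular.deformationCurrent_mem_nullForms (hreg : IsLocallyRegular e z)
    (hR : RepresentsForm e R 0) (hf : f ∈ deformations e (z 0)) :
    deformationCurrent R f ∈ nullForms e q := by
  refine ⟨hR.1.deformationCurrent_mem hf.1, fun ψ x h => ?_⟩
  obtain ⟨k, hk, -⟩ := (hreg.regular_noether 0).involutive
  have h1 : (fun ψ => z 0 (f ψ)) ∈ nullSec e (Z 1) := ⟨comp_mem_localSec hf.1 ⟨k, hk⟩, hf.2⟩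
  -- `ξ` depends on `x` and `ψ` and solves `e ξ = f ψ` only to infinite order at `x`. That suffices,
  -- since `R ψ` vanishes at `x` on sections flat there.
  obtain ⟨ξ, hξ⟩ := (hreg.exact_zero x (f ψ)).1 (isFlatAt_of_mem_nullSec hreg.regular h1 h)
  have h2 : R ψ (f ψ) x = R ψ (f ψ - e ξ) x + R ψ (e ξ) x := by
    rw [map_sub, ← FormField.add_apply, sub_add_cancel]
  rw [deformationCurrent, h2, hR.1.eq_zero_of_isFlatAt ψ hξ, hR.apply_eq_zero h, add_zero]

lemma IsLocallyRegular.deformationCurrent_sub_mem_nullForms (hreg : IsLocallyRegular e z)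
    (hR : RepresentsForm e R ρ) (hS : RepresentsForm e S ρ) (hf : f ∈ deformations e (z 0)) :
    deformationCurrent R f - deformationCurrent S f ∈ nullForms e q := by
  have h := hR.sub hS
  rw [sub_self] at h
  exact hreg.deformationCurrent_mem_nullForms h hf

/-- Deformation currents are conserved. -/
lemma IsLocallyRegular.deformationCurrent_mem_conservedCurrents (hreg : IsLocallyRegular e z)
    (hR : RepresentsForm e R ρ) (hρ : ρ ∈ nullSources e q) (hf : f ∈ deformations e (z 0)) :
    deformationCurrent R f ∈ conservedCurrents e q := by
  refine ⟨hR.1.deformationCurrent_mem hf.1, fun ψ x h => ?_⟩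
  -- A null source is exact, so d∘R represents the zero form. Its value on `f ψ`, the differential
  -- of the current, is therefore null.
  have h1 := hR.extDOp
  rw [show (fun ψ => extD (ρ ψ)) = 0 from funext (extD_eq_zero_of_mem_hExact hρ.1)] at h1
  exact (hreg.deformationCurrent_mem_nullForms h1 hf).2 ψ x h

/-- The deformation currents of trivial deformations are trivial. -/
lemma IsLocallyRegular.deformationCurrent_mem_trivialCurrents_of_trivialDeformation
    (hreg : IsLocallyRegular e z) (hR : RepresentsForm e R ρ) (hρ : ρ ∈ nullSources e q)
    (hf : f ∈ trivialDeformations e) : deformationCurrent R f ∈ trivialCurrents e q := by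
  obtain ⟨_, ⟨g, hg, rfl⟩, h, hh, rfl⟩ := Submodule.mem_sup.1 hf
  have h0 : deformationCurrent R ((e.compLeft (Sec F)) g + h) =
      deformationCurrent R (fun ψ => e (g ψ)) + deformationCurrent R h :=
    funext fun ψ => (R ψ).map_add _ _
  obtain ⟨k, hk, -⟩ := hreg.regular.involutive
  have heg : (fun ψ => e (g ψ)) ∈ LocalSec F (Z 0) := comp_mem_localSec hg ⟨k, hk⟩
  rw [h0]
  refine add_mem ?_ (Submodule.mem_sup_right ⟨hR.1.deformationCurrent_mem hh.1, fun ψ x hx =>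
    hR.1.eq_zero_of_isFlatAt ψ (isFlatAt_of_mem_nullSec hreg.regular hh hx)⟩)
  cases q with
  | zero =>
    -- In degree zero the only exact form is `0`, so `R` represents zero and its current vanishes
    -- on-shell.
    rw [(Submodule.mem_bot ℝ).1 hρ.1] at hR
    exact Submodule.mem_sup_right ⟨hR.1.deformationCurrent_mem heg, fun ψ x hx =>
      hR.apply_eq_zero hx (g ψ)⟩
  | succ q =>
    obtain ⟨hρl, j, -, hj⟩ := hρ.1
    have h1 : deformationCurrent (linearization hρl) g ∈ LocalForm F (q + 1) :=
      (isLocalLinearOp_linearization hρl).deformationCurrent_mem hg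
    -- The potential of this form is the linearization of `j` in the direction `g ψ`. On-shell the
    -- form agrees with `R ψ (e (g ψ))`, so the current of the part `e (g ψ)` is exact up to a null
    -- form.
    have h2 : deformationCurrent (linearization hρl) g ∈ hExact F (LocalForm F) (q + 1) := by
      have h3 : deformationCurrent (linearization j.2) g ∈ LocalForm F q :=
        (isLocalLinearOp_linearization j.2).deformationCurrent_mem hg
      exact ⟨h1, ⟨_, h3⟩, h3, funext fun ψ =>
        extD_linearization j.2 hρl (fun ψ => (congrFun hj ψ).symm) ψ (g ψ)⟩
    rw [← sub_add_cancel (deformationCurrent R fun ψ => e (g ψ))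
      (deformationCurrent (linearization hρl) g)]
    refine add_mem (Submodule.mem_sup_right ⟨sub_mem (hR.1.deformationCurrent_mem heg) h1,
      fun ψ x hx => ?_⟩) (Submodule.mem_sup_left (Submodule.mem_sup_left h2))
    have h4 := hR.linearization_eq hρl hx (g ψ)
    exact sub_eq_zero.2 h4.symm

/-- The deformation currents of trivial null sources are trivial. -/
lemma IsLocallyRegular.deformationCurrent_mem_trivialCurrents_of_trivialSource
    [SecondCountableTopology M] (hreg : IsLocallyRegular e z) (hR : RepresentsForm e R ρ)
    (hρ : ρ ∈ trivialSources e q) (hf : f ∈ deformations e (z 0)) :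
    deformationCurrent R f ∈ trivialCurrents e q := by
  cases q with
  | zero =>
    rw [(Submodule.mem_bot ℝ).1 hρ] at hR
    exact Submodule.mem_sup_right (hreg.deformationCurrent_mem_nullForms hR hf)
  | succ q =>
    obtain ⟨-, j, hj, rfl⟩ := hρ
    -- Being null, the potential `j` has its own operator `J`. Now d∘J and `R` represent the same
    -- source, so the current of `R` is, up to a null form, the differential of the current of `J`.
    obtain ⟨J, hJ⟩ := exists_representsForm hreg.regular (ρ := j.1) hj
    rw [← sub_add_cancel (deformationCurrent R f) (deformationCurrent (extDOp hJ.1) f)]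
    have h1 := hJ.1.deformationCurrent_mem hf.1
    exact add_mem (Submodule.mem_sup_right
        (hreg.deformationCurrent_sub_mem_nullForms hR hJ.extDOp hf))
      (Submodule.mem_sup_left (Submodule.mem_sup_left
        ⟨(isLocalLinearOp_extDOp hJ.1).deformationCurrent_mem hf.1, ⟨_, h1⟩, h1, rfl⟩))

/-- The class of the deformation current of a null source and a consistent deformation. -/
def IsLocallyRegular.currentClass [SecondCountableTopology M] (hreg : IsLocallyRegular e z)
    {p : ℕ} (ρ : nullSources e (n - p)) (f : deformations e (z 0)) : Hcur e p :=
  Submodule.Quotient.mk ⟨_, hreg.deformationCurrent_mem_conservedCurrents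
    (exists_representsForm hreg.regular ρ.2.2).choose_spec ρ.2 f.2⟩

/-- Frees the class from the operator chosen in its definition. Bilinearity can then be checked with
sums and multiples of representing operators. -/
lemma IsLocallyRegular.currentClass_eq [SecondCountableTopology M] (hreg : IsLocallyRegular e z)
    {p : ℕ} {ρ : nullSources e (n - p)} {f : deformations e (z 0)}
    {R : Sec F → Sec (Z 0) →ₗ[ℝ] FormField n M (n - p)} (hR : RepresentsForm e R ρ.1) :
    hreg.currentClass ρ f = Submodule.Quotient.mk ⟨deformationCurrent R f.1,
      hreg.deformationCurrent_mem_conservedCurrents hR ρ.2 f.2⟩ :=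
  (Submodule.Quotient.eq _).2 (Submodule.mem_sup_right
    (hreg.deformationCurrent_sub_mem_nullForms
      (exists_representsForm hreg.regular ρ.2.2).choose_spec hR f.2))

/-- The bilinear map that sends a null source and a consistent deformation to the class of their
deformation current. -/
def IsLocallyRegular.currentMap [SecondCountableTopology M] (hreg : IsLocallyRegular e z)
    (p : ℕ) : nullSources e (n - p) →ₗ[ℝ] deformations e (z 0) →ₗ[ℝ] Hcur e p :=
  LinearMap.mk₂ ℝ hreg.currentClass
    (fun ρ σ f => by
      obtain ⟨R, hR⟩ := exists_representsForm hreg.regular ρ.2.2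
      obtain ⟨S, hS⟩ := exists_representsForm hreg.regular σ.2.2
      rw [hreg.currentClass_eq hR, hreg.currentClass_eq hS,
        hreg.currentClass_eq (ρ := ρ + σ) (hR.add hS)]
      rfl)
    (fun c ρ f => by
      obtain ⟨R, hR⟩ := exists_representsForm hreg.regular ρ.2.2
      rw [hreg.currentClass_eq hR, hreg.currentClass_eq (ρ := c • ρ) (hR.const_smul c)]
      rfl)
    (fun ρ f g => by
      obtain ⟨R, hR⟩ := exists_representsForm hreg.regular ρ.2.2
      rw [hreg.currentClass_eq hR, hreg.currentClass_eq hR, hreg.currentClass_eq hR,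
        ← Submodule.Quotient.mk_add]
      exact congrArg _ (Subtype.ext (funext fun ψ => (R ψ).map_add _ _)))
    (fun c ρ f => by
      obtain ⟨R, hR⟩ := exists_representsForm hreg.regular ρ.2.2
      rw [hreg.currentClass_eq hR, hreg.currentClass_eq hR, ← Submodule.Quotient.mk_smul]
      exact congrArg _ (Subtype.ext (funext fun ψ => (R ψ).map_smul c _)))

/-- The bilinear map that sends the classes of a null source and of a consistent deformation to the
class of their deformation current. -/
def IsLocallyRegular.currentPairing [SecondCountableTopology M] (hreg : IsLocallyRegular e z)
    (p : ℕ) : Hsrc e p →ₗ[ℝ] Hdef e (z 0) →ₗ[ℝ] Hcur e p :=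
  -- The map descends in the source first. After a flip it descends in the deformation, where
  -- vanishing is tested on classes of sources, and a second flip restores the order.
  (Submodule.liftQ _ (Submodule.liftQ _ (hreg.currentMap p) (fun ρ hρ => LinearMap.ext fun f => by
    obtain ⟨R, hR⟩ := exists_representsForm hreg.regular ρ.2.2
    refine (hreg.currentClass_eq hR).trans ((Submodule.Quotient.mk_eq_zero _).2 ?_)
    exact hreg.deformationCurrent_mem_trivialCurrents_of_trivialSource hR hρ f.2)).flip
    (fun f hf => LinearMap.ext fun c => by
      obtain ⟨ρ, rfl⟩ := Submodule.Quotient.mk_surjective _ c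
      obtain ⟨R, hR⟩ := exists_representsForm hreg.regular ρ.2.2
      refine (hreg.currentClass_eq hR).trans ((Submodule.Quotient.mk_eq_zero _).2 ?_)
      exact hreg.deformationCurrent_mem_trivialCurrents_of_trivialDeformation hR ρ.2 hf)).flip

end Regular

end DeformationCurrents

end

theorem mainTheorem2 {n : ℕ} {M : Type u} [TopologicalSpace M]
    [ChartedSpace (EuclideanSpace ℝ (Fin n)) M] [IsManifold (𝓡 n) ∞ M]
    [T2Space M] [SecondCountableTopology M] [ConnectedSpace M]
    (F : SmoothVB.{u, v, w} n M) (Z : ℕ → SmoothVB.{u, v, w} n M)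
    (e : Sec F →ₗ[ℝ] Sec (Z 0)) (z : ∀ i, Sec (Z i) →ₗ[ℝ] Sec (Z (i + 1)))
    (hreg : IsLocallyRegular e z) (p : ℕ) (hp : p ≤ n) :
    (∀ ρ ∈ nullSources e (n - p), ∃ R : Sec F → Sec (Z 0) →ₗ[ℝ] FormField n M (n - p),
      RepresentsForm e R ρ) ∧
    ∃! j : Hsrc e p →ₗ[ℝ] Hdef e (z 0) →ₗ[ℝ] Hcur e p,
      ∀ (ρ : nullSources e (n - p)) (f : deformations e (z 0))
        (R : Sec F → Sec (Z 0) →ₗ[ℝ] FormField n M (n - p)), RepresentsForm e R ρ.1 →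
        ∃ hj : deformationCurrent R f.1 ∈ conservedCurrents e (n - p),
          j (Submodule.Quotient.mk ρ) (Submodule.Quotient.mk f) =
            Submodule.Quotient.mk ⟨deformationCurrent R f.1, hj⟩ := by
  refine ⟨fun ρ hρ => exists_representsForm hreg.regular hρ.2,
    hreg.currentPairing p, fun ρ f R hR => ⟨_, hreg.currentClass_eq hR⟩, fun j hj => ?_⟩
  -- Uniqueness: all classes have representatives and every null source has a representing operator,
  -- so the required identity prescribes `j` on every pair.
  refine LinearMap.ext fun a => LinearMap.ext fun b => ?_
  obtain ⟨ρ, rfl⟩ := Submodule.Quotient.mk_surjective _ a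
  obtain ⟨f, rfl⟩ := Submodule.Quotient.mk_surjective _ b
  obtain ⟨R, hR⟩ := exists_representsForm hreg.regular ρ.2.2
  obtain ⟨_, h⟩ := hj ρ f R hR
  exact h.trans (hreg.currentClass_eq hR).symm
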